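/- Let $\sigma=(v_1,\dots,v_n)$ be an ordering of the vertices of a finite simple graph $G$. For vertex sets $U\subseteq W$, say that $W$ \emph{ends with} $U$ if no element of $W\setminus U$ occurs in $\sigma$ after an element of $U$, and that $W$ \emph{begins with} $U$ if this holds in the reversed ordering. Two sets \emph{overlap} if they intersect and neither is a subset of the other. The ordering $\sigma$ is \emph{$k$-clique extendable} if, whenever $X$ and $Y$ are overlapping cliques of size $k$ with $|X\cap Y|=k-1$ such that $X\cup Y$ begins with $X\setminus Y=\{a\}$ and ends with $Y\setminus X=\{b\}$, the vertices $a$ and $b$ are adjacent and $X\cup Y$ is a clique. \textbf{Theorem.} A maximum clique can be found in $O(k\,m^{k/2})$ time in a graph with $m$ edges, given a $k$-clique extendable ordering of it. Precisely: there are a single random access machine program $P$ and an absolute constant $C$ such that, for every integer $k\ge 2$, every nonempty finite simple graph $G$ without isolated vertices (in particular, every connected graph with at least two vertices) and every $k$-clique extendable ordering $\sigma$ of $G$, the program $P$, given $k$, the numbers $n$ of vertices and $m$ of edges, a list of the edges of $G$ (in arbitrary order) and the list $\sigma$, halts after at most $C\,k\,m^{k/2}$ elementary steps and outputs a clique of $G$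 of maximum size. (The machine has registers and zero-initialised random access arrays of natural numbers; register and array accesses, successor, predecessor, assignments and tests cost one step each.) -/

import Mathlib

/-! ### Clique extendable orderings -/

namespace CliqueOrdering

variable {V : Type*} [DecidableEq V] {n : ℕ}

/-- Two sets overlap if they intersect and neither is a subset of the other. -/
def Overlap (X Y : Finset V) : Prop :=
  (X ∩ Y).Nonempty ∧ ¬ X ⊆ Y ∧ ¬ Y ⊆ X

/-- An ordering `(v₁, …, vₙ)` of the vertices is a bijection `σ` from positions to vertices.
`W` ends with `U` if `U ⊆ W` and no element of `W \ U` occurs after an element of `U`. -/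
def EndsWith (σ : Fin n ≃ V) (W U : Finset V) : Prop :=
  U ⊆ W ∧ ∀ w ∈ W \ U, ∀ u ∈ U, ¬ σ.symm u < σ.symm w

/-- `W` begins with `U` if `W` ends with `U` in the reversed ordering `(vₙ, …, v₁)`. -/
def BeginsWith (σ : Fin n ≃ V) (W U : Finset V) : Prop :=
  EndsWith (Fin.revPerm.trans σ) W U

/-- `σ` is a `k`-clique extendable ordering of `G`. -/
def IsCliqueExtendable (G : SimpleGraph V) (σ : Fin n ≃ V) (k : ℕ) : Prop :=
  ∀ (X Y : Finset V) (a b : V), G.IsNClique k X → G.IsNClique k Y → Overlap X Y →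
    (X ∩ Y).card = k - 1 → X \ Y = {a} → Y \ X = {b} →
    BeginsWith σ (X ∪ Y) (X \ Y) → EndsWith σ (X ∪ Y) (Y \ X) →
    G.Adj a b ∧ G.IsClique (↑(X ∪ Y) : Set V)

end CliqueOrdering

/-! ### A random access machine with a step count

Programs are finite structured programs over scalar registers and zero-initialised arrays with
random access, all holding natural numbers. A program is a finite piece of syntax, so it mentions
only finitely many registers and arrays; register and array names are not computed. The only
arithmetic is successor and predecessor, so that `t` steps increase the largest number in memory
by at most `t` beyond the constants in the program: every number stays within the usual
logarithmic word length. -/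

namespace Ram

/-- Memory: `reg x` is the content of register `x`, `arr a i` is entry `i` of array `a`. -/
@[ext]
structure Memory where
  reg : ℕ → ℕ
  arr : ℕ → ℕ → ℕ

/-- Arithmetic expressions. -/
inductive Arith where
  | const (c : ℕ)
  | var (x : ℕ)
  | read (a : ℕ) (index : Arith)
  | succ (e : Arith)
  | pred (e : Arith)

/-- The value of an expression; the predecessor of `0` is `0`. -/
def Arith.eval (s : Memory) : Arith → ℕ
  | .const c => c
  | .var x => s.reg x
  | .read a i => s.arr a (i.eval s)
  | .succ e => e.eval s + 1
  | .pred e => e.eval s - 1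

/-- The number of elementary operations used to evaluate an expression. -/
def Arith.cost : Arith → ℕ
  | .const _ => 1
  | .var _ => 1
  | .read _ i => i.cost + 1
  | .succ e => e.cost + 1
  | .pred e => e.cost + 1

/-- Tests, used in conditionals and loops. -/
inductive Test where
  | lt (e f : Arith)
  | eq (e f : Arith)
  | neg (b : Test)
  | conj (b c : Test)

/-- The truth value of a test. -/
def Test.Holds (s : Memory) : Test → Prop
  | .lt e f => e.eval s < f.eval s
  | .eq e f => e.eval s = f.eval s
  | .neg b => ¬ b.Holds s
  | .conj b c => b.Holds s ∧ c.Holds s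

/-- The number of elementary operations used to evaluate a test. -/
def Test.cost : Test → ℕ
  | .lt e f => e.cost + f.cost + 1
  | .eq e f => e.cost + f.cost + 1
  | .neg b => b.cost + 1
  | .conj b c => b.cost + c.cost + 1

/-- Programs. -/
inductive Program where
  | skip
  | assign (x : ℕ) (e : Arith)
  | store (a : ℕ) (index value : Arith)
  | seq (p q : Program)
  | cond (b : Test) (p q : Program)
  | loop (b : Test) (p : Program)

/-- Write the value `v` to register `x`. -/
def Memory.setReg (s : Memory) (x v : ℕ) : Memory :=
  { s with reg := Function.update s.reg x v }

/-- Write the value `v` to entry `i` of array `a`. -/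
def Memory.setArr (s : Memory) (a i v : ℕ) : Memory :=
  { s with arr := Function.update s.arr a (Function.update (s.arr a) i v) }

/-- `Run p s t s'`: started in memory `s`, the program `p` halts after exactly `t` elementary
steps, with memory `s'`. Here `loop b p` repeats `p` as long as `b` holds. -/
inductive Run : Program → Memory → ℕ → Memory → Prop where
  | skip (s : Memory) : Run .skip s 1 s
  | assign (s : Memory) (x : ℕ) (e : Arith) :
      Run (.assign x e) s (e.cost + 1) (s.setReg x (e.eval s))
  | store (s : Memory) (a : ℕ) (i e : Arith) :
      Run (.store a i e) s (i.cost + e.cost + 1) (s.setArr a (i.eval s) (e.eval s))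
  | seq {p q : Program} {s s₁ s₂ : Memory} {t₁ t₂ : ℕ} :
      Run p s t₁ s₁ → Run q s₁ t₂ s₂ → Run (.seq p q) s (t₁ + t₂) s₂
  | condTrue {b : Test} {p q : Program} {s s' : Memory} {t : ℕ} :
      b.Holds s → Run p s t s' → Run (.cond b p q) s (b.cost + 1 + t) s'
  | condFalse {b : Test} {p q : Program} {s s' : Memory} {t : ℕ} :
      ¬ b.Holds s → Run q s t s' → Run (.cond b p q) s (b.cost + 1 + t) s'
  | loopStep {b : Test} {p : Program} {s s₁ s₂ : Memory} {t₁ t₂ : ℕ} :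
      b.Holds s → Run p s t₁ s₁ → Run (.loop b p) s₁ t₂ s₂ →
      Run (.loop b p) s (b.cost + 1 + t₁ + t₂) s₂
  | loopEnd {b : Test} {p : Program} {s : Memory} :
      ¬ b.Holds s → Run (.loop b p) s (b.cost + 1) s

/-- The machine is deterministic: running time and final memory are determined by the program
and the initial memory. -/
theorem Run.deterministic {p : Program} {s s₁ s₂ : Memory} {t₁ t₂ : ℕ}
    (h₁ : Run p s t₁ s₁) (h₂ : Run p s t₂ s₂) : t₁ = t₂ ∧ s₁ = s₂ := by
  induction h₁ generalizing t₂ s₂ with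
  | skip s => cases h₂; exact ⟨rfl, rfl⟩
  | assign s x e => cases h₂; exact ⟨rfl, rfl⟩
  | store s a i e => cases h₂; exact ⟨rfl, rfl⟩
  | seq _ _ ih₁ ih₂ =>
    cases h₂ with
    | seq g₁ g₂ =>
      obtain ⟨rfl, rfl⟩ := ih₁ g₁
      obtain ⟨rfl, rfl⟩ := ih₂ g₂
      exact ⟨rfl, rfl⟩
  | condTrue hb _ ih =>
    cases h₂ with
    | condTrue _ g => obtain ⟨rfl, rfl⟩ := ih g; exact ⟨rfl, rfl⟩
    | condFalse hb' _ => exact absurd hb hb'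
  | condFalse hb _ ih =>
    cases h₂ with
    | condTrue hb' _ => exact absurd hb' hb
    | condFalse _ g => obtain ⟨rfl, rfl⟩ := ih g; exact ⟨rfl, rfl⟩
  | loopStep hb _ _ ih₁ ih₂ =>
    cases h₂ with
    | loopStep _ g₁ g₂ =>
      obtain ⟨rfl, rfl⟩ := ih₁ g₁
      obtain ⟨rfl, rfl⟩ := ih₂ g₂
      exact ⟨rfl, rfl⟩
    | loopEnd hb' => exact absurd hb hb'
  | loopEnd hb =>
    cases h₂ with
    | loopStep hb' _ _ => exact absurd hb' hb
    | loopEnd _ => exact ⟨rfl, rfl⟩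

end Ram

/-! ### Input and output of the maximum clique problem -/

namespace MaxCliqueProblem

/-- `es` lists every edge of `G` exactly once, in any order and with its endpoints in either
order. -/
def ListsEdges {n : ℕ} (G : SimpleGraph (Fin n)) (es : List (Fin n × Fin n)) : Prop :=
  (es.map fun e => s(e.1, e.2)).Nodup ∧ ∀ u v, G.Adj u v ↔ s(u, v) ∈ es.map fun e => s(e.1, e.2)

/-- The initial memory. Registers `0`, `1`, `2` hold `k`, the number `n` of vertices and the
length `m` of the list of edges; array `0` holds the ordering `v₁, …, vₙ` of the vertices (whose
names are `0, …, n - 1`), and arrays `1` and `2` hold the two endpoints of the listed edges.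
Everything else is zero. -/
def input {n : ℕ} (k : ℕ) (σ : Fin n ≃ Fin n) (es : List (Fin n × Fin n)) : Ram.Memory where
  reg x := match x with
    | 0 => k
    | 1 => n
    | 2 => es.length
    | _ => 0
  arr a i := match a with
    | 0 => if h : i < n then (σ ⟨i, h⟩ : ℕ) else 0
    | 1 => if h : i < es.length then ((es[i]).1 : ℕ) else 0
    | 2 => if h : i < es.length then ((es[i]).2 : ℕ) else 0
    | _ => 0

/-- The memory `s` presents the set `Q` as the output: register `0` holds the number of elements
of `Q`, and that many first entries of array `3` are exactly the elements of `Q` (hence listed without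
repetition). -/
def Outputs {n : ℕ} (s : Ram.Memory) (Q : Finset (Fin n)) : Prop :=
  s.reg 0 = Q.card ∧ ∀ x : ℕ, (∃ i < s.reg 0, s.arr 3 i = x) ↔ ∃ v ∈ Q, (v : ℕ) = x

end MaxCliqueProblem

/-!
Put the vertices at positions `0, …, n - 1` in the given order. Extendability then says: if `Z` is
a set of `k - 1` positions, `a` lies before `Z`, `b` lies after `Z`, and both `Z ∪ {a}` and
`Z ∪ {b}` are cliques, then `a` and `b` are adjacent. Hence whether a clique `W` can be extended by
a later vertex `b` depends only on the last `k - 1` elements of `W`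
(`CliqueSearch.isClique_insert_lastPos`). For a set `Z` of `k - 1` positions let `gain Z` be the
size of the largest clique that ends with `Z`, minus `k - 1`. Every `k`-clique `X` gives
`gain (X without its last element) + 1 ≤ gain (X without its first element)`, and every nonzero
gain of a clique arises with equality from some `X` (`CliqueSearch.gain_dropLast_lt`,
`CliqueSearch.exists_of_gain_ne_zero`). All gains can thus be computed from the list of the
`k`-cliques, in the order of their last elements, and a maximum clique is recovered by following
the choices that attain the maxima.

Three points make this fit into `O(k m ^ (k / 2))` steps on a machine whose only arithmetic is
successor and predecessor.

* Listing the `k`-cliques. Every edge is directed towards its end of larger degree, so that all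
  out-degrees are at most `√(2 m)` (`Ram.EdgeTable.length_outList_le_sqrt`). A clique consists of
  its first vertex in this orientation and some out-neighbours of it, so there are at most
  `m (2 m) ^ (i / 2) / (i + 1)!` cliques of size `i + 2`, and the factorial pays for all
  polynomial factors (`Ram.IsOrientation.length_mul_sq_le`). The cliques are enumerated breadth
  first; the common out-neighbours of the members of a clique are found by counting marks along
  their out-lists (`Ram.wp_enumerate`, `Ram.IsOrientation.levelTime_le`).

* Comparing sets of `k - 1` positions. The sets are named by numbers, by partition refinement: the
  cliques are read position by position, and whenever a position is added to a set, the pair of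
  old name and position is turned into a new name in constant time (`Ram.wp_refineName`). Equal
  sets get equal names, so that the names can serve as indices of the array of gains.

* Order of evaluation. When the last element of a `k`-clique `X` is read, every `k`-clique that
  contributes to the gain of `X` without its last element ends earlier, so that this gain is already
  final (`Ram.Scores.gain_eq`, `Ram.wp_visit`).

If there are no `k`-cliques, the last clique in the breadth-first enumeration is a maximum clique
(`Ram.wp_outputLast_maximum`).
-/

set_option linter.unusedSimpArgs false

namespace Ram

/-! ### Weakest preconditions with running time -/

/-- `wp p s Q`: started in `s`, the program `p` halts, and its running time and final memory
satisfy `Q`. -/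
def wp (p : Program) (s : Memory) (Q : ℕ → Memory → Prop) : Prop :=
  ∃ t s', Run p s t s' ∧ Q t s'

@[simp] theorem Memory.reg_setReg (s : Memory) (x v y : ℕ) :
    (s.setReg x v).reg y = if y = x then v else s.reg y := by
  simp [Memory.setReg, Function.update_apply]

@[simp] theorem Memory.arr_setReg (s : Memory) (x v : ℕ) : (s.setReg x v).arr = s.arr := rfl

@[simp] theorem Memory.reg_setArr (s : Memory) (a i v : ℕ) : (s.setArr a i v).reg = s.reg := rfl

@[simp] theorem Memory.arr_setArr (s : Memory) (a i v b : ℕ) :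
    (s.setArr a i v).arr b = if b = a then Function.update (s.arr a) i v else s.arr b := by
  by_cases h : b = a
  · subst h; simp [Memory.setArr]
  · simp [Memory.setArr, h]

attribute [simp] Arith.eval Arith.cost Test.Holds Test.cost

theorem wp.mono {p : Program} {s : Memory} {Q Q' : ℕ → Memory → Prop} (h : wp p s Q)
    (hQ : ∀ t s', Q t s' → Q' t s') : wp p s Q' := by
  obtain ⟨t, s', hr, hq⟩ := h
  exact ⟨t, s', hr, hQ t s' hq⟩

@[simp] theorem wp_skip {s : Memory} {Q : ℕ → Memory → Prop} : wp .skip s Q ↔ Q 1 s := by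
  constructor
  · rintro ⟨t, s', hr, hq⟩; cases hr; exact hq
  · intro h; exact ⟨_, _, .skip s, h⟩

@[simp] theorem wp_assign {s : Memory} {x : ℕ} {e : Arith} {Q : ℕ → Memory → Prop} :
    wp (.assign x e) s Q ↔ Q (e.cost + 1) (s.setReg x (e.eval s)) := by
  constructor
  · rintro ⟨t, s', hr, hq⟩; cases hr; exact hq
  · intro h; exact ⟨_, _, .assign s x e, h⟩

@[simp] theorem wp_store {s : Memory} {a : ℕ} {i e : Arith} {Q : ℕ → Memory → Prop} :
    wp (.store a i e) s Q ↔ Q (i.cost + e.cost + 1) (s.setArr a (i.eval s) (e.eval s)) := by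
  constructor
  · rintro ⟨t, s', hr, hq⟩; cases hr; exact hq
  · intro h; exact ⟨_, _, .store s a i e, h⟩

@[simp] theorem wp_seq {p q : Program} {s : Memory} {Q : ℕ → Memory → Prop} :
    wp (.seq p q) s Q ↔ wp p s fun t₁ s₁ => wp q s₁ fun t₂ s₂ => Q (t₁ + t₂) s₂ := by
  constructor
  · rintro ⟨t, s', hr, hq⟩
    cases hr with
    | seq h₁ h₂ => exact ⟨_, _, h₁, _, _, h₂, hq⟩
  · rintro ⟨_, _, h₁, _, _, h₂, hq⟩
    exact ⟨_, _, .seq h₁ h₂, hq⟩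

theorem wp_cond {b : Test} {p q : Program} {s : Memory} {Q : ℕ → Memory → Prop} :
    wp (.cond b p q) s Q ↔
      (b.Holds s → wp p s fun t s' => Q (b.cost + 1 + t) s') ∧
      (¬ b.Holds s → wp q s fun t s' => Q (b.cost + 1 + t) s') := by
  constructor
  · rintro ⟨t, s', hr, hq⟩
    cases hr with
    | condTrue hb h => exact ⟨fun _ => ⟨_, _, h, hq⟩, fun hb' => absurd hb hb'⟩
    | condFalse hb h => exact ⟨fun hb' => absurd hb' hb, fun _ => ⟨_, _, h, hq⟩⟩
  · rintro ⟨h₁, h₂⟩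
    by_cases hb : b.Holds s
    · obtain ⟨t, s', hr, hq⟩ := h₁ hb
      exact ⟨_, _, .condTrue hb hr, hq⟩
    · obtain ⟨t, s', hr, hq⟩ := h₂ hb
      exact ⟨_, _, .condFalse hb hr, hq⟩

/-- The registers that a program may write. -/
def Program.regs : Program → List ℕ
  | .skip => []
  | .assign x _ => [x]
  | .store _ _ _ => []
  | .seq p q => p.regs ++ q.regs
  | .cond _ p q => p.regs ++ q.regs
  | .loop _ p => p.regs

/-- The arrays that a program may write. -/
def Program.arrs : Program → List ℕ
  | .skip => []
  | .assign _ _ => []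
  | .store a _ _ => [a]
  | .seq p q => p.arrs ++ q.arrs
  | .cond _ p q => p.arrs ++ q.arrs
  | .loop _ p => p.arrs

/-- `s'` agrees with `s` on all registers and arrays that `p` does not write. -/
structure Frame (p : Program) (s s' : Memory) : Prop where
  reg : ∀ x, x ∉ p.regs → s'.reg x = s.reg x
  arr : ∀ a, a ∉ p.arrs → s'.arr a = s.arr a

theorem Run.frame {p : Program} {s s' : Memory} {t : ℕ} (h : Run p s t s') : Frame p s s' := by
  induction h with
  | skip s => exact ⟨fun _ _ => rfl, fun _ _ => rfl⟩
  | assign s x e =>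
    refine ⟨fun y hy => ?_, fun _ _ => rfl⟩
    have : y ≠ x := by simpa [Program.regs] using hy
    simp [this]
  | store s a i e =>
    refine ⟨fun _ _ => rfl, fun b hb => ?_⟩
    have : b ≠ a := by simpa [Program.arrs] using hb
    simp [this]
  | seq _ _ ih₁ ih₂ =>
    refine ⟨fun x hx => ?_, fun a ha => ?_⟩
    · simp only [Program.regs, List.mem_append, not_or] at hx
      rw [ih₂.reg x hx.2, ih₁.reg x hx.1]
    · simp only [Program.arrs, List.mem_append, not_or] at ha
      rw [ih₂.arr a ha.2, ih₁.arr a ha.1]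
  | condTrue _ _ ih =>
    refine ⟨fun x hx => ?_, fun a ha => ?_⟩
    · simp only [Program.regs, List.mem_append, not_or] at hx
      exact ih.reg x hx.1
    · simp only [Program.arrs, List.mem_append, not_or] at ha
      exact ih.arr a ha.1
  | condFalse _ _ ih =>
    refine ⟨fun x hx => ?_, fun a ha => ?_⟩
    · simp only [Program.regs, List.mem_append, not_or] at hx
      exact ih.reg x hx.2
    · simp only [Program.arrs, List.mem_append, not_or] at ha
      exact ih.arr a ha.2
  | loopStep _ _ _ ih₁ ih₂ =>
    refine ⟨fun x hx => ?_, fun a ha => ?_⟩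
    · rw [ih₂.reg x hx, ih₁.reg x hx]
    · rw [ih₂.arr a ha, ih₁.arr a ha]
  | loopEnd _ => exact ⟨fun _ _ => rfl, fun _ _ => rfl⟩

theorem wp.frame {p : Program} {s : Memory} {Q : ℕ → Memory → Prop} (h : wp p s Q) :
    wp p s fun t s' => Frame p s s' ∧ Q t s' := by
  obtain ⟨t, s', hr, hq⟩ := h
  exact ⟨t, s', hr, hr.frame, hq⟩

/-- Total correctness of a loop that makes exactly `N` rounds. The invariant `I i t s` speaks of
the time `t` used by the first `i` rounds, so that amortised bounds can be carried along. -/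
theorem wp_loop {b : Test} {p : Program} {s₀ : Memory} {Q : ℕ → Memory → Prop} (N : ℕ)
    (I : ℕ → ℕ → Memory → Prop) (h0 : I 0 0 s₀)
    (hstep : ∀ i t s, i < N → Frame p s₀ s → I i t s →
      b.Holds s ∧ wp p s fun t' s' => I (i + 1) (t + (b.cost + 1 + t')) s')
    (hend : ∀ t s, Frame p s₀ s → I N t s → ¬ b.Holds s ∧ Q (t + (b.cost + 1)) s) :
    wp (.loop b p) s₀ Q := by
  have key : ∀ d i t s, i + d = N → Frame p s₀ s → I i t s →
      ∃ t' s', Run (.loop b p) s t' s' ∧ Q (t + t') s' := by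
    intro d
    induction d with
    | zero =>
      intro i t s hi hF hI
      obtain rfl : i = N := by omega
      obtain ⟨hb, hq⟩ := hend t s hF hI
      exact ⟨_, _, .loopEnd hb, hq⟩
    | succ d ih =>
      intro i t s hi hF hI
      obtain ⟨hb, t₁, s₁, hr, hI'⟩ := hstep i t s (by omega) hF hI
      have hF' : Frame p s₀ s₁ :=
        ⟨fun x hx => (hr.frame.reg x hx).trans (hF.reg x hx),
          fun a ha => (hr.frame.arr a ha).trans (hF.arr a ha)⟩
      obtain ⟨t₂, s₂, hr₂, hq⟩ := ih (i + 1) _ s₁ (by omega) hF' hI'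
      refine ⟨_, _, .loopStep hb hr hr₂, ?_⟩
      convert hq using 1
      omega
  obtain ⟨t', s', hr, hq⟩ := key N 0 0 s₀ (by omega) ⟨fun _ _ => rfl, fun _ _ => rfl⟩ h0
  exact ⟨t', s', hr, by simpa using hq⟩

/-! ### Names of the registers and arrays -/

/-!
Registers.
* `rK`, `rN`, `rM`: the input `k`, `n`, `m`; in the end `rK` is the size of the output.
* `rE`: an edge, a pointer into an incidence list, or a counter; `rU`, `rV`: the ends of an edge.
* `rP`: the position in the queue of the clique that is expanded; after the enumeration, of the
  first of the cliques of the last level. `rW`: the end of the queue. `rJ`: the size of the cliques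
  that are expanded. `rEnd`: the end of their level.
* `rI`: a counter, and the current position of the dynamic program; `rR`: a running position in the
  queue; `rX`, `rY`: a list pointer or a name, and a vertex.
* `rC`: a clique, given by its position in the queue. `rFresh`: the least unused name.
* `rTop`, `rTopName`: the largest gain, and the name of a set that attains it.
* `rA`, `rB`: the names of a clique without its first and without its last element.

Arrays.
* `aOrd`, `aFst`, `aSnd`: the input ordering and the ends of the edges; `aOut`: the output.
* `aDeg`: degrees; `aHead`, `aNext`, `aTgt`: the out-lists of the oriented graph.
* `aQueue`: the members of all cliques found, clique by clique; `aMark`: counters of marks.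
* `aOwner`, `aIncHead`, `aIncNext`: for every vertex, the list of its places in the queue, and the
  clique to which such a place belongs.
* `aCount`, `aNameA`, `aNameB`, `aLast`: for every clique, how many of its elements have been read,
  the names of the parts read of the clique without its first and without its last element,
  and its last vertex.
* `aStamp`, `aRename`, `aGain`, `aBest`: for every name, the last position at which it was refined,
  the result, the gain of the named set, and a clique that attains it.
-/

scoped infixr:60 " ;; " => Program.seq

scoped notation "rK" => (0 : ℕ)
scoped notation "rN" => (1 : ℕ)
scoped notation "rM" => (2 : ℕ)
scoped notation "rE" => (3 : ℕ)
scoped notation "rU" => (4 : ℕ)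
scoped notation "rV" => (5 : ℕ)
scoped notation "rP" => (6 : ℕ)
scoped notation "rW" => (7 : ℕ)
scoped notation "rJ" => (8 : ℕ)
scoped notation "rEnd" => (9 : ℕ)
scoped notation "rI" => (10 : ℕ)
scoped notation "rR" => (11 : ℕ)
scoped notation "rY" => (12 : ℕ)
scoped notation "rC" => (13 : ℕ)
scoped notation "rX" => (14 : ℕ)
scoped notation "rFresh" => (15 : ℕ)
scoped notation "rTop" => (16 : ℕ)
scoped notation "rTopName" => (17 : ℕ)
scoped notation "rA" => (18 : ℕ)
scoped notation "rB" => (19 : ℕ)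

scoped notation "aOrd" => (0 : ℕ)
scoped notation "aFst" => (1 : ℕ)
scoped notation "aSnd" => (2 : ℕ)
scoped notation "aOut" => (3 : ℕ)
scoped notation "aDeg" => (4 : ℕ)
scoped notation "aHead" => (5 : ℕ)
scoped notation "aNext" => (6 : ℕ)
scoped notation "aTgt" => (7 : ℕ)
scoped notation "aQueue" => (8 : ℕ)
scoped notation "aMark" => (9 : ℕ)
scoped notation "aOwner" => (10 : ℕ)
scoped notation "aIncNext" => (11 : ℕ)
scoped notation "aIncHead" => (12 : ℕ)
scoped notation "aCount" => (13 : ℕ)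
scoped notation "aNameA" => (14 : ℕ)
scoped notation "aNameB" => (15 : ℕ)
scoped notation "aStamp" => (16 : ℕ)
scoped notation "aRename" => (17 : ℕ)
scoped notation "aGain" => (18 : ℕ)
scoped notation "aBest" => (19 : ℕ)
scoped notation "aLast" => (20 : ℕ)

/-- Add one to a register. -/
abbrev incr (x : ℕ) : Program := .assign x (.succ (.var x))

/-! ### Linked lists -/

/-- The pointer `h` is the start of a linked list with the entries `l`. A pointer to the entry `e`
is stored as `e + 1`, and `0` is the null pointer, so that fresh memory holds empty lists. -/
def Linked (next : ℕ → ℕ) : ℕ → List ℕ → Prop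
  | h, [] => h = 0
  | h, e :: l => h = e + 1 ∧ Linked next (next e) l

theorem Linked.update {next : ℕ → ℕ} {e x : ℕ} :
    ∀ {l : List ℕ} {h : ℕ}, e ∉ l → Linked next h l → Linked (Function.update next e x) h l
  | [], _, _, hl => hl
  | f :: l, h, he, hl => by
    simp only [List.mem_cons, not_or] at he
    refine ⟨hl.1, ?_⟩
    rw [Function.update_of_ne (Ne.symm he.1)]
    exact Linked.update he.2 hl.2

theorem Linked.drop_lt {next : ℕ → ℕ} {h i : ℕ} {l : List ℕ} (hl : Linked next h (l.drop i))
    (hi : i < l.length) : h = l[i] + 1 ∧ Linked next (next l[i]) (l.drop (i + 1)) := by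
  rw [List.drop_eq_getElem_cons hi] at hl
  exact hl

/-- For every key `v`, the pointer `head v` starts a linked list of those members of `l` that have
the key `v`. -/
def Buckets (next head key : ℕ → ℕ) (l : List ℕ) : Prop :=
  ∀ v, Linked next (head v) (l.filter fun e => key e = v)

theorem Buckets.push {next head key : ℕ → ℕ} {l : List ℕ} {e u : ℕ}
    (h : Buckets next head key l) (he : e ∉ l) (hu : key e = u) :
    Buckets (Function.update next e (head u)) (Function.update head u (e + 1)) key
      (e :: l) := by
  intro v
  subst hu
  have hmem : e ∉ l.filter fun e => key e = v := fun h => he (List.mem_of_mem_filter h)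
  by_cases hv : key e = v
  · subst hv
    simp only [decide_true, List.filter_cons_of_pos, Linked, Function.update_self, true_and]
    exact (h (key e)).update hmem
  · rw [List.filter_cons_of_neg (by simpa using hv), Function.update_of_ne (Ne.symm hv)]
    exact (h v).update hmem

theorem Buckets.nil (next key : ℕ → ℕ) : Buckets next (fun _ => 0) key [] := fun _ => rfl

/-! ### Degrees and the oriented graph -/

/-- The list `[p + i - 1, …, p + 1, p]`. -/
def downTo (p : ℕ) : ℕ → List ℕ
  | 0 => []
  | i + 1 => (p + i) :: downTo p i

@[simp] theorem mem_downTo {p i x : ℕ} : x ∈ downTo p i ↔ p ≤ x ∧ x < p + i := by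
  induction i with
  | zero => simp [downTo]
  | succ i ih => simp only [downTo, List.mem_cons, ih]; omega

theorem nodup_downTo (p i : ℕ) : (downTo p i).Nodup := by
  induction i with
  | zero => simp [downTo]
  | succ i ih => simp [downTo, ih]

theorem update_succ_apply (f : ℕ → ℕ) (u v : ℕ) :
    Function.update f u (f u + 1) v = f v + if u = v then 1 else 0 := by
  by_cases h : u = v
  · subst h; simp
  · simp [h, Function.update_of_ne (Ne.symm h)]

/-- Count the degrees of all vertices. -/
def countDegrees : Program :=
  .assign rE (.const 0) ;;
  .loop (.lt (.var rE) (.var rM))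
    (.store aDeg (.read aFst (.var rE)) (.succ (.read aDeg (.read aFst (.var rE)))) ;;
     .store aDeg (.read aSnd (.var rE)) (.succ (.read aDeg (.read aSnd (.var rE)))) ;;
     incr rE)

/-- The number of ends at `v` of the first `i` listed edges. -/
def endCount (fst snd : ℕ → ℕ) (i v : ℕ) : ℕ :=
  ((Finset.range i).filter fun e => fst e = v).card +
  ((Finset.range i).filter fun e => snd e = v).card

theorem endCount_succ (fst snd : ℕ → ℕ) (i v : ℕ) :
    endCount fst snd (i + 1) v =
      endCount fst snd i v + (if fst i = v then 1 else 0) + (if snd i = v then 1 else 0) := by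
  simp only [endCount, Finset.range_add_one, Finset.filter_insert]
  split_ifs <;> simp <;> omega

theorem wp_countDegrees {s : Memory} (h : s.arr aDeg = fun _ => 0) :
    wp countDegrees s fun t s' => t ≤ 30 * s.reg rM + 10 ∧
      s'.arr aDeg = endCount (s.arr aFst) (s.arr aSnd) (s.reg rM) := by
  simp only [countDegrees, wp_seq, wp_assign]
  refine wp_loop (s.reg rM) (fun i t s' => t ≤ 30 * i ∧ s'.reg rE = i ∧
    s'.arr aDeg = endCount (s.arr aFst) (s.arr aSnd) i) ?_ ?_ ?_
  · simp only [Memory.arr_setReg, h]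
    exact ⟨Nat.zero_le _, by simp, by funext v; simp [endCount]⟩
  · rintro i t s' hi hF ⟨ht, hE, hD⟩
    have hM := hF.reg rM (by decide)
    have h1 := hF.arr aFst (by decide)
    have h2 := hF.arr aSnd (by decide)
    simp at hM h1 h2
    refine ⟨by simp [hE, hM, hi], ?_⟩
    simp [hE, hD, h1, h2]
    refine ⟨by omega, ?_⟩
    funext v
    rw [endCount_succ, update_succ_apply (Function.update _ _ _) _ v, update_succ_apply]
  · rintro t s' hF ⟨ht, hE, hD⟩
    have hM := hF.reg rM (by decide)
    simp at hM
    simp [hE, hM, hD]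
    omega

/-- The condition under which the edge `e` is directed from its first to its second end: the
degree of the first end is smaller, or the degrees are equal and its name is smaller. -/
def Forward (fst snd deg : ℕ → ℕ) (e : ℕ) : Prop :=
  deg (fst e) < deg (snd e) ∨ deg (fst e) = deg (snd e) ∧ fst e < snd e

instance (fst snd deg : ℕ → ℕ) (e : ℕ) : Decidable (Forward fst snd deg e) := by
  unfold Forward; infer_instance

/-- The start of the directed edge `e`. -/
def edgeSrc (fst snd deg : ℕ → ℕ) (e : ℕ) : ℕ :=
  if Forward fst snd deg e then fst e else snd e

/-- The end of the directed edge `e`. -/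
def edgeTgt (fst snd deg : ℕ → ℕ) (e : ℕ) : ℕ :=
  if Forward fst snd deg e then snd e else fst e

/-- Append the edge in register `rE` to the list of edges that leave the vertex in register `rU`. -/
def addArc : Program :=
  .store aTgt (.var rE) (.var rV) ;;
  .store aNext (.var rE) (.read aHead (.var rU)) ;;
  .store aHead (.var rU) (.succ (.var rE))

/-- Direct every edge towards the end of larger degree, and list the edges that leave each
vertex. -/
def orient : Program :=
  .assign rE (.const 0) ;;
  .loop (.lt (.var rE) (.var rM))
    (.assign rU (.read aFst (.var rE)) ;;
     .assign rV (.read aSnd (.var rE)) ;;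
     .cond (.conj (.neg (.lt (.read aDeg (.var rU)) (.read aDeg (.var rV))))
        (.neg (.conj (.eq (.read aDeg (.var rU)) (.read aDeg (.var rV)))
          (.lt (.var rU) (.var rV)))))
       (.assign rU (.read aSnd (.var rE)) ;; .assign rV (.read aFst (.var rE)))
       .skip ;;
     addArc ;;
     incr rE)

theorem wp_orient {s : Memory} {fst snd deg : ℕ → ℕ} (hh : s.arr aHead = fun _ => 0)
    (h1 : s.arr aFst = fst) (h2 : s.arr aSnd = snd) (hd : s.arr aDeg = deg) :
    wp orient s fun t s' => t ≤ 60 * s.reg rM + 10 ∧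
      Buckets (s'.arr aNext) (s'.arr aHead) (edgeSrc fst snd deg) (downTo 0 (s.reg rM)) ∧
      ∀ e < s.reg rM, s'.arr aTgt e = edgeTgt fst snd deg e := by
  simp only [orient, wp_seq, wp_assign]
  refine wp_loop (s.reg rM) (fun i t s' => t ≤ 60 * i ∧ s'.reg rE = i ∧
    Buckets (s'.arr aNext) (s'.arr aHead) (edgeSrc fst snd deg) (downTo 0 i) ∧
    ∀ e < i, s'.arr aTgt e = edgeTgt fst snd deg e) ?_ ?_ ?_
  · simp [hh, downTo, Buckets.nil]
  · rintro i t s' hi hF ⟨ht, hE, hB, hT⟩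
    have hM := hF.reg rM (by decide)
    have h1' := (hF.arr aFst (by decide)).trans h1
    have h2' := (hF.arr aSnd (by decide)).trans h2
    have hd' := (hF.arr aDeg (by decide)).trans hd
    simp at hM
    refine ⟨by simp [hE, hM, hi], ?_⟩
    simp only [wp_cond, wp_seq, addArc]
    simp only [hE, h1', h2', hd', wp_assign, wp_store, wp_skip, Arith.eval, Arith.cost,
      Test.Holds, Test.cost, Memory.reg_setReg, Memory.arr_setReg, Memory.reg_setArr,
      Memory.arr_setArr]
    simp only [Nat.reduceEqDiff, if_true, if_false]
    have hpush : ∀ u v, edgeSrc fst snd deg i = u → edgeTgt fst snd deg i = v →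
        Buckets (Function.update (s'.arr aNext) i (s'.arr aHead u))
          (Function.update (s'.arr aHead) u (i + 1)) (edgeSrc fst snd deg) (downTo 0 (i + 1)) ∧
        ∀ e < i + 1, Function.update (s'.arr aTgt) i v e = edgeTgt fst snd deg e := by
      intro u v hu hv
      refine ⟨by simpa [downTo] using hB.push (e := i) (by simp) hu, fun e he => ?_⟩
      by_cases hei : e = i
      · subst hei; simp [hv]
      · simp only [Function.update_of_ne hei]
        exact hT e (by omega)
    refine ⟨fun hc => ⟨by omega, trivial, ?_⟩, fun hc => ⟨by omega, trivial, ?_⟩⟩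
    · have hf : ¬ Forward fst snd deg i := by
        unfold Forward; tauto
      exact hpush _ _ (by simp [edgeSrc, hf]) (by simp [edgeTgt, hf])
    · have hf : Forward fst snd deg i := by
        unfold Forward; tauto
      exact hpush _ _ (by simp [edgeSrc, hf]) (by simp [edgeTgt, hf])
  · rintro t s' hF ⟨ht, hE, hB, hT⟩
    have hM := hF.reg rM (by decide)
    simp at hM
    simp [hE, hM]
    exact ⟨by omega, hB, hT⟩

/-! ### Breadth-first enumeration of the cliques -/

/-- The out-lists in memory list, for every vertex `v`, the members of `out v`. -/
def HasOut (s : Memory) (out : ℕ → List ℕ) : Prop :=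
  ∀ v, ∃ l, Linked (s.arr aNext) (s.arr aHead v) l ∧ l.map (s.arr aTgt) = out v

theorem HasOut.congr {s s' : Memory} {out : ℕ → List ℕ} (h : HasOut s out)
    (h1 : s'.arr aNext = s.arr aNext) (h2 : s'.arr aHead = s.arr aHead)
    (h3 : s'.arr aTgt = s.arr aTgt) : HasOut s' out := by
  unfold HasOut
  rw [h1, h2, h3]
  exact h

/-- For every member `y` of the list that starts in register `rX`, overwrite the mark of `y` with
the value of `e`. -/
def markList (e : Arith) : Program :=
  .loop (.neg (.eq (.var rX) (.const 0)))
    (.assign rY (.read aTgt (.pred (.var rX))) ;;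
     .store aMark (.var rY) e ;;
     .assign rX (.read aNext (.pred (.var rX))))

/-- The effect of `markList`: the mark of `z` is overwritten once for every occurrence of `z`. -/
theorem wp_markList {s : Memory} {e : Arith} {g : ℕ → ℕ} {l : List ℕ} (hc : e.cost ≤ 5)
    (he : ∀ s : Memory, e.eval s = g (s.arr aMark (s.reg rY)))
    (hl : Linked (s.arr aNext) (s.reg rX) l) :
    wp (markList e) s fun t s' => t ≤ 30 * l.length + 10 ∧
      s'.arr aMark = fun z => g^[(l.map (s.arr aTgt)).count z] (s.arr aMark z) := by
  refine wp_loop l.length (fun i t s' => t ≤ 30 * i ∧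
    Linked (s.arr aNext) (s'.reg rX) (l.drop i) ∧
    s'.arr aMark = fun z => g^[((l.take i).map (s.arr aTgt)).count z] (s.arr aMark z))
    ?_ ?_ ?_
  · exact ⟨Nat.zero_le _, by simpa using hl, by simp⟩
  · rintro i t s' hi hF ⟨ht, hL, hM⟩
    obtain ⟨hx, hL'⟩ := hL.drop_lt hi
    have hN := hF.arr aNext (by simp [Program.arrs])
    have hT := hF.arr aTgt (by simp [Program.arrs])
    refine ⟨by simp [hx], ?_⟩
    simp only [wp_seq, wp_assign, wp_store, he]
    simp only [Arith.eval, Arith.cost, Test.cost, Memory.reg_setReg, Memory.arr_setReg,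
      Memory.reg_setArr, Memory.arr_setArr, Nat.reduceEqDiff, if_true, if_false, hx, hN, hT,
      Nat.add_sub_cancel]
    refine ⟨by omega, hL', ?_⟩
    funext z
    rw [List.take_add_one, List.getElem?_eq_getElem hi]
    simp only [Option.toList_some, List.map_append, List.count_append, List.map_cons,
      List.map_nil, List.count_singleton, hM]
    by_cases hz : z = s.arr aTgt l[i]
    · subst hz
      simp [Function.iterate_succ_apply']
    · rw [Function.update_of_ne hz]
      simp [Ne.symm hz]
  · rintro t s' hF ⟨ht, hL, hM⟩
    rw [List.drop_length] at hL
    have hx : s'.reg rX = 0 := hL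
    refine ⟨by simp [hx], by simp; omega, by simpa using hM⟩

/-- Overwrite the marks along the out-lists of all members of the current clique. -/
def sweep (e : Arith) : Program :=
  .assign rR (.var rP) ;;
  .assign rI (.const 0) ;;
  .loop (.lt (.var rI) (.var rJ))
    (.assign rX (.read aHead (.read aQueue (.var rR))) ;;
     markList e ;;
     incr rR ;;
     incr rI)

theorem wp_sweep {s : Memory} {e : Arith} {g : ℕ → ℕ} {q : List ℕ} {out : ℕ → List ℕ} {D : ℕ}
    (hc : e.cost ≤ 5) (he : ∀ s : Memory, e.eval s = g (s.arr aMark (s.reg rY)))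
    (hout : HasOut s out) (hD : ∀ x ∈ q, (out x).length ≤ D) (hj : s.reg rJ = q.length)
    (hq : ∀ i (h : i < q.length), s.arr aQueue (s.reg rP + i) = q[i]) :
    wp (sweep e) s fun t s' => t ≤ q.length * (30 * D + 40) + 10 ∧
      s'.reg rR = s.reg rP + q.length ∧
      s'.arr aMark = fun z => g^[(q.flatMap out).count z] (s.arr aMark z) := by
  simp only [sweep, wp_seq, wp_assign]
  refine wp_loop q.length (fun i t s' => t ≤ i * (30 * D + 40) ∧
    s'.reg rI = i ∧ s'.reg rR = s.reg rP + i ∧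
    s'.arr aMark = fun z => g^[((q.take i).flatMap out).count z] (s.arr aMark z)) ?_ ?_ ?_
  · exact ⟨Nat.zero_le _, by simp, by simp, by simp⟩
  · rintro i t s' hi hF ⟨ht, hI, hR, hM⟩
    have hJ := hF.reg rJ (by simp [Program.regs, markList])
    have hN := hF.arr aNext (by simp [Program.arrs, markList])
    have hH := hF.arr aHead (by simp [Program.arrs, markList])
    have hT := hF.arr aTgt (by simp [Program.arrs, markList])
    have hQ := hF.arr aQueue (by simp [Program.arrs, markList])
    simp only [Memory.reg_setReg, Memory.arr_setReg, Nat.reduceEqDiff, if_false] at hJ hN hH hT hQ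
    refine ⟨by simp [hI, hJ, hj, hi], ?_⟩
    obtain ⟨l, hl, hlt⟩ := hout q[i]
    have hlen : l.length ≤ D := by
      have := hD q[i] (List.getElem_mem _)
      rw [← hlt, List.length_map] at this
      exact this
    rw [wp_seq, wp_assign, wp_seq]
    refine (wp_markList (l := l) hc he ?_).frame.mono ?_
    · simp only [Arith.eval, Memory.reg_setReg, Memory.arr_setReg, if_true]
      rw [hN, hH, hQ, hR, hq i hi]
      exact hl
    · rintro t₁ s₁ ⟨hF₁, ht₁, hM₁⟩
      have hR₁ := hF₁.reg rR (by simp [Program.regs, markList])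
      have hI₁ := hF₁.reg rI (by simp [Program.regs, markList])
      simp only [Memory.reg_setReg, Memory.arr_setReg, Nat.reduceEqDiff, if_false] at hR₁ hI₁ hM₁
      simp only [wp_seq, wp_assign, Arith.eval, Arith.cost, Test.cost, Memory.reg_setReg,
        Memory.arr_setReg, Nat.reduceEqDiff, if_true, if_false, hR₁, hI₁, hR, hI, true_and]
      refine ⟨by nlinarith, by omega, ?_⟩
      rw [hM₁, hM, hT, hlt]
      funext z
      rw [List.take_add_one, List.getElem?_eq_getElem hi]
      simp only [Option.toList_some, List.flatMap_append, List.count_append, List.flatMap_cons,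
        List.flatMap_nil, List.append_nil]
      rw [add_comm, Function.iterate_add_apply]
  · rintro t s' hF ⟨ht, hI, hR, hM⟩
    have hJ := hF.reg rJ (by simp [Program.regs, markList])
    simp only [Memory.reg_setReg, Nat.reduceEqDiff, if_false] at hJ
    refine ⟨by simp [hI, hJ, hj], by simp; omega, hR, by simpa using hM⟩

/-- The first entries of the array `Q` are the members of the list `F`. -/
def Holds (Q : ℕ → ℕ) (F : List ℕ) : Prop :=
  ∀ i (h : i < F.length), Q i = F[i]

theorem Holds.push {Q : ℕ → ℕ} {F : List ℕ} (h : Holds Q F) (v : ℕ) :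
    Holds (Function.update Q F.length v) (F ++ [v]) := by
  intro i hi
  rw [List.length_append, List.length_singleton] at hi
  rcases Nat.lt_succ_iff_lt_or_eq.mp hi with hi' | rfl
  · rw [Function.update_of_ne hi'.ne, List.getElem_append_left hi']
    exact h i hi'
  · simp

theorem Holds.segment {Q : ℕ → ℕ} {a q b : List ℕ} (h : Holds Q (a ++ q ++ b)) (i : ℕ)
    (hi : i < q.length) : Q (a.length + i) = q[i] := by
  rw [h _ (by simp; omega)]
  simp [List.getElem_append, hi]

/-- Append a copy of the current clique to the queue. -/
def copyClique : Program :=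
  .assign rR (.var rP) ;;
  .assign rI (.const 0) ;;
  .loop (.lt (.var rI) (.var rJ))
    (.store aQueue (.var rW) (.read aQueue (.var rR)) ;;
     incr rW ;;
     incr rR ;;
     incr rI)

theorem wp_copyClique {s : Memory} {a q b : List ℕ} (hQ : Holds (s.arr aQueue) (a ++ q ++ b))
    (hP : s.reg rP = a.length) (hW : s.reg rW = (a ++ q ++ b).length)
    (hj : s.reg rJ = q.length) :
    wp copyClique s fun t s' => t ≤ 30 * q.length + 10 ∧
      Holds (s'.arr aQueue) (a ++ q ++ b ++ q) ∧
      s'.reg rW = (a ++ q ++ b ++ q).length := by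
  simp only [copyClique, wp_seq, wp_assign]
  refine wp_loop q.length (fun i t s' => t ≤ 30 * i ∧ s'.reg rI = i ∧
    s'.reg rR = a.length + i ∧ Holds (s'.arr aQueue) (a ++ q ++ b ++ q.take i) ∧
      s'.reg rW = (a ++ q ++ b ++ q.take i).length) ?_ ?_ ?_
  · refine ⟨Nat.zero_le _, by simp, by simp [hP], by simpa using hQ, by simpa using hW⟩
  · rintro i t s' hi hF ⟨ht, hI, hR, hQ', hW'⟩
    have hJ := hF.reg rJ (by decide)
    simp only [Memory.reg_setReg, Nat.reduceEqDiff, if_false] at hJ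
    refine ⟨by simp [hI, hJ, hj, hi], ?_⟩
    simp only [wp_seq, wp_assign, wp_store, Arith.eval, Arith.cost, Test.cost, Memory.reg_setReg,
      Memory.arr_setReg, Memory.reg_setArr, Memory.arr_setArr, Nat.reduceEqDiff, if_true, if_false,
      hI, hR, hW', true_and]
    have hseg : s'.arr aQueue (a.length + i) = q[i] := by
      rw [List.append_assoc (a ++ q) b] at hQ'
      exact hQ'.segment i hi
    have htake : q.take (i + 1) = q.take i ++ [q[i]] := by simp
    refine ⟨by omega, by omega, ?_, ?_⟩
    · rw [hseg, htake, ← List.append_assoc]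
      exact hQ'.push _
    · rw [htake]; simp; omega
  · rintro t s' hF ⟨ht, hI, hR, hQ', hW'⟩
    have hJ := hF.reg rJ (by decide)
    simp only [Memory.reg_setReg, Nat.reduceEqDiff, if_false] at hJ
    rw [List.take_length] at hQ' hW'
    refine ⟨by simp [hI, hJ, hj], by simp; omega, hQ', hW'⟩

/-- Append to the queue the extensions of the current clique by each of the out-neighbours of its
first member whose mark is the size of the clique. -/
def pushExtensions : Program :=
  .assign rX (.read aHead (.read aQueue (.var rP))) ;;
  .loop (.neg (.eq (.var rX) (.const 0)))
    (.assign rY (.read aTgt (.pred (.var rX))) ;;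
     .cond (.eq (.read aMark (.var rY)) (.var rJ))
       (copyClique ;; .store aQueue (.var rW) (.var rY) ;; incr rW)
       .skip ;;
     .assign rX (.read aNext (.pred (.var rX))))

/-- The queue is `a ++ q ++ b`, where `q` is the clique that is expanded; `ys` lists the vertices
that extend it. -/
theorem wp_pushExtensions {s : Memory} {a b q ys : List ℕ} {l : List ℕ}
    (hQ : Holds (s.arr aQueue) (a ++ q ++ b)) (hq : q ≠ [])
    (hP : s.reg rP = a.length) (hW : s.reg rW = (a ++ q ++ b).length)
    (hj : s.reg rJ = q.length) (hl : Linked (s.arr aNext) (s.arr aHead (q.headD 0)) l)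
    (hys : ys = (l.map (s.arr aTgt)).filter fun y => s.arr aMark y = q.length) :
    wp pushExtensions s fun t s' =>
      t ≤ 40 * l.length + 20 + 60 * (ys.flatMap fun y => q ++ [y]).length ∧
      Holds (s'.arr aQueue) (a ++ q ++ b ++ ys.flatMap fun y => q ++ [y]) ∧
      s'.reg rW = (a ++ q ++ b ++ ys.flatMap fun y => q ++ [y]).length := by
  simp only [pushExtensions, wp_seq, wp_assign]
  let f : ℕ → List ℕ := fun i => (((l.take i).map (s.arr aTgt)).filter
    fun y => s.arr aMark y = q.length).flatMap fun y => q ++ [y]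
  have hf : f l.length = ys.flatMap fun y => q ++ [y] := by
    simp only [f, hys, List.take_length]
  refine wp_loop l.length (fun i t s' => t ≤ 40 * i + 60 * (f i).length ∧
    Linked (s.arr aNext) (s'.reg rX) (l.drop i) ∧
    Holds (s'.arr aQueue) (a ++ q ++ b ++ f i) ∧
    s'.reg rW = (a ++ q ++ b ++ f i).length) ?_ ?_ ?_
  · refine ⟨Nat.zero_le _, ?_, by simpa [f] using hQ, by simpa [f] using hW⟩
    obtain ⟨x, q, rfl⟩ := List.exists_cons_of_ne_nil hq
    have hx : s.arr aQueue a.length = x := by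
      exact hQ.segment 0 (by simp)
    simpa [hP, hx] using hl
  · rintro i t s' hi hF ⟨ht, hL, hQ', hW'⟩
    obtain ⟨hx, hL'⟩ := hL.drop_lt hi
    have hN := hF.arr aNext (by decide)
    have hT := hF.arr aTgt (by decide)
    have hM := hF.arr aMark (by decide)
    have hP' := hF.reg rP (by decide)
    have hJ' := hF.reg rJ (by decide)
    simp only [Memory.reg_setReg, Memory.arr_setReg, Nat.reduceEqDiff, if_false]
      at hN hT hM hP' hJ'
    refine ⟨by simp [hx], ?_⟩
    simp only [wp_seq, wp_assign, wp_cond, wp_skip, wp_store, Arith.eval, Arith.cost, Test.cost,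
      Test.Holds, Memory.reg_setReg, Memory.arr_setReg, Nat.reduceEqDiff, if_true, if_false, hx,
      hN, hT, hM, hJ', hj, Nat.add_sub_cancel]
    have hfi : f (i + 1) = f i ++ if s.arr aMark (s.arr aTgt l[i]) = q.length then
        q ++ [s.arr aTgt l[i]] else [] := by
      simp only [f]
      rw [List.take_add_one, List.getElem?_eq_getElem hi]
      simp only [Option.toList_some, List.map_append, List.map_cons, List.map_nil,
        List.filter_append, List.flatMap_append]
      congr 1
      by_cases hm : s.arr aMark (s.arr aTgt l[i]) = q.length <;> simp [hm]
    refine ⟨fun hm => ?_, fun hm => ?_⟩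
    · rw [if_pos hm] at hfi
      have hQ₁ := hQ'
      rw [List.append_assoc (a ++ q)] at hQ₁ hW'
      refine (wp_copyClique (a := a) (q := q) (b := b ++ f i) (by simpa using hQ₁)
        (by simpa [hP] using hP') (by simpa using hW') (by simp [hJ', hj])).frame.mono ?_
      rintro t₁ s₁ ⟨hF₁, ht₁, hQ₂, hW₂⟩
      have hY₁ := hF₁.reg rY (by decide)
      have hX₁ := hF₁.reg rX (by decide)
      have hN₁ := hF₁.arr aNext (by decide)
      simp only [Memory.reg_setReg, Memory.arr_setReg, Nat.reduceEqDiff, if_true, if_false]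
        at hX₁ hY₁ hN₁
      simp only [Memory.reg_setReg, Memory.arr_setReg, Memory.reg_setArr, Memory.arr_setArr,
        Nat.reduceEqDiff, if_true, if_false, hX₁, hY₁, hN₁, hN, hx, Nat.add_sub_cancel, hW₂, hfi]
      refine ⟨by simp; omega, hL', ?_, ?_⟩
      · have := hQ₂.push (s.arr aTgt l[i])
        simpa using this
      · simp; omega
    · rw [if_neg hm, List.append_nil] at hfi
      simp only [Memory.reg_setReg, Memory.arr_setReg, Nat.reduceEqDiff, if_true, if_false, hx, hN,
        Nat.add_sub_cancel, hfi]
      exact ⟨by omega, hL', hQ', hW'⟩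
  · rintro t s' hF ⟨ht, hL, hQ', hW'⟩
    rw [List.drop_length] at hL
    have hx : s'.reg rX = 0 := hL
    rw [hf] at ht hQ' hW'
    exact ⟨by simp [hx], by simp only [Arith.cost, Test.cost]; omega, hQ', hW'⟩

/-- The vertices that extend the clique `q`: the out-neighbours of its first member that lie in the
out-lists of all its members, which is decided by counting. -/
def extensions (out : ℕ → List ℕ) (q : List ℕ) : List ℕ :=
  (out (q.headD 0)).filter fun y => (q.flatMap out).count y = q.length

/-- The cliques that extend `q` by one vertex. -/
def expand (out : ℕ → List ℕ) (q : List ℕ) : List (List ℕ) :=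
  (extensions out q).map fun y => q ++ [y]

/-- The total length of the out-lists of the members of `q`. -/
def outWeight (out : ℕ → List ℕ) (q : List ℕ) : ℕ := (q.map fun x => (out x).length).sum

theorem length_le_outWeight {out : ℕ → List ℕ} {q : List ℕ} {x : ℕ} (hx : x ∈ q) :
    (out x).length ≤ outWeight out q :=
  List.single_le_sum (by simp) _ (List.mem_map_of_mem (f := fun x => (out x).length) hx)

/-- Append all extensions of the current clique to the queue, and go to the next clique. -/
def expandClique : Program :=
  sweep (.succ (.read aMark (.var rY))) ;;
  pushExtensions ;;
  sweep (.const 0) ;;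
  .assign rP (.var rR)

/-- The marks are zero before and after; in between they count in how many out-lists of members
of `q` a vertex lies. -/
theorem wp_expandClique {s : Memory} {a b q : List ℕ} {out : ℕ → List ℕ}
    (hout : HasOut s out)
    (hQ : Holds (s.arr aQueue) (a ++ q ++ b)) (hq : q ≠ [])
    (hP : s.reg rP = a.length) (hW : s.reg rW = (a ++ q ++ b).length)
    (hj : s.reg rJ = q.length) (hM : s.arr aMark = fun _ => 0) :
    wp expandClique s fun t s' =>
      t ≤ 250 * (q.length * (outWeight out q + 1)) + 60 * (expand out q).flatten.length ∧
      Holds (s'.arr aQueue) (a ++ q ++ b ++ (expand out q).flatten) ∧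
      s'.reg rW = (a ++ q ++ b ++ (expand out q).flatten).length ∧
      s'.reg rP = (a ++ q).length ∧ s'.arr aMark = fun _ => 0 := by
  have hD : ∀ x ∈ q, (out x).length ≤ outWeight out q := fun x => length_le_outWeight
  generalize outWeight out q = D at *
  simp only [expandClique, wp_seq]
  refine (wp_sweep (g := Nat.succ) (by simp) (by simp) hout hD hj
    (by rw [hP]; exact hQ.segment)).frame.mono ?_
  rintro t₁ s₁ ⟨hF₁, ht₁, hR₁, hM₁⟩
  obtain ⟨l, hl, hlt⟩ := hout (q.headD 0)
  have hTgt := hF₁.arr aTgt (by simp [Program.arrs, markList, sweep])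
  have hQ₁ := hF₁.arr aQueue (by simp [Program.arrs, markList, sweep])
  have hM₁' : ∀ z, s₁.arr aMark z = (q.flatMap out).count z := by
    intro z; rw [hM₁, hM]; simp [Nat.succ_iterate]
  have hN₁ := hF₁.arr aNext (by simp [Program.arrs, markList, sweep])
  have hH₁ := hF₁.arr aHead (by simp [Program.arrs, markList, sweep])
  have hP₁ := hF₁.reg rP (by simp [Program.regs, markList, sweep])
  have hW₁ := hF₁.reg rW (by simp [Program.regs, markList, sweep])
  have hJ₁ := hF₁.reg rJ (by simp [Program.regs, markList, sweep])
  refine (wp_pushExtensions (a := a) (b := b) (q := q) (l := l) (ys := extensions out q)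
    (by rw [hQ₁]; exact hQ) hq (by rw [hP₁, hP]) (by rw [hW₁, hW]) (by rw [hJ₁, hj])
    (by rw [hN₁, hH₁]; exact hl)
    (by rw [hTgt, hlt]; simp only [hM₁']; rfl)).frame.mono ?_
  rintro t₂ s₂ ⟨hF₂, ht₂, hQ₂, hW₂⟩
  have hfl : ((extensions out q).flatMap fun y => q ++ [y]) = (expand out q).flatten := by
    rw [expand, List.flatMap_def]
  rw [hfl] at ht₂ hQ₂ hW₂
  have hP₂ := hF₂.reg rP (by decide)
  have hJ₂ := hF₂.reg rJ (by decide)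
  have hM₂ := hF₂.arr aMark (by decide)
  refine (wp_sweep (g := fun _ => 0) (q := q) (out := out) (D := D) (by simp) (by simp) ?_ hD
    (by rw [hJ₂, hJ₁, hj]) ?_).frame.mono ?_
  · refine hout.congr ?_ ?_ ?_
    · rw [hF₂.arr aNext (by decide), hN₁]
    · rw [hF₂.arr aHead (by decide), hH₁]
    · rw [hF₂.arr aTgt (by decide), hTgt]
  · rw [hP₂, hP₁, hP]
    rw [List.append_assoc (a ++ q)] at hQ₂
    exact hQ₂.segment
  · rintro t₃ s₃ ⟨hF₃, ht₃, hR₃, hM₃⟩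
    have hQ₃ := hF₃.arr aQueue (by simp [Program.arrs, markList, sweep])
    have hW₃ := hF₃.reg rW (by simp [Program.regs, markList, sweep])
    simp only [wp_assign, Arith.eval, Arith.cost, Memory.reg_setReg, Memory.arr_setReg,
      Nat.reduceEqDiff, if_true, if_false, hQ₃, hW₃, hR₃, hP₂, hP₁, hP, hW₂]
    have hlD : l.length ≤ D := by
      have := hD (q.headD 0) (by obtain ⟨x, q, rfl⟩ := List.exists_cons_of_ne_nil hq; simp)
      rwa [← hlt, List.length_map] at this
    have hq0 : 1 ≤ q.length := List.length_pos_iff.mpr hq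
    refine ⟨by nlinarith, hQ₂, trivial, by simp, ?_⟩
    rw [hM₃]
    funext z
    rw [hM₂, hM₁']
    cases h : (q.flatMap out).count z with
    | zero => rfl
    | succ c => rw [Function.iterate_succ_apply']

/-- A bound for the time in which the clique `q` is expanded, without the time for the output. -/
def expandTime (out : ℕ → List ℕ) (q : List ℕ) : ℕ := 260 * (q.length * (outWeight out q + 1))

/-- Expand all cliques of the current size. -/
def expandLevel : Program :=
  .assign rEnd (.var rW) ;;
  .loop (.lt (.var rP) (.var rEnd)) expandClique

theorem wp_expandLevel {s : Memory} {a : List ℕ} {L : List (List ℕ)} {out : ℕ → List ℕ}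
    (hout : HasOut s out)
    (hQ : Holds (s.arr aQueue) (a ++ L.flatten))
    (hP : s.reg rP = a.length) (hW : s.reg rW = (a ++ L.flatten).length)
    (hj : ∀ q ∈ L, q.length = s.reg rJ) (hj0 : 0 < s.reg rJ) (hM : s.arr aMark = fun _ => 0) :
    wp expandLevel s fun t s' =>
      t ≤ (L.map (expandTime out)).sum + 60 * (L.flatMap (expand out)).flatten.length
        + 10 ∧
      Holds (s'.arr aQueue) (a ++ L.flatten ++ (L.flatMap (expand out)).flatten) ∧
      s'.reg rW = (a ++ L.flatten ++ (L.flatMap (expand out)).flatten).length ∧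
      s'.reg rP = (a ++ L.flatten).length ∧ s'.arr aMark = fun _ => 0 := by
  simp only [expandLevel, wp_seq, wp_assign]
  let f : ℕ → List ℕ := fun i => ((L.take i).flatMap (expand out)).flatten
  refine wp_loop L.length (fun i t s' =>
      t ≤ ((L.take i).map (expandTime out)).sum + 60 * (f i).length ∧
      Holds (s'.arr aQueue) (a ++ L.flatten ++ f i) ∧
      s'.reg rW = (a ++ L.flatten ++ f i).length ∧
      s'.reg rP = (a ++ (L.take i).flatten).length ∧ s'.arr aMark = fun _ => 0) ?_ ?_ ?_
  · exact ⟨Nat.zero_le _, by simpa [f] using hQ, by simpa [f] using hW, by simp [hP],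
      by simp [hM]⟩
  · rintro i t s' hi hF ⟨ht, hQ', hW', hP', hM'⟩
    have hJ := hF.reg rJ (by simp [Program.regs, markList, sweep, expandClique, pushExtensions,
      copyClique])
    have hE := hF.reg rEnd (by simp [Program.regs, markList, sweep, expandClique, pushExtensions,
      copyClique])
    simp only [Memory.reg_setReg, Nat.reduceEqDiff, if_true, if_false, Arith.eval, hW] at hJ hE
    have hqL : L[i] ∈ L := List.getElem_mem _
    have hlen := hj _ hqL
    have hsplit : L.flatten = (L.take i).flatten ++ L[i] ++ (L.drop (i + 1)).flatten := by
      conv_lhs => rw [← List.take_append_drop i L, List.drop_eq_getElem_cons hi]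
      rw [List.flatten_append, List.flatten_cons, List.append_assoc]
    have htake : L.take (i + 1) = L.take i ++ [L[i]] := by simp
    refine ⟨?_, ?_⟩
    · simp only [Test.Holds, Arith.eval, hP', hE]
      rw [hsplit]
      simp
      omega
    · refine (wp_expandClique (a := a ++ (L.take i).flatten) (q := L[i])
        (b := (L.drop (i + 1)).flatten ++ f i) (out := out) ?_ ?_ ?_ hP' ?_
        (by rw [hJ, hlen]) hM').mono ?_
      · refine hout.congr ?_ ?_ ?_ <;>
        · rw [hF.arr _ (by simp [Program.arrs, markList, sweep, expandClique, pushExtensions,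
            copyClique]), Memory.arr_setReg]
      · rw [hsplit] at hQ'
        simpa using hQ'
      · intro h; rw [h] at hlen; simp at hlen; omega
      · rw [hW', hsplit]; simp
      · rintro t₁ s₁ ⟨ht₁, hQ₁, hW₁, hP₁, hM₁⟩
        have hfi : f (i + 1) = f i ++ (expand out L[i]).flatten := by
          simp only [f]
          rw [htake, List.flatMap_append, List.flatten_append, List.flatMap_singleton]
        refine ⟨?_, ?_, ?_, ?_, hM₁⟩
        · rw [htake, List.map_append, List.sum_append, List.map_singleton, List.sum_singleton]
          simp only [Arith.cost, Test.cost, hfi, List.length_append, expandTime]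
          have : 1 ≤ L[i].length * (outWeight out L[i] + 1) :=
            Nat.mul_pos (by omega) (by omega)
          omega
        · rw [hfi, hsplit]; simpa using hQ₁
        · rw [hW₁, hfi, hsplit]; simp
        · rw [hP₁, htake, List.flatten_append, List.flatten_singleton, List.append_assoc]
  · rintro t s' hF ⟨ht, hQ', hW', hP', hM'⟩
    have hE := hF.reg rEnd (by simp [Program.regs, markList, sweep, expandClique, pushExtensions,
      copyClique])
    simp only [Memory.reg_setReg, Nat.reduceEqDiff, if_true, Arith.eval, hW] at hE
    rw [List.take_length] at hP' ht
    have hf : f L.length = (L.flatMap (expand out)).flatten := by simp [f]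
    rw [hf] at ht hQ' hW'
    refine ⟨by simp [hP', hE], ?_, hQ', hW', hP', hM'⟩
    simp only [Arith.cost, Test.cost]
    omega

/-- `cliqueLevel out n i` lists the cliques with `i + 1` vertices: those of level `0` are the
vertices, and each further level extends the cliques of the previous one. -/
def cliqueLevel (out : ℕ → List ℕ) (n : ℕ) : ℕ → List (List ℕ)
  | 0 => (List.range n).map fun v => [v]
  | i + 1 => (cliqueLevel out n i).flatMap (expand out)

/-- The members of the cliques of the first `i` levels. -/
def levelsBelow (out : ℕ → List ℕ) (n : ℕ) : ℕ → List ℕ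
  | 0 => []
  | i + 1 => levelsBelow out n i ++ (cliqueLevel out n i).flatten

theorem length_of_mem_cliqueLevel {out : ℕ → List ℕ} {n : ℕ} :
    ∀ {i : ℕ} {q : List ℕ}, q ∈ cliqueLevel out n i → q.length = i + 1
  | 0, q, h => by
    simp only [cliqueLevel, List.mem_map] at h
    obtain ⟨v, -, rfl⟩ := h
    rfl
  | i + 1, q, h => by
    simp only [cliqueLevel, List.mem_flatMap, expand, List.mem_map] at h
    obtain ⟨q, hq, y, -, rfl⟩ := h
    simp [length_of_mem_cliqueLevel hq]

theorem length_flatten_cliqueLevel (out : ℕ → List ℕ) (n i : ℕ) :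
    (cliqueLevel out n i).flatten.length = (cliqueLevel out n i).length * (i + 1) := by
  rw [List.length_flatten, List.sum_eq_card_nsmul _ (i + 1)]
  · simp
  · intro x hx
    obtain ⟨q, hq, rfl⟩ := List.mem_map.mp hx
    exact length_of_mem_cliqueLevel hq

/-- Fill the queue with the cliques of size at most `k`, stopping early when there are no more
cliques. -/
def enumerate : Program :=
  .assign rI (.const 0) ;;
  .loop (.lt (.var rI) (.var rN)) (.store aQueue (.var rI) (.var rI) ;; incr rI) ;;
  .assign rP (.const 0) ;;
  .assign rW (.var rN) ;;
  .assign rJ (.const 1) ;;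
  .loop (.conj (.lt (.var rJ) (.var rK)) (.lt (.var rP) (.var rW)))
    (expandLevel ;; incr rJ)

/-- The time for expanding level `i`. -/
def levelTime (out : ℕ → List ℕ) (n i : ℕ) : ℕ :=
  ((cliqueLevel out n i).map (expandTime out)).sum +
    60 * ((cliqueLevel out n (i + 1)).length * (i + 1 + 1)) + 30

/-- The enumeration ends with level `N`, which is either the level of the `k`-cliques or the first
empty level. -/
theorem wp_enumerate {s : Memory} {out : ℕ → List ℕ} {n k N : ℕ} (hout : HasOut s out)
    (hn : s.reg rN = n) (hk : s.reg rK = k)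
    (hM : s.arr aMark = fun _ => 0)
    (hN : N + 1 ≤ k) (hlow : ∀ i < N, cliqueLevel out n i ≠ [])
    (hlast : N + 1 = k ∨ cliqueLevel out n N = []) :
    wp enumerate s fun t s' =>
      t ≤ 20 * n + 40 + ∑ i ∈ Finset.range N, levelTime out n i ∧
      Holds (s'.arr aQueue) (levelsBelow out n (N + 1)) ∧
      s'.reg rP = (levelsBelow out n N).length ∧
      s'.reg rW = (levelsBelow out n (N + 1)).length ∧ s'.reg rJ = N + 1 := by
  simp only [enumerate, wp_seq, wp_assign]
  refine wp_loop n (fun i t s' => t ≤ 20 * i ∧ s'.reg rI = i ∧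
    Holds (s'.arr aQueue) (List.range i)) ?_ ?_ ?_
  · exact ⟨Nat.zero_le _, by simp, by simp [Holds]⟩
  · rintro i t s' hi hF ⟨ht, hI, hQ⟩
    have hN := hF.reg rN (by decide)
    simp only [Memory.reg_setReg, Nat.reduceEqDiff, if_false, hn] at hN
    refine ⟨by simp [hI, hN, hi], ?_⟩
    simp only [wp_seq, wp_assign, Test.cost, Arith.cost, wp_store, Arith.eval,
      Memory.reg_setReg, Memory.arr_setReg,
      Memory.reg_setArr, Memory.arr_setArr, if_true, hI, true_and]
    refine ⟨by omega, ?_⟩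
    rw [List.range_succ]
    simpa using hQ.push i
  · rintro t s₁ hF₁ ⟨ht, hI, hQ⟩
    have hN₁ := hF₁.reg rN (by decide)
    have hK₁ := hF₁.reg rK (by decide)
    have hM₁ := hF₁.arr aMark (by decide)
    simp only [Memory.reg_setReg, Memory.arr_setReg, Nat.reduceEqDiff, if_false, hn, hk, hM]
      at hN₁ hK₁ hM₁
    refine ⟨by simp [hI, hN₁], ?_⟩
    have hout₁ : HasOut s₁ out := hout.congr (by rw [hF₁.arr _ (by decide)]; rfl)
      (by rw [hF₁.arr _ (by decide)]; rfl) (by rw [hF₁.arr _ (by decide)]; rfl)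
    have hfl : ∀ i, ((cliqueLevel out n i).flatMap (expand out)).flatten =
      (cliqueLevel out n (i + 1)).flatten := fun i => rfl
    refine wp_loop N (fun i t s' => t ≤ ∑ i ∈ Finset.range i, levelTime out n i ∧
      Holds (s'.arr aQueue) (levelsBelow out n (i + 1)) ∧
      s'.reg rP = (levelsBelow out n i).length ∧
      s'.reg rW = (levelsBelow out n (i + 1)).length ∧ s'.reg rJ = i + 1 ∧
      s'.arr aMark = fun _ => 0) ?_ ?_ ?_
    · have h0 : levelsBelow out n 1 = List.range n := by
        rw [levelsBelow, levelsBelow, cliqueLevel, ← List.flatMap_def]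
        simp
      refine ⟨Nat.zero_le _, ?_, ?_, ?_, by simp, by simp [hM₁]⟩
      · rw [h0]; exact hQ
      · simp [levelsBelow]
      · rw [h0]; simp [hN₁]
    · rintro i t₂ s₂ hi hF₂ ⟨ht₂, hQ₂, hP₂, hW₂, hJ₂, hM₂⟩
      have hK₂ := hF₂.reg rK (by simp [Program.regs, markList, sweep, expandLevel, expandClique,
        pushExtensions, copyClique])
      simp only [Memory.reg_setReg, Nat.reduceEqDiff, if_false, hK₁] at hK₂
      have hne : 0 < (cliqueLevel out n i).length := List.length_pos_iff.mpr (hlow i hi)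
      refine ⟨⟨?_, ?_⟩, ?_⟩
      · simp [hJ₂, hK₂]; omega
      · simp only [Test.Holds, Arith.eval, hP₂, hW₂, levelsBelow, List.length_append,
          length_flatten_cliqueLevel]
        nlinarith
      · rw [wp_seq]
        refine (wp_expandLevel (a := levelsBelow out n i) (L := cliqueLevel out n i) (out := out)
          ?_ hQ₂ hP₂ hW₂ ?_ (by omega) hM₂).frame.mono ?_
        · refine hout₁.congr ?_ ?_ ?_ <;>
          · rw [hF₂.arr _ (by simp [Program.arrs, markList, sweep, expandLevel, expandClique,
              pushExtensions, copyClique])]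
            rfl
        · rintro q hq; rw [hJ₂, length_of_mem_cliqueLevel hq]
        · rintro t₃ s₃ ⟨hF₃, ht₃, hQ₃, hW₃, hP₃, hM₃⟩
          have hJ₃ := hF₃.reg rJ (by simp [Program.regs, markList, sweep, expandLevel,
            expandClique, pushExtensions, copyClique])
          rw [hfl, length_flatten_cliqueLevel] at ht₃
          simp only [wp_assign, Arith.eval, Arith.cost, Test.cost, Memory.reg_setReg,
            Memory.arr_setReg, Nat.reduceEqDiff, if_true, if_false, hJ₃, hJ₂, hP₃, hW₃, hM₃,
            Finset.sum_range_succ]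
          refine ⟨?_, hQ₃, rfl, rfl, trivial, trivial⟩
          rw [levelTime]
          omega
    · rintro t₂ s₂ hF₂ ⟨ht₂, hQ₂, hP₂, hW₂, hJ₂, hM₂⟩
      have hK₂ := hF₂.reg rK (by simp [Program.regs, markList, sweep, expandLevel, expandClique,
        pushExtensions, copyClique])
      simp only [Memory.reg_setReg, Nat.reduceEqDiff, if_false, hK₁] at hK₂
      refine ⟨?_, ?_, hQ₂, hP₂, hW₂, hJ₂⟩
      · rintro ⟨h₁, h₂⟩
        simp only [Test.Holds, Arith.eval, hJ₂, hK₂, hP₂, hW₂] at h₁ h₂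
        rcases hlast with h | h
        · omega
        · simp [levelsBelow, h] at h₂
      · simp only [Test.cost, Arith.cost]
        omega

end Ram

namespace CliqueSearch

open Finset

/-! ### Cliques and orderings -/

/-- `W` ends with `Z` in the natural order. -/
def EndsIn (W Z : Finset ℕ) : Prop :=
  Z ⊆ W ∧ ∀ w ∈ W, w ∉ Z → ∀ z ∈ Z, w < z

theorem EndsIn.refl (Z : Finset ℕ) : EndsIn Z Z := ⟨Subset.rfl, fun _ h h' => absurd h h'⟩

/-- Clique extendability for the natural order, with `Z` the intersection of the two cliques. -/
def Extendable (H : SimpleGraph ℕ) (k : ℕ) : Prop :=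
  ∀ (Z : Finset ℕ) (a b : ℕ), Z.card = k - 1 → (∀ z ∈ Z, a < z) → (∀ z ∈ Z, z < b) →
    H.IsClique (insert a Z : Finset ℕ) → H.IsClique (insert b Z : Finset ℕ) → H.Adj a b

/-- The least element of `X`. -/
noncomputable def firstPos (X : Finset ℕ) : ℕ := sInf (X : Set ℕ)

/-- The greatest element of `X`. -/
def lastPos (X : Finset ℕ) : ℕ := X.sup id

theorem firstPos_mem {X : Finset ℕ} (h : X.Nonempty) : firstPos X ∈ X :=
  Nat.sInf_mem (s := (X : Set ℕ)) h

theorem firstPos_le {X : Finset ℕ} {x : ℕ} (h : x ∈ X) : firstPos X ≤ x :=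
  Nat.sInf_le (s := (X : Set ℕ)) h

theorem lastPos_mem {X : Finset ℕ} (h : X.Nonempty) : lastPos X ∈ X := by
  obtain ⟨x, hx, he⟩ := exists_mem_eq_sup X h id
  rw [lastPos, he]; exact hx

theorem le_lastPos {X : Finset ℕ} {x : ℕ} (h : x ∈ X) : x ≤ lastPos X :=
  le_sup (f := id) h

theorem firstPos_lt_lastPos {X : Finset ℕ} (h : 1 < X.card) : firstPos X < lastPos X := by
  obtain ⟨a, ha, b, hb, hab⟩ := one_lt_card.mp h
  have h1 := firstPos_le ha
  have h2 := firstPos_le hb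
  have h3 := le_lastPos ha
  have h4 := le_lastPos hb
  omega

/-- `X` without its first element. -/
noncomputable def dropFirst (X : Finset ℕ) : Finset ℕ := X.erase (firstPos X)

/-- `X` without its last element. -/
def dropLast (X : Finset ℕ) : Finset ℕ := X.erase (lastPos X)

theorem card_dropLast {X : Finset ℕ} {k : ℕ} (hk : 1 ≤ k) (h : X.card = k) :
    (dropLast X).card = k - 1 := by
  rw [dropLast, card_erase_of_mem (lastPos_mem (card_pos.mp (by omega))), h]

theorem lt_lastPos_of_mem_dropLast {X : Finset ℕ} {x : ℕ} (h : x ∈ dropLast X) :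
    x < lastPos X := by
  rw [dropLast, mem_erase] at h
  exact lt_of_le_of_ne (le_lastPos h.2) h.1

theorem lastPos_mem_dropFirst {X : Finset ℕ} (h : 1 < X.card) : lastPos X ∈ dropFirst X := by
  rw [dropFirst, mem_erase]
  exact ⟨(firstPos_lt_lastPos h).ne', lastPos_mem (card_pos.mp (by omega))⟩

section Gain

variable {H : SimpleGraph ℕ} {k n : ℕ}

/-- The key consequence of extendability: a clique that ends with the first `k - 1` elements of a
`k`-clique `X` stays a clique when the last element of `X` is added. -/
theorem isClique_insert_lastPos (hE : Extendable H k) {W X : Finset ℕ}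
    (hk : 2 ≤ k) (hX : H.IsNClique k X) (hW : H.IsClique (W : Set ℕ))
    (hend : EndsIn W (dropLast X)) :
    lastPos X ∉ W ∧ H.IsClique (insert (lastPos X) W : Finset ℕ) ∧
      EndsIn (insert (lastPos X) W) (dropFirst X) := by
  have hcard := hX.card_eq
  have hne : X.Nonempty := card_pos.mp (by omega)
  have hlt := firstPos_lt_lastPos (X := X) (by omega)
  have hf : firstPos X ∈ dropLast X := mem_erase.mpr ⟨hlt.ne, firstPos_mem hne⟩
  have hins : insert (lastPos X) (dropLast X) = X := insert_erase (lastPos_mem hne)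
  refine ⟨fun hmem => ?_, ?_, ?_, ?_⟩
  · have := hend.2 _ hmem (by simp [dropLast]) _ hf
    omega
  · rw [coe_insert]
    refine hW.insert fun w hw _ => ?_
    by_cases hwZ : w ∈ dropLast X
    · exact (hX.isClique (mem_coe.mpr (mem_of_mem_erase hwZ)) (mem_coe.mpr (lastPos_mem hne))
        (lt_lastPos_of_mem_dropLast hwZ).ne).symm
    · refine (hE (dropLast X) w (lastPos X) (card_dropLast (by omega) hcard)
        (hend.2 w hw hwZ) (fun z => lt_lastPos_of_mem_dropLast) (hW.subset ?_) ?_).symm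
      · rw [coe_insert]
        exact Set.insert_subset hw hend.1
      · rw [hins]; exact hX.isClique
  · intro x hx
    rw [dropFirst, mem_erase] at hx
    by_cases h : x = lastPos X
    · simp [h]
    · exact mem_insert_of_mem (hend.1 (mem_erase.mpr ⟨h, hx.2⟩))
  · intro w hw hwZ z hz
    have hz' : z ≠ firstPos X ∧ z ∈ X := by simpa [dropFirst] using hz
    have hfz := firstPos_le hz'.2
    rcases mem_insert.mp hw with rfl | hw
    · exact absurd (lastPos_mem_dropFirst (by omega)) hwZ
    · by_cases hwX : w = firstPos X
      · omega
      · have : w ∉ dropLast X := fun h => hwZ (mem_erase.mpr ⟨hwX, mem_of_mem_erase h⟩)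
        have := hend.2 w hw this _ hf
        omega

open Classical in
/-- By how much the largest clique of positions below `n` that ends with `Z` exceeds the size
`k - 1`. It is `0` if there is no such clique. -/
noncomputable def gain (H : SimpleGraph ℕ) (k n : ℕ) (Z : Finset ℕ) : ℕ :=
  ((range n).powerset.filter fun W : Finset ℕ => H.IsClique (W : Set ℕ) ∧ EndsIn W Z).sup
    fun W => W.card - (k - 1)

/-- The gain of `Z` bounds every clique that ends with `Z`. -/
theorem le_gain {W Z : Finset ℕ} (hn : W ⊆ range n) (hW : H.IsClique (W : Set ℕ))
    (hend : EndsIn W Z) : W.card - (k - 1) ≤ gain H k n Z := by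
  classical
  exact le_sup (f := fun W : Finset ℕ => W.card - (k - 1))
    (mem_filter.mpr ⟨mem_powerset.mpr hn, hW, hend⟩)

theorem exists_gain_eq {Z : Finset ℕ} (hn : Z ⊆ range n) (hZ : H.IsClique (Z : Set ℕ)) :
    ∃ W ⊆ range n, H.IsClique (W : Set ℕ) ∧ EndsIn W Z ∧ gain H k n Z = W.card - (k - 1) := by
  classical
  obtain ⟨W, hW, he⟩ := exists_mem_eq_sup
    ((range n).powerset.filter fun W : Finset ℕ => H.IsClique (W : Set ℕ) ∧ EndsIn W Z)
    ⟨Z, by simp [hn, hZ, EndsIn.refl]⟩ fun W => W.card - (k - 1)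
  simp only [mem_filter, mem_powerset] at hW
  exact ⟨W, hW.1, hW.2.1, hW.2.2, he⟩

/-- A largest clique that ends with `dropLast X` can be extended by the last element of `X`. -/
theorem gain_dropLast_lt (hE : Extendable H k) (hk : 2 ≤ k) {X : Finset ℕ}
    (hX : H.IsNClique k X) (hn : X ⊆ range n) :
    gain H k n (dropLast X) + 1 ≤ gain H k n (dropFirst X) := by
  have hsub : dropLast X ⊆ X := erase_subset _ _
  obtain ⟨W, hWn, hW, hend, he⟩ := exists_gain_eq (k := k) (H := H) (hsub.trans hn)
    (hX.isClique.subset (coe_subset.mpr hsub))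
  obtain ⟨h1, h2, h3⟩ := isClique_insert_lastPos hE hk hX hW hend
  have hmem : lastPos X ∈ range n :=
    hn (lastPos_mem (card_pos.mp (by rw [hX.card_eq]; omega)))
  have := le_gain (k := k) (insert_subset hmem hWn) h2 h3
  rw [card_insert_of_notMem h1] at this
  have hc : (dropLast X).card ≤ W.card := card_le_card hend.1
  rw [card_dropLast (by omega) hX.card_eq] at hc
  omega

/-- The converse of `gain_dropLast_lt`: a clique larger than `k - 1` that ends with `Z` contains the
`k`-clique `X` of its last `k` elements, and without its last element it ends with `dropLast X`. -/
theorem exists_of_gain_ne_zero (hk : 2 ≤ k) {Z : Finset ℕ} (hn : Z ⊆ range n)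
    (hZ : H.IsClique (Z : Set ℕ)) (hc : Z.card = k - 1) (h0 : gain H k n Z ≠ 0) :
    ∃ X ⊆ range n, H.IsNClique k X ∧ dropFirst X = Z ∧
      gain H k n Z ≤ gain H k n (dropLast X) + 1 := by
  obtain ⟨W, hWn, hW, hend, he⟩ := exists_gain_eq (k := k) hn hZ
  have hcW : Z.card < W.card := by omega
  have hne : (W \ Z).Nonempty := by
    rw [sdiff_nonempty]
    intro h
    have := card_le_card h
    omega
  obtain ⟨haW, haZ⟩ := mem_sdiff.mp (lastPos_mem hne)
  generalize hadef : lastPos (W \ Z) = a at *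
  have hmax : ∀ w ∈ W, w ∉ Z → w ≤ a := fun w h1 h2 =>
    hadef ▸ le_lastPos (mem_sdiff.mpr ⟨h1, h2⟩)
  have haz := hend.2 a haW haZ
  have hXW : insert a Z ⊆ W := insert_subset haW hend.1
  have hXc : (insert a Z).card = k := by rw [card_insert_of_notMem haZ]; omega
  have hXne : (insert a Z).Nonempty := insert_nonempty _ _
  have hfirst : firstPos (insert a Z) = a := by
    refine le_antisymm (firstPos_le (mem_insert_self _ _)) ?_
    rcases mem_insert.mp (firstPos_mem hXne) with h | h
    · exact h.ge
    · exact (haz _ h).le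
  have hlt := firstPos_lt_lastPos (X := insert a Z) (by omega)
  refine ⟨insert a Z, hXW.trans hWn, ⟨hW.subset (coe_subset.mpr hXW), hXc⟩, ?_, ?_⟩
  · rw [dropFirst, hfirst, erase_insert haZ]
  · have hlast : lastPos (insert a Z) ∈ W := hXW (lastPos_mem hXne)
    have : EndsIn (W.erase (lastPos (insert a Z))) (dropLast (insert a Z)) := by
      refine ⟨erase_subset_erase _ hXW, fun w hw hwZ z hz => ?_⟩
      rw [mem_erase] at hw
      have hwX : w ∉ insert a Z := fun h => hwZ (mem_erase.mpr ⟨hw.1, h⟩)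
      rw [mem_insert, not_or] at hwX
      have h1 := hmax w hw.2 hwX.2
      have h2 := firstPos_le (mem_of_mem_erase hz)
      rw [hfirst] at h2
      have := hwX.1
      omega
    have hle := le_gain (k := k) (n := n) ((erase_subset _ _).trans hWn)
      (hW.subset (coe_subset.mpr (erase_subset _ _))) this
    rw [card_erase_of_mem hlast] at hle
    omega

theorem exists_endsIn (W : Finset ℕ) : ∀ r ≤ W.card, ∃ Z, EndsIn W Z ∧ Z.card = r
  | 0, _ => ⟨∅, ⟨empty_subset _, by simp⟩, rfl⟩
  | r + 1, hr => by
    obtain ⟨Z, hZ, hc⟩ := exists_endsIn W r (by omega)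
    have hne : (W \ Z).Nonempty := by
      rw [sdiff_nonempty]
      intro h
      have := card_le_card h
      omega
    obtain ⟨haW, haZ⟩ := mem_sdiff.mp (lastPos_mem hne)
    refine ⟨insert (lastPos (W \ Z)) Z, ⟨insert_subset haW hZ.1, fun w hw hwZ z hz => ?_⟩,
      by rw [card_insert_of_notMem haZ, hc]⟩
    rw [mem_insert, not_or] at hwZ
    have := le_lastPos (mem_sdiff.mpr ⟨hw, hwZ.2⟩)
    rcases mem_insert.mp hz with rfl | hz
    · have := hwZ.1
      omega
    · exact hZ.2 w hw hwZ.2 z hz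

end Gain

end CliqueSearch

namespace Ram

open CliqueSearch Finset MaxCliqueProblem

/-! ### Incidence lists of the `k`-cliques -/

/-- For every vertex, list the entries of the queue, from position `rP` on, that hold this vertex.
The owner of an entry is the position at which its clique starts. -/
def buildIncidence : Program :=
  .assign rR (.var rP) ;;
  .loop (.lt (.var rR) (.var rW))
    (.assign rC (.var rR) ;;
     .assign rI (.const 0) ;;
     .loop (.lt (.var rI) (.var rK))
       (.store aOwner (.var rR) (.var rC) ;;
        .store aIncNext (.var rR) (.read aIncHead (.read aQueue (.var rR))) ;;
        .store aIncHead (.read aQueue (.var rR)) (.succ (.var rR)) ;;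
        incr rR ;;
        incr rI))

/-- The incidence lists of the `N` cliques of size `k` that fill the queue from position `p` on. -/
theorem wp_buildIncidence {s : Memory} {p k N : ℕ} (hk : s.reg rK = k) (hk0 : 0 < k)
    (hP : s.reg rP = p) (hW : s.reg rW = p + N * k) (hh : s.arr aIncHead = fun _ => 0) :
    wp buildIncidence s fun t s' => t ≤ 80 * (N * k) + 20 ∧
      Buckets (s'.arr aIncNext) (s'.arr aIncHead) (s.arr aQueue) (downTo p (N * k)) ∧
      ∀ b < N, ∀ i < k, s'.arr aOwner (p + b * k + i) = p + b * k := by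
  simp only [buildIncidence, wp_seq, wp_assign]
  refine wp_loop N (fun b t s' => t ≤ 80 * (b * k) ∧ s'.reg rR = p + b * k ∧
    Buckets (s'.arr aIncNext) (s'.arr aIncHead) (s.arr aQueue) (downTo p (b * k)) ∧
    ∀ b' < b, ∀ i < k, s'.arr aOwner (p + b' * k + i) = p + b' * k) ?_ ?_ ?_
  · refine ⟨Nat.zero_le _, by simp [hP], ?_, by simp⟩
    simp [downTo, hh, Buckets.nil]
  · rintro b t s₁ hb hF₁ ⟨ht, hR, hB, hO⟩
    have hK₁ := hF₁.reg rK (by decide)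
    have hW₁ := hF₁.reg rW (by decide)
    have hQ₁ := hF₁.arr aQueue (by decide)
    simp only [Memory.reg_setReg, Memory.arr_setReg, Nat.reduceEqDiff, if_false, hk, hW]
      at hK₁ hW₁ hQ₁
    have hbk : b * k + k ≤ N * k := by
      rw [← Nat.succ_mul]; exact Nat.mul_le_mul_right k hb
    refine ⟨by simp only [Test.Holds, Arith.eval, hR, hW₁]; omega, ?_⟩
    simp only [wp_seq, wp_assign]
    refine wp_loop k (fun i t' s' => t' ≤ 40 * i ∧ s'.reg rI = i ∧ s'.reg rR = p + b * k + i ∧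
      Buckets (s'.arr aIncNext) (s'.arr aIncHead) (s.arr aQueue) (downTo p (b * k + i)) ∧
      (∀ b' < b, ∀ i < k, s'.arr aOwner (p + b' * k + i) = p + b' * k) ∧
      ∀ i' < i, s'.arr aOwner (p + b * k + i') = p + b * k) ?_ ?_ ?_
    · exact ⟨Nat.zero_le _, by simp, by simp [hR], by simpa using hB, by simpa using hO, by simp⟩
    · rintro i t' s' hi hF' ⟨ht', hI', hR', hB', hO', hO''⟩
      have hK' := hF'.reg rK (by decide)
      have hC' := hF'.reg rC (by decide)
      have hQ' := hF'.arr aQueue (by decide)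
      simp only [Memory.reg_setReg, Memory.arr_setReg, Arith.eval, Nat.reduceEqDiff, if_true,
        if_false, hK₁, hQ₁, hR] at hK' hC' hQ'
      refine ⟨by simp [hI', hK', hi], ?_⟩
      simp only [wp_seq, wp_assign, wp_store, Arith.eval, Arith.cost, Test.cost, Memory.reg_setReg,
        Memory.arr_setReg, Memory.reg_setArr, Memory.arr_setArr, Nat.reduceEqDiff, if_true,
        if_false, hI', hR', hC', hQ', true_and]
      refine ⟨by omega, by omega, ?_, fun b' hb' i' hi' => ?_, fun i' hi' => ?_⟩
      · rw [← add_assoc, downTo, ← add_assoc]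
        exact hB'.push (by simp; omega) rfl
      · rw [Function.update_of_ne]
        · exact hO' b' hb' i' hi'
        · have : b' * k + k ≤ b * k := by
            rw [← Nat.succ_mul]; exact Nat.mul_le_mul_right k hb'
          omega
      · rcases Nat.lt_succ_iff_lt_or_eq.mp hi' with h | rfl
        · rw [Function.update_of_ne (by omega)]
          exact hO'' i' h
        · simp
    · rintro t' s' hF' ⟨ht', hI', hR', hB', hO', hO''⟩
      have hK' := hF'.reg rK (by decide)
      simp only [Memory.reg_setReg, Nat.reduceEqDiff, if_false, hK₁] at hK'
      refine ⟨by simp [hI', hK'], ?_, ?_, ?_, ?_⟩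
      · simp only [Arith.cost, Test.cost, Nat.succ_mul]; omega
      · rw [hR', Nat.succ_mul]; ring
      · rw [Nat.succ_mul]; exact hB'
      · intro b' hb' i hi
        rcases Nat.lt_succ_iff_lt_or_eq.mp hb' with h | rfl
        · exact hO' b' h i hi
        · exact hO'' i hi
  · rintro t s₁ hF₁ ⟨ht, hR, hB, hO⟩
    have hW₁ := hF₁.reg rW (by decide)
    simp only [Memory.reg_setReg, Nat.reduceEqDiff, if_false, hW] at hW₁
    refine ⟨by simp [hR, hW₁], ?_, hB, hO⟩
    simp only [Arith.cost, Test.cost]; omega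

/-! ### Naming sets by partition refinement -/

/-- The numbers below register `rFresh` are distinct names of sets of positions: `x` is the name of
`φ x`. While position `i` is processed, a name `x` of a set without `i` is stamped with `i + 1` as
soon as the set with `i` added has a name, which is then found in `aRename`. -/
structure Names (s : Memory) (φ : ℕ → Finset ℕ) (i : ℕ) : Prop where
  pos : 0 < s.reg rFresh
  inj : ∀ x < s.reg rFresh, ∀ y < s.reg rFresh, φ x = φ y → x = y
  bound : ∀ x < s.reg rFresh, ∀ z ∈ φ x, z ≤ i
  stamp_le : ∀ x, s.arr aStamp x ≤ i + 1
  stamp_fresh : ∀ x, s.reg rFresh ≤ x → s.arr aStamp x = 0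
  stamped : ∀ x < s.reg rFresh, i ∉ φ x → s.arr aStamp x = i + 1 →
    s.arr aRename x < s.reg rFresh ∧ φ (s.arr aRename x) = insert i (φ x)
  unstamped : ∀ x < s.reg rFresh, i ∉ φ x → s.arr aStamp x ≠ i + 1 →
    ∀ y < s.reg rFresh, φ y ≠ insert i (φ x)

/-- In the array `nm` of names, replace the name of a set by the name of the set with the position
in register `rI` added. -/
def refineName (nm : ℕ) : Program :=
  .assign rX (.read nm (.var rC)) ;;
  .cond (.eq (.read aStamp (.var rX)) (.succ (.var rI)))
    .skip
    (.store aStamp (.var rX) (.succ (.var rI)) ;;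
     .store aRename (.var rX) (.var rFresh) ;;
     incr rFresh) ;;
  .store nm (.var rC) (.read aRename (.var rX))

/-- After the refinement, the entry `c` of `nm` is the name of its set with `i` added, and old names
keep their meaning. -/
theorem wp_refineName {s : Memory} {φ : ℕ → Finset ℕ} {nm c i x : ℕ} (h16 : nm ≠ aStamp)
    (h17 : nm ≠ aRename) (h : Names s φ i) (hC : s.reg rC = c) (hI : s.reg rI = i)
    (hnm : s.arr nm c = x) (hx : x < s.reg rFresh) (hi : i ∉ φ x) :
    wp (refineName nm) s fun t s' => t ≤ 60 ∧ ∃ φ' x', Names s' φ' i ∧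
      s.reg rFresh ≤ s'.reg rFresh ∧ (∀ y < s.reg rFresh, φ' y = φ y) ∧
      s'.arr nm = Function.update (s.arr nm) c x' ∧ x' < s'.reg rFresh ∧
      φ' x' = insert i (φ x) := by
  simp only [refineName, wp_seq, wp_assign, wp_store, wp_cond, wp_skip, Arith.eval, Arith.cost,
    Test.cost, Test.Holds, Memory.reg_setReg, Memory.arr_setReg, Memory.reg_setArr,
    Memory.arr_setArr, Nat.reduceEqDiff, if_true, if_false, hC, hI, hnm, h16, h17]
  refine ⟨fun hs => ⟨by norm_num, φ, _, ⟨h.pos, h.inj, h.bound, ?_, ?_, ?_, ?_⟩, le_rfl,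
    fun _ _ => rfl, rfl, h.stamped x hx hi hs⟩, fun hs => ?_⟩
  · simpa [h16.symm] using h.stamp_le
  · simpa [h16.symm] using h.stamp_fresh
  · simpa [h16.symm, h17.symm] using h.stamped
  · simpa [h16.symm] using h.unstamped
  · have hne : ∀ y < s.reg rFresh, φ y ≠ insert i (φ x) := h.unstamped x hx hi hs
    refine ⟨by norm_num, Function.update φ (s.reg rFresh) (insert i (φ x)), s.reg rFresh, ?_,
      by simp, fun y hy => Function.update_of_ne hy.ne _ _, by simp, by simp, by simp⟩
    have hφ : ∀ y < s.reg rFresh,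
        Function.update φ (s.reg rFresh) (insert i (φ x)) y = φ y :=
      fun y hy => Function.update_of_ne hy.ne _ _
    constructor <;> simp only [Memory.reg_setReg, Memory.arr_setReg, Memory.reg_setArr,
      Memory.arr_setArr, Nat.reduceEqDiff, if_true, if_false, h16.symm, h17.symm]
    · omega
    · intro y hy z hz hyz
      rcases Nat.lt_succ_iff_lt_or_eq.mp hy with hy | rfl <;>
      rcases Nat.lt_succ_iff_lt_or_eq.mp hz with hz | rfl
      · rw [hφ y hy, hφ z hz] at hyz
        exact h.inj y hy z hz hyz
      · rw [hφ y hy, Function.update_self] at hyz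
        exact absurd hyz (hne y hy)
      · rw [hφ z hz, Function.update_self] at hyz
        exact absurd hyz.symm (hne z hz)
      · rfl
    · intro y hy z hz
      rcases Nat.lt_succ_iff_lt_or_eq.mp hy with hy | rfl
      · rw [hφ y hy] at hz
        exact h.bound y hy z hz
      · rw [Function.update_self, mem_insert] at hz
        rcases hz with rfl | hz
        · exact le_rfl
        · exact h.bound x hx z hz
    · intro y
      by_cases hy : y = x
      · simp [hy]
      · rw [Function.update_of_ne hy]; exact h.stamp_le y
    · intro y hy
      rw [Function.update_of_ne (by omega)]
      exact h.stamp_fresh y (by omega)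
    · intro y hy hiy hsy
      rcases Nat.lt_succ_iff_lt_or_eq.mp hy with hy | rfl
      · rw [hφ y hy] at hiy ⊢
        by_cases hyx : y = x
        · subst hyx; simp
        · rw [Function.update_of_ne hyx] at hsy ⊢
          obtain ⟨h1, h2⟩ := h.stamped y hy hiy hsy
          exact ⟨by omega, by rw [hφ _ h1, h2]⟩
      · rw [Function.update_self] at hiy
        simp at hiy
    · intro y hy hiy hsy z hz
      rcases Nat.lt_succ_iff_lt_or_eq.mp hy with hy | rfl
      · rw [hφ y hy] at hiy ⊢
        have hyx : y ≠ x := by rintro rfl; simp at hsy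
        rw [Function.update_of_ne hyx] at hsy
        rcases Nat.lt_succ_iff_lt_or_eq.mp hz with hz | rfl
        · rw [hφ z hz]
          exact h.unstamped y hy hiy hsy z hz
        · rw [Function.update_self]
          intro heq
          apply hyx
          refine h.inj y hy x hx ?_
          rw [← erase_insert hiy, ← heq, erase_insert hi]
      · rw [Function.update_self] at hiy
        simp at hiy

/-! ### The dynamic program -/

/-- `Cs` is a set of names for the `k`-cliques of `H`: the name `c` stands for the clique `P c`,
and every `k`-clique has a name. -/
structure CliqueTable (H : SimpleGraph ℕ) (k n : ℕ) (Cs : Finset ℕ) (P : ℕ → Finset ℕ) :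
    Prop where
  two_le : 2 ≤ k
  extendable : Extendable H k
  isNClique : ∀ c ∈ Cs, H.IsNClique k (P c)
  subset : ∀ c ∈ Cs, P c ⊆ range n
  complete : ∀ X ⊆ range n, H.IsNClique k X → ∃ c ∈ Cs, P c = X

/-- The array `nm` holds, for every clique `c`, the name of the part of `Y c` before the
position `fr c`. -/
def Named (s : Memory) (φ : ℕ → Finset ℕ) (Cs : Finset ℕ) (nm : ℕ) (Y : ℕ → Finset ℕ)
    (fr : ℕ → ℕ) : Prop :=
  ∀ c ∈ Cs, s.arr nm c < s.reg rFresh ∧ φ (s.arr nm c) = (Y c).filter (· < fr c)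

/-- A clique `c` has been processed when its last element is before the position `fr c`. The entry
`x` of `aGain` is the largest gain for the set `φ x` that the processed cliques provide; it is `0`
if there are none. -/
structure Scores (H : SimpleGraph ℕ) (k n : ℕ) (Cs : Finset ℕ) (P : ℕ → Finset ℕ)
    (ord : ℕ → ℕ) (φ : ℕ → Finset ℕ) (fr : ℕ → ℕ) (s : Memory) : Prop where
  last : ∀ c ∈ Cs, lastPos (P c) < fr c → s.arr aLast c = ord (lastPos (P c))
  best : ∀ x < s.reg rFresh, s.arr aGain x ≠ 0 → s.arr aBest x ∈ Cs ∧
    lastPos (P (s.arr aBest x)) < fr (s.arr aBest x) ∧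
    dropFirst (P (s.arr aBest x)) = φ x ∧
    s.arr aGain x = gain H k n (dropLast (P (s.arr aBest x))) + 1
  le_gain : ∀ c ∈ Cs, lastPos (P c) < fr c → ∃ x < s.reg rFresh, φ x = dropFirst (P c) ∧
    gain H k n (dropLast (P c)) + 1 ≤ s.arr aGain x
  gain_fresh : ∀ x, s.reg rFresh ≤ x → s.arr aGain x = 0
  gain_le_top : ∀ x, s.arr aGain x ≤ s.reg rTop
  top : s.reg rTop ≠ 0 → s.reg rTopName < s.reg rFresh ∧ s.arr aGain (s.reg rTopName) = s.reg rTop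

section DynamicProgram

variable {H : SimpleGraph ℕ} {k n : ℕ} {Cs : Finset ℕ} {P : ℕ → Finset ℕ} {ord : ℕ → ℕ}
  {φ φ' : ℕ → Finset ℕ} {fr fr' : ℕ → ℕ} {s s' : Memory}

/-- The scores are not affected by the introduction of new names. -/
theorem Scores.extend (h : Scores H k n Cs P ord φ fr s) (hle : s.reg rFresh ≤ s'.reg rFresh)
    (hφ : ∀ y < s.reg rFresh, φ' y = φ y) (h1 : s'.arr aLast = s.arr aLast)
    (h2 : s'.arr aGain = s.arr aGain) (h3 : s'.arr aBest = s.arr aBest)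
    (h4 : s'.reg rTop = s.reg rTop) (h5 : s'.reg rTopName = s.reg rTopName) :
    Scores H k n Cs P ord φ' fr s' := by
  constructor
  · rw [h1]; exact h.last
  · rw [h2, h3]
    intro x _ hx0
    have hx : x < s.reg rFresh := by
      by_contra hx
      exact hx0 (h.gain_fresh x (by omega))
    rw [hφ x hx]
    exact h.best x hx hx0
  · rw [h2]
    intro c hc hlt
    obtain ⟨x, hx, h1, h2⟩ := h.le_gain c hc hlt
    exact ⟨x, by omega, by rw [hφ x hx, h1], h2⟩
  · rw [h2]
    intro x hx
    exact h.gain_fresh x (by omega)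
  · rw [h2, h4]; exact h.gain_le_top
  · rw [h2, h4, h5]
    intro h0
    obtain ⟨h1, h2⟩ := h.top h0
    exact ⟨by omega, h2⟩

/-- Once all cliques that could contribute to the gain of a set `Z` of `k - 1` positions have been
processed, the entry for `Z` is correct. -/
theorem Scores.gain_eq (hT : CliqueTable H k n Cs P) (h : Scores H k n Cs P ord φ fr s)
    (hinj : ∀ x < s.reg rFresh, ∀ y < s.reg rFresh, φ x = φ y → x = y) {x : ℕ}
    (hx : x < s.reg rFresh) (hcl : H.IsClique (φ x : Set ℕ)) (hn : φ x ⊆ range n)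
    (hcard : (φ x).card = k - 1)
    (hdone : ∀ c ∈ Cs, dropFirst (P c) = φ x → lastPos (P c) < fr c) :
    s.arr aGain x = gain H k n (φ x) := by
  apply le_antisymm
  · by_cases h0 : s.arr aGain x = 0
    · omega
    · obtain ⟨hc, -, hφ, hg⟩ := h.best x hx h0
      rw [hg, ← hφ]
      exact gain_dropLast_lt hT.extendable hT.two_le (hT.isNClique _ hc) (hT.subset _ hc)
  · by_cases h0 : gain H k n (φ x) = 0
    · omega
    · obtain ⟨X, hX, hXc, hXZ, hle⟩ := exists_of_gain_ne_zero hT.two_le hn hcl hcard h0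
      obtain ⟨c, hc, rfl⟩ := hT.complete X hX hXc
      obtain ⟨y, hy, hφy, hgy⟩ := h.le_gain c hc (hdone c hc hXZ)
      rw [hinj y hy x hx (hφy.trans hXZ)] at hgy
      omega

/-- The invariant of the dynamic program while position `i` is processed: of the clique `c`, the
positions before `fr c` have been read. -/
structure Inv (H : SimpleGraph ℕ) (k n : ℕ) (Cs : Finset ℕ) (P : ℕ → Finset ℕ)
    (ord : ℕ → ℕ) (φ : ℕ → Finset ℕ) (i : ℕ) (fr : ℕ → ℕ) (s : Memory) : Prop where
  names : Names s φ i
  nameA : Named s φ Cs aNameA (fun c => dropFirst (P c)) fr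
  nameB : Named s φ Cs aNameB (fun c => dropLast (P c)) fr
  count : ∀ c ∈ Cs, s.arr aCount c = ((P c).filter (· < fr c)).card
  scores : Scores H k n Cs P ord φ fr s

/-- Read position `rI` of the clique `rC`. The position is added to the set named in `aNameA` unless
it is the first of the clique, and to the set named in `aNameB` unless it is the last; at the last
position the gain that the clique provides is recorded. -/
def visit : Program :=
  .cond (.eq (.read aCount (.var rC)) (.const 0)) .skip (refineName aNameA) ;;
  .cond (.eq (.succ (.read aCount (.var rC))) (.var rK))
    (.store aLast (.var rC) (.read aOrd (.var rI)) ;;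
     .assign rA (.read aNameA (.var rC)) ;;
     .assign rB (.read aNameB (.var rC)) ;;
     .cond (.lt (.read aGain (.var rA)) (.succ (.read aGain (.var rB))))
       (.store aGain (.var rA) (.succ (.read aGain (.var rB))) ;;
        .store aBest (.var rA) (.var rC) ;;
        .cond (.lt (.var rTop) (.read aGain (.var rA)))
          (.assign rTop (.read aGain (.var rA)) ;; .assign rTopName (.var rA))
          .skip)
       .skip)
    (refineName aNameB) ;;
  .store aCount (.var rC) (.succ (.read aCount (.var rC)))

theorem filter_lt_succ_of_notMem {Y : Finset ℕ} {i : ℕ} (h : i ∉ Y) :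
    Y.filter (· < i + 1) = Y.filter (· < i) := by
  ext x
  simp only [mem_filter, and_congr_right_iff]
  intro hx
  have : x ≠ i := fun e => h (e ▸ hx)
  omega

theorem filter_lt_succ_of_mem {Y : Finset ℕ} {i : ℕ} (h : i ∈ Y) :
    Y.filter (· < i + 1) = insert i (Y.filter (· < i)) := by
  ext x
  simp only [mem_filter, mem_insert]
  constructor
  · rintro ⟨h1, h2⟩
    by_cases hx : x = i
    · exact .inl hx
    · exact .inr ⟨h1, by omega⟩
  · rintro (rfl | ⟨h1, h2⟩)
    · exact ⟨h, by omega⟩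
    · exact ⟨h1, by omega⟩

theorem Named.extend {nm : ℕ} {Y : ℕ → Finset ℕ} (h : Named s φ Cs nm Y fr)
    (hle : s.reg rFresh ≤ s'.reg rFresh) (hφ : ∀ y < s.reg rFresh, φ' y = φ y)
    (harr : s'.arr nm = s.arr nm) : Named s' φ' Cs nm Y fr := by
  intro c hc
  obtain ⟨h1, h2⟩ := h c hc
  rw [harr]
  exact ⟨by omega, by rw [hφ _ h1, h2]⟩

/-- Reading position `i` of the clique `c` in the array of names `nm`. -/
theorem wp_refineName_named {nm c i : ℕ} {Y : ℕ → Finset ℕ} (h16 : nm ≠ aStamp)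
    (h17 : nm ≠ aRename) (h : Names s φ i) (hN : Named s φ Cs nm Y fr) (hC : s.reg rC = c)
    (hI : s.reg rI = i) (hc : c ∈ Cs) (hfr : fr c = i) (hi : i ∈ Y c) :
    wp (refineName nm) s fun t s' => t ≤ 60 ∧ ∃ φ', Names s' φ' i ∧
      s.reg rFresh ≤ s'.reg rFresh ∧ (∀ y < s.reg rFresh, φ' y = φ y) ∧
      Named s' φ' Cs nm Y (Function.update fr c (i + 1)) := by
  obtain ⟨hx, hφx⟩ := hN c hc
  rw [hfr] at hφx
  refine (wp_refineName h16 h17 h hC hI rfl hx (by simp [hφx])).mono ?_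
  rintro t s' ⟨ht, φ', x', hN', hle, hφ, harr, hx', hφ'⟩
  refine ⟨ht, φ', hN', hle, hφ, fun d hd => ?_⟩
  rw [harr]
  by_cases hdc : d = c
  · subst hdc
    simp only [Function.update_self]
    exact ⟨hx', by rw [hφ', hφx, filter_lt_succ_of_mem hi]⟩
  · rw [Function.update_of_ne hdc, Function.update_of_ne hdc]
    obtain ⟨h1, h2⟩ := hN d hd
    exact ⟨by omega, by rw [hφ _ h1, h2]⟩

theorem Named.update_of_notMem {nm c i : ℕ} {Y : ℕ → Finset ℕ} (hN : Named s φ Cs nm Y fr)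
    (hfr : fr c = i) (hi : i ∉ Y c) : Named s φ Cs nm Y (Function.update fr c (i + 1)) := by
  intro d hd
  by_cases hdc : d = c
  · subst hdc
    rw [Function.update_self, filter_lt_succ_of_notMem hi, ← hfr]
    exact hN d hd
  · rw [Function.update_of_ne hdc]
    exact hN d hd

/-- Reading an element of a clique that is not its last one does not process the clique. -/
theorem Scores.update_of_ne {c i : ℕ} (h : Scores H k n Cs P ord φ fr s) (hfr : fr c = i)
    (hi : i < lastPos (P c)) :
    Scores H k n Cs P ord φ (Function.update fr c (i + 1)) s := by
  have key : ∀ d, lastPos (P d) < Function.update fr c (i + 1) d ↔ lastPos (P d) < fr d := by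
    intro d
    by_cases hd : d = c
    · subst hd; rw [Function.update_self]; omega
    · rw [Function.update_of_ne hd]
  exact ⟨fun d hd hlt => h.last d hd ((key d).mp hlt),
    fun x hx h0 => by simpa only [key] using h.best x hx h0,
    fun d hd hlt => h.le_gain d hd ((key d).mp hlt), h.gain_fresh, h.gain_le_top, h.top⟩

/-- Processing the clique `c` at its last element: the gain of `dropFirst (P c)`, which has the
name `a`, is improved to the value that `c` provides. -/
theorem Scores.record {c i a v : ℕ} (h : Scores H k n Cs P ord φ fr s) (hc : c ∈ Cs)
    (hfr : fr c = i) (hi : lastPos (P c) = i) (ha : a < s.reg rFresh)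
    (hφa : φ a = dropFirst (P c)) (hv : v = gain H k n (dropLast (P c)) + 1)
    (hfresh : s'.reg rFresh = s.reg rFresh)
    (hlast : s'.arr aLast = Function.update (s.arr aLast) c (ord i))
    (hgain : s'.arr aGain = Function.update (s.arr aGain) a (max (s.arr aGain a) v))
    (hbest : s.arr aGain a < v ∧ s'.arr aBest = Function.update (s.arr aBest) a c ∨
      v ≤ s.arr aGain a ∧ s'.arr aBest = s.arr aBest)
    (htop : s.reg rTop ≤ v ∧ s.arr aGain a < v ∧ s'.reg rTop = v ∧ s'.reg rTopName = a ∨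
      max (s.arr aGain a) v ≤ s.reg rTop ∧ s'.reg rTop = s.reg rTop ∧
        s'.reg rTopName = s.reg rTopName) :
    Scores H k n Cs P ord φ (Function.update fr c (i + 1)) s' := by
  have hmono : ∀ d, lastPos (P d) < fr d → lastPos (P d) < Function.update fr c (i + 1) d := by
    intro d hd
    by_cases hdc : d = c
    · subst hdc; simp [hi]
    · rwa [Function.update_of_ne hdc]
  have hgle : ∀ x, s.arr aGain x ≤ s'.arr aGain x := by
    intro x
    rw [hgain]
    by_cases hx : x = a
    · subst hx; simp
    · rw [Function.update_of_ne hx]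
  constructor
  · intro d hd hlt
    rw [hlast]
    by_cases hdc : d = c
    · subst hdc; simp [hi]
    · rw [Function.update_of_ne hdc] at hlt ⊢
      exact h.last d hd hlt
  · intro x hx h0
    rw [hfresh] at hx
    by_cases hnew : x = a ∧ s.arr aGain a < v
    · obtain ⟨rfl, hlt⟩ := hnew
      have hb : s'.arr aBest x = c := by
        rcases hbest with ⟨-, hb⟩ | ⟨hb, -⟩
        · rw [hb]; simp
        · omega
      rw [hb, hgain]
      refine ⟨hc, by simp [hi], hφa.symm, ?_⟩
      rw [Function.update_self, max_eq_right hlt.le, hv]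
    · have hg : s'.arr aGain x = s.arr aGain x := by
        rw [hgain]
        by_cases hxa : x = a
        · subst hxa
          rw [Function.update_self, max_eq_left]
          simp at hnew; exact hnew
        · rw [Function.update_of_ne hxa]
      have hb : s'.arr aBest x = s.arr aBest x := by
        rcases hbest with ⟨hb1, hb⟩ | ⟨-, hb⟩
        · rw [hb, Function.update_of_ne]
          rintro rfl
          exact hnew ⟨rfl, hb1⟩
        · rw [hb]
      rw [hg] at h0
      obtain ⟨h1, h2, h3, h4⟩ := h.best x hx h0
      rw [hg, hb]
      exact ⟨h1, hmono _ h2, h3, h4⟩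
  · intro d hd hlt
    rw [hfresh]
    by_cases hdc : d = c
    · subst hdc
      refine ⟨a, ha, hφa, ?_⟩
      rw [hgain, Function.update_self, ← hv]
      exact le_max_right _ _
    · rw [Function.update_of_ne hdc] at hlt
      obtain ⟨x, hx, h1, h2⟩ := h.le_gain d hd hlt
      exact ⟨x, hx, h1, h2.trans (hgle x)⟩
  · intro x hx
    rw [hfresh] at hx
    rw [hgain, Function.update_of_ne (by omega)]
    exact h.gain_fresh x hx
  · intro x
    rw [hgain]
    have hx := h.gain_le_top x
    by_cases hxa : x = a
    · subst hxa
      rw [Function.update_self]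
      rcases htop with ⟨h1, h2, h3, -⟩ | ⟨h1, h2, -⟩ <;> omega
    · rw [Function.update_of_ne hxa]
      rcases htop with ⟨h1, h2, h3, -⟩ | ⟨h1, h2, -⟩ <;> omega
  · rw [hfresh, hgain]
    rcases htop with ⟨h1, h2, h3, h4⟩ | ⟨h1, h2, h3⟩
    · intro _
      rw [h3, h4, Function.update_self, max_eq_right h2.le]
      exact ⟨ha, rfl⟩
    · rw [h2, h3]
      intro h0
      obtain ⟨h5, h6⟩ := h.top h0
      refine ⟨h5, ?_⟩
      by_cases hxa : s.reg rTopName = a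
      · rw [hxa, Function.update_self]
        rw [hxa] at h6
        omega
      · rw [Function.update_of_ne hxa, h6]

theorem CliqueTable.nonempty (hT : CliqueTable H k n Cs P) {c : ℕ} (hc : c ∈ Cs) :
    (P c).Nonempty := by
  have h1 := (hT.isNClique c hc).card_eq
  have h2 := hT.two_le
  exact card_pos.mp (by omega)

theorem CliqueTable.lastPos_lt (hT : CliqueTable H k n Cs P) {c : ℕ} (hc : c ∈ Cs) :
    lastPos (P c) < n :=
  mem_range.mp (hT.subset c hc (lastPos_mem (hT.nonempty hc)))

theorem CliqueTable.dropLast_isClique (hT : CliqueTable H k n Cs P) {c : ℕ} (hc : c ∈ Cs) :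
    H.IsClique (dropLast (P c) : Set ℕ) :=
  (hT.isNClique c hc).isClique.subset (coe_subset.mpr (erase_subset _ _))

theorem CliqueTable.dropLast_subset (hT : CliqueTable H k n Cs P) {c : ℕ} (hc : c ∈ Cs) :
    dropLast (P c) ⊆ range n :=
  (erase_subset _ _).trans (hT.subset c hc)

theorem CliqueTable.card_dropLast (hT : CliqueTable H k n Cs P) {c : ℕ} (hc : c ∈ Cs) :
    (dropLast (P c)).card = k - 1 :=
  CliqueSearch.card_dropLast (by have := hT.two_le; omega) (hT.isNClique c hc).card_eq

/-- The cliques that provide the gain of `dropLast (P c)` end before `P c` does. -/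
theorem CliqueTable.lastPos_lt_of_dropFirst_eq (hT : CliqueTable H k n Cs P) {c d : ℕ}
    (hd : d ∈ Cs) (h : dropFirst (P d) = dropLast (P c)) :
    lastPos (P d) < lastPos (P c) := by
  have h1 := (hT.isNClique d hd).card_eq
  have h2 := hT.two_le
  have h3 := lastPos_mem_dropFirst (X := P d) (by omega)
  rw [h] at h3
  exact lt_lastPos_of_mem_dropLast h3

/-- The first test of `visit`: an element of a clique is not its first one if and only if some
element has been read before. -/
theorem CliqueTable.mem_dropFirst_iff (hT : CliqueTable H k n Cs P) {c i : ℕ} (hc : c ∈ Cs)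
    (hi : i ∈ P c) : ((P c).filter (· < i)).card ≠ 0 ↔ i ∈ dropFirst (P c) := by
  rw [card_ne_zero, dropFirst, mem_erase]
  constructor
  · rintro ⟨x, hx⟩
    rw [mem_filter] at hx
    have := firstPos_le hx.1
    exact ⟨by omega, hi⟩
  · rintro ⟨h, -⟩
    have h1 := firstPos_le hi
    exact ⟨firstPos (P c), mem_filter.mpr ⟨firstPos_mem (hT.nonempty hc), by omega⟩⟩

/-- The second test of `visit`: an element of a clique is the last one if and only if `k - 1`
elements have been read before. -/
theorem CliqueTable.lastPos_eq_iff (hT : CliqueTable H k n Cs P) {c i : ℕ} (hc : c ∈ Cs)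
    (hi : i ∈ P c) : ((P c).filter (· < i)).card + 1 = k ↔ lastPos (P c) = i := by
  have hcard := (hT.isNClique c hc).card_eq
  constructor
  · intro h
    have hins : insert i ((P c).filter (· < i)) = P c := by
      refine eq_of_subset_of_card_le (insert_subset hi (filter_subset _ _)) ?_
      rw [card_insert_of_notMem (by simp)]
      omega
    have h1 := lastPos_mem (hT.nonempty hc)
    have h2 := le_lastPos hi
    by_contra hne
    have h3 : lastPos (P c) ∈ insert i ((P c).filter (· < i)) := by rw [hins]; exact h1
    rw [mem_insert, mem_filter] at h3
    omega
  · intro h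
    have : (P c).filter (· < i) = dropLast (P c) := by
      ext x
      rw [mem_filter, dropLast, mem_erase, h]
      constructor
      · rintro ⟨h1, h2⟩; exact ⟨by omega, h1⟩
      · rintro ⟨h1, h2⟩
        have := le_lastPos h2
        exact ⟨h2, by omega⟩
    rw [this, hT.card_dropLast hc]
    have := hT.two_le
    omega

/-- Reading position `i` of the clique `c` keeps the invariant. When `i` is the last position of
`c`, the gain of `dropLast (P c)` is final, because all cliques that provide it have been processed. -/
theorem wp_visit {c i : ℕ} (hT : CliqueTable H k n Cs P) (h : Inv H k n Cs P ord φ i fr s)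
    (hc : c ∈ Cs) (hi : i ∈ P c) (hfr : fr c = i) (hle : ∀ d, i ≤ fr d) (hC : s.reg rC = c)
    (hI : s.reg rI = i) (hK : s.reg rK = k) (hord : s.arr aOrd i = ord i) :
    wp visit s fun t s' => t ≤ 250 ∧
      ∃ φ', Inv H k n Cs P ord φ' i (Function.update fr c (i + 1)) s' := by
  have hcount : s.arr aCount c = ((P c).filter (· < i)).card := by rw [h.count c hc, hfr]
  have hilast := le_lastPos hi
  -- the new name of the part of `dropFirst (P c)` up to position `i`
  have step1 : wp (.cond (.eq (.read aCount (.var rC)) (.const 0)) .skip (refineName aNameA)) s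
      fun t s' => t ≤ 80 ∧ ∃ φ', Names s' φ' i ∧
        s.reg rFresh ≤ s'.reg rFresh ∧ (∀ y < s.reg rFresh, φ' y = φ y) ∧
        Named s' φ' Cs aNameA (fun c => dropFirst (P c)) (Function.update fr c (i + 1)) := by
    rw [wp_cond]
    simp only [Test.Holds, Arith.eval, Arith.cost, Test.cost, hC, hcount, wp_skip]
    refine ⟨fun h0 => ⟨by norm_num, φ, h.names, le_rfl, fun _ _ => rfl, ?_⟩, fun h0 => ?_⟩
    · refine h.nameA.update_of_notMem hfr ?_
      rw [← hT.mem_dropFirst_iff hc hi]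
      simpa using h0
    · refine (wp_refineName_named (by decide) (by decide) h.names h.nameA hC hI hc hfr
        ((hT.mem_dropFirst_iff hc hi).mp h0)).mono ?_
      rintro t s' ⟨ht, hex⟩
      exact ⟨by omega, hex⟩
  simp only [visit]
  rw [wp_seq]
  refine step1.frame.mono ?_
  rintro t₁ s₁ ⟨hF₁, ht₁, φ₁, hN₁, hle₁, hφ₁, hA₁⟩
  have hB₁ : Named s₁ φ₁ Cs aNameB (fun c => dropLast (P c)) fr :=
    h.nameB.extend hle₁ hφ₁ (hF₁.arr _ (by decide))
  have hS₁ : Scores H k n Cs P ord φ₁ fr s₁ := h.scores.extend hle₁ hφ₁ (hF₁.arr _ (by decide))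
    (hF₁.arr _ (by decide)) (hF₁.arr _ (by decide)) (hF₁.reg _ (by decide))
    (hF₁.reg _ (by decide))
  have hC₁ : s₁.reg rC = c := (hF₁.reg _ (by decide)).trans hC
  have hI₁ : s₁.reg rI = i := (hF₁.reg _ (by decide)).trans hI
  have hK₁ : s₁.reg rK = k := (hF₁.reg _ (by decide)).trans hK
  have hord₁ : s₁.arr aOrd i = ord i := by rw [hF₁.arr _ (by decide), hord]
  have hcnt₁ : s₁.arr aCount = s.arr aCount := hF₁.arr _ (by decide)
  -- the new count
  have hcount' : ∀ d ∈ Cs, Function.update (s.arr aCount) c (s.arr aCount c + 1) d =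
      ((P d).filter (· < Function.update fr c (i + 1) d)).card := by
    intro d hd
    by_cases hdc : d = c
    · subst hdc
      rw [Function.update_self, Function.update_self, filter_lt_succ_of_mem hi,
        card_insert_of_notMem (by simp), hcount]
    · rw [Function.update_of_ne hdc, Function.update_of_ne hdc]
      exact h.count d hd
  rw [wp_seq, wp_cond]
  refine ⟨fun hlast => ?_, fun hlast => ?_⟩
  · simp only [Test.Holds, Arith.eval, hC₁, hK₁, hcnt₁, hcount] at hlast
    rw [hT.lastPos_eq_iff hc hi] at hlast
    obtain ⟨ha, hφa⟩ := hA₁ c hc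
    obtain ⟨hb, hφb⟩ := hB₁ c hc
    have hfullA : (dropFirst (P c)).filter (· < i + 1) = dropFirst (P c) := by
      refine filter_true_of_mem fun x hx => ?_
      have := le_lastPos (mem_of_mem_erase hx)
      omega
    have hfullB : (dropLast (P c)).filter (· < i) = dropLast (P c) := by
      refine filter_true_of_mem fun x hx => ?_
      have := lt_lastPos_of_mem_dropLast hx
      omega
    rw [Function.update_self, hfullA] at hφa
    rw [hfr, hfullB] at hφb
    have hgb := hS₁.gain_eq hT hN₁.inj hb (by rw [hφb]; exact hT.dropLast_isClique hc)
      (by rw [hφb]; exact hT.dropLast_subset hc) (by rw [hφb]; exact hT.card_dropLast hc)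
      (fun d hd hdc => by
        rw [hφb] at hdc
        have := hT.lastPos_lt_of_dropFirst_eq hd hdc
        have := hle d
        omega)
    rw [hφb] at hgb
    have finish : ∀ s₂ : Memory, s₂.reg rFresh = s₁.reg rFresh →
        s₂.arr aStamp = s₁.arr aStamp → s₂.arr aRename = s₁.arr aRename →
        s₂.arr aNameA = s₁.arr aNameA → s₂.arr aNameB = s₁.arr aNameB →
        s₂.arr aCount = Function.update (s.arr aCount) c (s.arr aCount c + 1) →
        Scores H k n Cs P ord φ₁ (Function.update fr c (i + 1)) s₂ →
        Inv H k n Cs P ord φ₁ i (Function.update fr c (i + 1)) s₂ := by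
      intro s₂ h1 h2 h3 h4 h5 h6 h7
      refine ⟨?_, ?_, ?_, by rw [h6]; exact hcount', h7⟩
      · constructor <;> simp only [h1, h2, h3]
        exacts [hN₁.pos, hN₁.inj, hN₁.bound, hN₁.stamp_le, hN₁.stamp_fresh, hN₁.stamped,
          hN₁.unstamped]
      · exact hA₁.extend h1.ge (fun _ _ => rfl) h4
      · exact (hB₁.update_of_notMem hfr (by simp [dropLast, hlast])).extend h1.ge
          (fun _ _ => rfl) h5
    simp only [wp_seq, wp_assign, wp_store, wp_cond, wp_skip, Arith.eval, Arith.cost, Test.cost,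
      Test.Holds, Memory.reg_setReg, Memory.arr_setReg, Memory.reg_setArr, Memory.arr_setArr,
      Nat.reduceEqDiff, if_true, if_false, hC₁, hI₁, hord₁, hcnt₁, Function.update_self]
    refine ⟨fun hlt => ⟨fun hlt' => ⟨by omega, φ₁, ?_⟩, fun hlt' => ⟨by omega, φ₁, ?_⟩⟩,
      fun hlt => ⟨by omega, φ₁, ?_⟩⟩
    · refine finish _ (by simp) (by simp) (by simp) (by simp) (by simp)
        (by simp [hcnt₁]) ?_
      refine hS₁.record (v := s₁.arr aGain (s₁.arr aNameB c) + 1) hc hfr hlast ha hφa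
        (by rw [hgb]) (by simp) (by simp) ?_ (.inl ⟨hlt, by simp⟩)
        (.inl ⟨hlt'.le, hlt, by simp, by simp⟩)
      rw [max_eq_right hlt.le]
      simp
    · refine finish _ (by simp) (by simp) (by simp) (by simp) (by simp)
        (by simp [hcnt₁]) ?_
      refine hS₁.record (v := s₁.arr aGain (s₁.arr aNameB c) + 1) hc hfr hlast ha hφa
        (by rw [hgb]) (by simp) (by simp) ?_ (.inl ⟨hlt, by simp⟩)
        (.inr ⟨by omega, by simp, by simp⟩)
      rw [max_eq_right hlt.le]
      simp
    · refine finish _ (by simp) (by simp) (by simp) (by simp) (by simp)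
        (by simp [hcnt₁]) ?_
      refine hS₁.record (v := s₁.arr aGain (s₁.arr aNameB c) + 1) hc hfr hlast ha hφa
        (by rw [hgb]) (by simp) (by simp) ?_ (.inr ⟨by omega, by simp⟩)
        (.inr ⟨?_, by simp, by simp⟩)
      · rw [max_eq_left (by omega)]
        simp
      · rw [max_eq_left (by omega)]
        exact hS₁.gain_le_top _
  · simp only [Test.Holds, Arith.eval, hC₁, hK₁, hcnt₁, hcount] at hlast
    rw [hT.lastPos_eq_iff hc hi] at hlast
    refine (wp_refineName_named (by decide) (by decide) hN₁ hB₁ hC₁ hI₁ hc hfr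
      (mem_erase.mpr ⟨Ne.symm hlast, hi⟩)).frame.mono ?_
    rintro t₂ s₂ ⟨hF₂, ht₂, φ₂, hN₂, hle₂, hφ₂, hB₂⟩
    have hC₂ : s₂.reg rC = c := (hF₂.reg _ (by decide)).trans hC₁
    have hcnt₂ : s₂.arr aCount = s.arr aCount := (hF₂.arr _ (by decide)).trans hcnt₁
    simp only [wp_store, Arith.eval, Arith.cost, Test.cost, hC₂, hcnt₂]
    refine ⟨by omega, φ₂, ⟨?_, ?_, ?_, ?_, ?_⟩⟩
    · constructor <;> simp only [Memory.reg_setArr, Memory.arr_setArr, Nat.reduceEqDiff, if_false]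
      exacts [hN₂.pos, hN₂.inj, hN₂.bound, hN₂.stamp_le, hN₂.stamp_fresh, hN₂.stamped,
        hN₂.unstamped]
    · exact hA₁.extend hle₂ hφ₂ (by simpa using hF₂.arr _ (by decide))
    · exact hB₂.extend le_rfl (fun _ _ => rfl) (by simp)
    · simpa [hcnt₂] using hcount'
    · refine ((hS₁.extend hle₂ hφ₂ (hF₂.arr _ (by decide)) (hF₂.arr _ (by decide))
        (hF₂.arr _ (by decide)) (hF₂.reg _ (by decide)) (hF₂.reg _ (by decide))).update_of_ne
        hfr (by omega)).extend le_rfl (fun _ _ => rfl) ?_ ?_ ?_ ?_ ?_ <;> simp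

/-- When the next position is processed, all stamps are outdated, and no named set contains the new
position. -/
theorem Names.next {i : ℕ} (h : Names s φ i) : Names s φ (i + 1) where
  pos := h.pos
  inj := h.inj
  bound x hx z hz := (h.bound x hx z hz).trans (Nat.le_succ i)
  stamp_le x := (h.stamp_le x).trans (Nat.le_succ _)
  stamp_fresh := h.stamp_fresh
  stamped x _ _ hs := by
    have := h.stamp_le x
    omega
  unstamped x hx _ _ y hy he := by
    have := h.bound y hy (i + 1) (by rw [he]; exact mem_insert_self _ _)
    omega

/-- Only the elements of a clique matter for how far it has been read. -/
theorem Inv.congr {i : ℕ} (hT : CliqueTable H k n Cs P) (h : Inv H k n Cs P ord φ i fr s)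
    (hfr : ∀ c ∈ Cs, ∀ x ∈ P c, x < fr' c ↔ x < fr c) :
    Inv H k n Cs P ord φ i fr' s := by
  have key : ∀ c ∈ Cs, ∀ Y ⊆ P c, Y.filter (· < fr' c) = Y.filter (· < fr c) :=
    fun c hc Y hY => filter_congr fun x hx => hfr c hc x (hY hx)
  have hlast : ∀ c ∈ Cs, lastPos (P c) < fr' c ↔ lastPos (P c) < fr c :=
    fun c hc => hfr c hc _ (lastPos_mem (hT.nonempty hc))
  refine ⟨h.names, fun c hc => ?_, fun c hc => ?_, fun c hc => ?_, ⟨fun c hc hlt => ?_,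
    fun x hx h0 => ?_, fun c hc hlt => ?_, h.scores.gain_fresh, h.scores.gain_le_top,
    h.scores.top⟩⟩
  · exact (key c hc _ (erase_subset (firstPos (P c)) _)) ▸ h.nameA c hc
  · exact (key c hc _ (erase_subset (lastPos (P c)) _)) ▸ h.nameB c hc
  · rw [key c hc _ Subset.rfl]; exact h.count c hc
  · exact h.scores.last c hc ((hlast c hc).mp hlt)
  · obtain ⟨h1, h2, h3⟩ := h.scores.best x hx h0
    exact ⟨h1, (hlast _ h1).mpr h2, h3⟩
  · exact h.scores.le_gain c hc ((hlast c hc).mp hlt)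

theorem Inv.setReg {i x v : ℕ} (h : Inv H k n Cs P ord φ i fr s)
    (hx : x ≠ rFresh ∧ x ≠ rTop ∧ x ≠ rTopName) :
    Inv H k n Cs P ord φ i fr (s.setReg x v) := by
  obtain ⟨a, b, c, d, e⟩ := h
  have h1 : (s.setReg x v).reg rFresh = s.reg rFresh := by simp [hx.1.symm]
  refine ⟨?_, b.extend h1.ge (fun _ _ => rfl) rfl, c.extend h1.ge (fun _ _ => rfl) rfl, d,
    e.extend h1.ge (fun _ _ => rfl) rfl rfl rfl (by simp [hx.2.1.symm])
      (by simp [hx.2.2.symm])⟩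
  constructor <;> simp only [h1, Memory.arr_setReg]
  exacts [a.pos, a.inj, a.bound, a.stamp_le, a.stamp_fresh, a.stamped, a.unstamped]

/-- Run the dynamic program: read the positions in increasing order, and at each position all
cliques that contain it. The empty set has the name `0`, so that in fresh memory all cliques have
the right names, and `1` is the first unused name. -/
def process : Program :=
  .assign rFresh (.const 1) ;;
  .assign rTop (.const 0) ;;
  .assign rI (.const 0) ;;
  .loop (.lt (.var rI) (.var rN))
    (.assign rE (.read aIncHead (.read aOrd (.var rI))) ;;
     .loop (.neg (.eq (.var rE) (.const 0)))
       (.assign rC (.read aOwner (.pred (.var rE))) ;;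
        visit ;;
        .assign rE (.read aIncNext (.pred (.var rE)))) ;;
     incr rI)

/-- `ls i` is the incidence list of the vertex at position `i`. -/
theorem wp_process {ls : ℕ → List ℕ} (hT : CliqueTable H k n Cs P)
    (hn : s.reg rN = n) (hk : s.reg rK = k) (hord : ∀ i < n, s.arr aOrd i = ord i)
    (hls : ∀ i < n, Linked (s.arr aIncNext) (s.arr aIncHead (ord i)) (ls i))
    (hnd : ∀ i < n, ((ls i).map (s.arr aOwner)).Nodup)
    (hmem : ∀ i < n, ∀ c, c ∈ (ls i).map (s.arr aOwner) ↔ c ∈ Cs ∧ i ∈ P c)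
    (h1 : s.arr aCount = fun _ => 0) (h2 : s.arr aNameA = fun _ => 0)
    (h3 : s.arr aNameB = fun _ => 0) (h4 : s.arr aStamp = fun _ => 0)
    (h5 : s.arr aGain = fun _ => 0) :
    wp process s fun t s' => t ≤ 30 + ∑ i ∈ range n, (50 + 300 * (ls i).length) ∧
      ∃ φ, Inv H k n Cs P ord φ n (fun _ => n) s' := by
  simp only [process, wp_seq, wp_assign]
  refine wp_loop n (fun i t s' => t ≤ ∑ i ∈ range i, (50 + 300 * (ls i).length) ∧
    s'.reg rI = i ∧ ∃ φ, Inv H k n Cs P ord φ i (fun _ => i) s') ?_ ?_ ?_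
  · refine ⟨Nat.zero_le _, by simp, fun _ => ∅, ⟨?_, ?_, ?_, ?_, ?_⟩⟩
    · constructor <;> simp [h4]
    · intro c _; simp [h2]
    · intro c _; simp [h3]
    · intro c _; simp [h1]
    · constructor <;> simp [h5]
  · rintro i t s₁ hi hF₁ ⟨ht, hI, φ, hInv⟩
    have hN₁ := hF₁.reg rN (by decide)
    have hK₁ := hF₁.reg rK (by decide)
    have hord₁ := hF₁.arr aOrd (by decide)
    have hnx₁ := hF₁.arr aIncNext (by decide)
    have hhd₁ := hF₁.arr aIncHead (by decide)
    have how₁ := hF₁.arr aOwner (by decide)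
    simp only [Memory.reg_setReg, Memory.arr_setReg, Nat.reduceEqDiff, if_false, hn, hk]
      at hN₁ hK₁ hord₁ hnx₁ hhd₁ how₁
    refine ⟨by simp [hI, hN₁, hi], ?_⟩
    have hlen : ((ls i).map (s.arr aOwner)).length = (ls i).length := by simp
    simp only [wp_seq, wp_assign]
    refine wp_loop (ls i).length (fun j t' s' => t' ≤ 290 * j ∧
      Linked (s.arr aIncNext) (s'.reg rE) ((ls i).drop j) ∧
      ∃ φ, Inv H k n Cs P ord φ i
        (fun c => if c ∈ ((ls i).map (s.arr aOwner)).take j then i + 1 else i) s') ?_ ?_ ?_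
    · refine ⟨Nat.zero_le _, ?_, φ, ?_⟩
      · simpa [hI, hord₁, hhd₁, hord i hi] using hls i hi
      · simp only [List.take_zero, List.not_mem_nil, if_false]
        exact hInv.setReg (by decide)
    · rintro j t' s₂ hj hF₂ ⟨ht', hL, φ₂, hInv₂⟩
      obtain ⟨hx, hL'⟩ := hL.drop_lt hj
      have hI₂ := hF₂.reg rI (by decide)
      have hK₂ := hF₂.reg rK (by decide)
      have hord₂ := hF₂.arr aOrd (by decide)
      have hnx₂ := hF₂.arr aIncNext (by decide)
      have how₂ := hF₂.arr aOwner (by decide)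
      simp only [Memory.reg_setReg, Memory.arr_setReg, Nat.reduceEqDiff, if_false, hI, hK₁,
        hord₁, hnx₁, how₁] at hI₂ hK₂ hord₂ hnx₂ how₂
      refine ⟨by simp [hx], ?_⟩
      have hjl : j < ((ls i).map (s.arr aOwner)).length := by rw [hlen]; exact hj
      have hget : ((ls i).map (s.arr aOwner))[j] = s.arr aOwner (ls i)[j] := by simp
      obtain ⟨hc, hic⟩ := (hmem i hi _).mp (List.getElem_mem hjl)
      have hnot : ((ls i).map (s.arr aOwner))[j] ∉ ((ls i).map (s.arr aOwner)).take j := by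
        have := hnd i hi
        rw [← List.take_append_drop j ((ls i).map (s.arr aOwner)),
          List.drop_eq_getElem_cons hjl] at this
        intro hmem
        exact (List.nodup_append.mp this).2.2 _ hmem _ (List.mem_cons_self) rfl
      rw [hget] at hc hic hnot
      simp only [wp_seq, wp_assign]
      refine (wp_visit (φ := φ₂) (ord := ord) (c := s.arr aOwner (ls i)[j]) (i := i)
        (fr := fun c => if c ∈ ((ls i).map (s.arr aOwner)).take j then i + 1 else i) hT ?_ hc hic
        (if_neg hnot) (fun d => by split_ifs <;> omega)
        (by simp [hx, how₂]) (by simp [hI₂]) (by simp [hK₂])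
        (by simp [hord₂, hord i hi])).frame.mono ?_
      · exact hInv₂.setReg (by decide)
      · rintro t₃ s₃ ⟨hF₃, ht₃, φ₃, hInv₃⟩
        have hE₃ := hF₃.reg rE (by decide)
        have hnx₃ := hF₃.arr aIncNext (by decide)
        simp only [Memory.reg_setReg, Memory.arr_setReg, Nat.reduceEqDiff, if_false, hx, hnx₂]
          at hE₃ hnx₃
        simp only [Arith.eval, Arith.cost, Test.cost, Memory.reg_setReg, if_true, hE₃, hnx₃,
          Nat.add_sub_cancel]
        refine ⟨by omega, hL', φ₃, ?_⟩
        have hupd : Function.update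
            (fun c => if c ∈ ((ls i).map (s.arr aOwner)).take j then i + 1 else i)
            (s.arr aOwner (ls i)[j]) (i + 1) =
            fun c => if c ∈ ((ls i).map (s.arr aOwner)).take (j + 1) then i + 1 else i := by
          funext c
          rw [List.take_add_one, List.getElem?_eq_getElem hjl, hget]
          by_cases hcj : c = s.arr aOwner (ls i)[j]
          · subst hcj; simp
          · rw [Function.update_of_ne hcj]
            simp [hcj]
        rw [hupd] at hInv₃
        exact hInv₃.setReg (by decide)
    · rintro t' s₂ hF₂ ⟨ht', hL, φ₂, hInv₂⟩
      rw [List.drop_length] at hL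
      have hx : s₂.reg rE = 0 := hL
      have hI₂ := hF₂.reg rI (by decide)
      simp only [Memory.reg_setReg, Nat.reduceEqDiff, if_false, hI] at hI₂
      refine ⟨by simp [hx], ?_⟩
      simp only [Arith.eval, Arith.cost, Test.cost, Memory.reg_setReg, if_true, hI₂, true_and,
        sum_range_succ]
      refine ⟨by omega, φ₂, ?_⟩
      have hInv₃ : Inv H k n Cs P ord φ₂ i (fun _ => i + 1) s₂ := by
        refine hInv₂.congr hT fun c hc x hx => ?_
        rw [← hlen, List.take_length]
        by_cases hcl : c ∈ (ls i).map (s.arr aOwner)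
        · rw [if_pos hcl]
        · rw [if_neg hcl]
          have : x ≠ i := by
            rintro rfl
            exact hcl ((hmem x hi c).mpr ⟨hc, hx⟩)
          omega
      exact ({ hInv₃ with names := hInv₃.names.next } : Inv H k n Cs P ord φ₂ (i + 1) _ s₂).setReg
        (by decide)
  · rintro t s₁ hF₁ ⟨ht, hI, hex⟩
    have hN₁ := hF₁.reg rN (by decide)
    simp only [Memory.reg_setReg, Nat.reduceEqDiff, if_false, hn] at hN₁
    refine ⟨by simp [hI, hN₁], ?_, hex⟩
    simp only [Arith.cost, Test.cost]; omega

/-! ### The output -/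

/-- Follow the best cliques from the set with the largest gain down to a set without gain, and
output the last elements of these cliques and the other elements of the final one. -/
def traceBack : Program :=
  .assign rB (.var rTopName) ;;
  .assign rI (.const 0) ;;
  .loop (.neg (.eq (.read aGain (.var rB)) (.const 0)))
    (.assign rC (.read aBest (.var rB)) ;;
     .store aOut (.var rI) (.read aLast (.var rC)) ;;
     incr rI ;;
     .assign rB (.read aNameB (.var rC))) ;;
  .assign rR (.var rC) ;;
  .assign rE (.const 0) ;;
  .loop (.lt (.var rE) (.var rK))
    (.cond (.eq (.read aQueue (.var rR)) (.read aLast (.var rC)))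
       .skip
       (.store aOut (.var rI) (.read aQueue (.var rR)) ;; incr rI) ;;
     incr rR ;;
     incr rE) ;;
  .assign rK (.var rI)

/-- `pl c` lists the positions of the clique `c` in the order in which the queue holds its members.
The first loop keeps the invariant that every clique `W` that ends with the set named in `rB`
remains a clique when the elements `l` output so far are added. -/
theorem wp_traceBack {pl : ℕ → List ℕ} (hT : CliqueTable H k n Cs P)
    (hInv : Inv H k n Cs P ord φ n (fun _ => n) s) (hk : s.reg rK = k)
    (hinj : ∀ x < n, ∀ y < n, ord x = ord y → x = y) (hne : s.reg rTop ≠ 0)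
    (hpl : ∀ c ∈ Cs, (pl c).Nodup ∧ (pl c).toFinset = P c ∧
      ∀ j (h : j < (pl c).length), s.arr aQueue (c + j) = ord (pl c)[j]) :
    wp traceBack s fun t s' => t ≤ 40 * s.reg rTop + 40 * k + 40 ∧
      ∃ l : List ℕ, l.Nodup ∧ (∀ x ∈ l, x < n) ∧ H.IsClique (l.toFinset : Set ℕ) ∧
        l.length = k - 1 + s.reg rTop ∧ Holds (s'.arr aOut) (l.map ord) ∧
        s'.reg rK = l.length := by
  have h2k := hT.two_le
  have hS := hInv.scores
  obtain ⟨htop, htopg⟩ := hS.top hne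
  -- the data of a clique, now that all cliques have been processed
  have hnameB : ∀ c ∈ Cs, s.arr aNameB c < s.reg rFresh ∧
      φ (s.arr aNameB c) = dropLast (P c) := by
    intro c hc
    obtain ⟨h1, h2⟩ := hInv.nameB c hc
    refine ⟨h1, h2.trans (filter_true_of_mem fun x hx => ?_)⟩
    exact mem_range.mp (hT.dropLast_subset hc hx)
  have hgain : ∀ c ∈ Cs, s.arr aGain (s.arr aNameB c) = gain H k n (dropLast (P c)) := by
    intro c hc
    obtain ⟨h1, h2⟩ := hnameB c hc
    rw [← h2]
    refine hS.gain_eq hT hInv.names.inj h1 ?_ ?_ ?_ fun d hd _ => hT.lastPos_lt hd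
    · rw [h2]; exact hT.dropLast_isClique hc
    · rw [h2]; exact hT.dropLast_subset hc
    · rw [h2]; exact hT.card_dropLast hc
  simp only [traceBack, wp_seq, wp_assign]
  refine wp_loop (s.reg rTop) (fun r t s' => t ≤ 30 * r ∧ s'.reg rI = r ∧
    s'.reg rB < s.reg rFresh ∧ s.arr aGain (s'.reg rB) + r = s.reg rTop ∧
    (0 < r → s'.reg rC ∈ Cs ∧ φ (s'.reg rB) = dropLast (P (s'.reg rC))) ∧
    ∃ l : List ℕ, l.Nodup ∧ (∀ x ∈ l, x < n) ∧ l.length = r ∧ Holds (s'.arr aOut) (l.map ord) ∧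
      ∀ W : Finset ℕ, H.IsClique (W : Set ℕ) → EndsIn W (φ (s'.reg rB)) →
        Disjoint W l.toFinset ∧ H.IsClique (W ∪ l.toFinset : Finset ℕ)) ?_ ?_ ?_
  · refine ⟨Nat.zero_le _, by simp, by simpa using htop, by simpa using htopg, by simp, [],
      by simp, by simp, rfl, by simp [Holds], fun W hW _ => by simpa using hW⟩
  · rintro r t s₁ hr hF₁ ⟨ht, hI, hB, hg, -, l, hl1, hl2, hl3, hl4, hl5⟩
    have hg₁ := hF₁.arr aGain (by decide)
    have hb₁ := hF₁.arr aBest (by decide)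
    have hL₁ := hF₁.arr aLast (by decide)
    have hnB₁ := hF₁.arr aNameB (by decide)
    simp only [Memory.arr_setReg] at hg₁ hb₁ hL₁ hnB₁
    have hg0 : s.arr aGain (s₁.reg rB) ≠ 0 := by omega
    refine ⟨by simp only [Test.Holds, Arith.eval, hg₁]; exact hg0, ?_⟩
    obtain ⟨hc, -, hfst, hgc⟩ := hS.best _ hB hg0
    simp only [wp_seq, wp_assign, wp_store, Arith.eval, Arith.cost, Test.cost, Memory.reg_setReg,
      Memory.arr_setReg, Memory.reg_setArr, Memory.arr_setArr, Nat.reduceEqDiff, if_true,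
      if_false, hb₁, hL₁, hnB₁, hI]
    generalize s.arr aBest (s₁.reg rB) = c at *
    obtain ⟨hnB, hφB⟩ := hnameB c hc
    have hlt := hT.lastPos_lt hc
    have hstep : ∀ W : Finset ℕ, H.IsClique (W : Set ℕ) → EndsIn W (dropLast (P c)) →
        lastPos (P c) ∉ W ∧ Disjoint (insert (lastPos (P c)) W) l.toFinset ∧
          H.IsClique (insert (lastPos (P c)) W ∪ l.toFinset : Finset ℕ) := by
      intro W hW hend
      obtain ⟨h1, h2, h3⟩ := isClique_insert_lastPos hT.extendable h2k (hT.isNClique c hc) hW hend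
      rw [hfst] at h3
      exact ⟨h1, hl5 _ h2 h3⟩
    have hnotl : lastPos (P c) ∉ l := by
      obtain ⟨-, h2, -⟩ := hstep _ (hT.dropLast_isClique hc) (EndsIn.refl _)
      intro h
      exact disjoint_left.mp h2 (mem_insert_self _ _) (List.mem_toFinset.mpr h)
    have hgB := hgain c hc
    refine ⟨by omega, trivial, hnB, by omega, fun _ => ⟨hc, hφB⟩, l ++ [lastPos (P c)], ?_, ?_,
      by simp [hl3], ?_, fun W hW hend => ?_⟩
    · rw [List.nodup_append]
      refine ⟨hl1, by simp, fun a ha b hb => ?_⟩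
      rw [List.mem_singleton] at hb
      rintro rfl
      exact hnotl (hb ▸ ha)
    · intro x hx
      rw [List.mem_append, List.mem_singleton] at hx
      rcases hx with hx | rfl
      · exact hl2 x hx
      · exact hlt
    · rw [hS.last c hc hlt, List.map_append]
      have := hl4.push (ord (lastPos (P c)))
      rwa [List.length_map, hl3] at this
    · rw [hφB] at hend
      obtain ⟨h1, h2, h3⟩ := hstep W hW hend
      have hfin : (l ++ [lastPos (P c)]).toFinset = insert (lastPos (P c)) l.toFinset := by
        ext x; simp [or_comm]
      rw [hfin]
      refine ⟨?_, ?_⟩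
      · rw [disjoint_insert_right]
        exact ⟨h1, (disjoint_insert_left.mp h2).2⟩
      · rwa [union_insert, ← insert_union]
  · rintro t s₁ hF₁ ⟨ht, hI, hB, hg, hrC, l, hl1, hl2, hl3, hl4, hl5⟩
    obtain ⟨hc, hφB⟩ := hrC (by omega)
    have hg₁ := hF₁.arr aGain (by decide)
    have hL₁ := hF₁.arr aLast (by decide)
    have hQ₁ := hF₁.arr aQueue (by decide)
    have hK₁ := hF₁.reg rK (by decide)
    simp only [Memory.reg_setReg, Memory.arr_setReg, Nat.reduceEqDiff, if_false, hk]
      at hg₁ hL₁ hQ₁ hK₁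
    refine ⟨?_, ?_⟩
    · simp only [Test.Holds, Arith.eval, hg₁]
      omega
    generalize hcdef : s₁.reg rC = c at *
    have hlt := hT.lastPos_lt hc
    obtain ⟨hp1, hp2, hp3⟩ := hpl c hc
    have hplen : (pl c).length = k := by
      rw [← List.toFinset_card_of_nodup hp1, hp2, (hT.isNClique c hc).card_eq]
    have hpn : ∀ x ∈ pl c, x < n := by
      intro x hx
      exact mem_range.mp (hT.subset c hc (hp2 ▸ List.mem_toFinset.mpr hx))
    have hlast := hS.last c hc hlt
    let f : ℕ → List ℕ := fun j => l ++ ((pl c).take j).filter (· ≠ lastPos (P c))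
    refine wp_loop k (fun j t' s' => t' ≤ 35 * j ∧ s'.reg rE = j ∧ s'.reg rR = c + j ∧
      Holds (s'.arr aOut) ((f j).map ord) ∧ s'.reg rI = (f j).length) ?_ ?_ ?_
    · refine ⟨Nat.zero_le _, by simp, by simp [hcdef], by simpa [f] using hl4,
        by simp [f, hl3, hI]⟩
    · rintro j t' s₂ hj hF₂ ⟨ht', hE, hR, hO, hI₂⟩
      have hK₂ := hF₂.reg rK (by decide)
      have hC₂ := hF₂.reg rC (by decide)
      have hQ₂ := hF₂.arr aQueue (by decide)
      have hL₂ := hF₂.arr aLast (by decide)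
      simp only [Memory.reg_setReg, Memory.arr_setReg, Nat.reduceEqDiff, if_false, hK₁, hcdef,
        hQ₁, hL₁] at hK₂ hC₂ hQ₂ hL₂
      refine ⟨by simp [hE, hK₂, hj], ?_⟩
      have hjp : j < (pl c).length := by omega
      have hfj : f (j + 1) = f j ++ if (pl c)[j] ≠ lastPos (P c) then [(pl c)[j]] else [] := by
        simp only [f]
        rw [List.take_add_one, List.getElem?_eq_getElem hjp]
        simp only [Option.toList_some, List.filter_append, List.append_assoc]
        congr 2
        by_cases h : (pl c)[j] = lastPos (P c) <;> simp [h]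
      have hiff : ord (pl c)[j] = ord (lastPos (P c)) ↔ (pl c)[j] = lastPos (P c) :=
        ⟨hinj _ (hpn _ (List.getElem_mem _)) _ hlt, fun h => by rw [h]⟩
      simp only [wp_seq, wp_assign, wp_store, wp_cond, wp_skip, Arith.eval, Arith.cost, Test.cost,
        Test.Holds, Memory.reg_setReg, Memory.arr_setReg, Memory.reg_setArr, Memory.arr_setArr,
        Nat.reduceEqDiff, if_true, if_false, hE, hR, hQ₂, hL₂, hC₂, hI₂, hp3 j hjp, hlast, hiff]
      refine ⟨fun h => ?_, fun h => ?_⟩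
      · rw [if_neg (by simpa using h), List.append_nil] at hfj
        rw [hfj]
        exact ⟨by omega, trivial, by omega, hO, rfl⟩
      · rw [if_pos h] at hfj
        rw [hfj, List.map_append]
        refine ⟨by omega, trivial, by omega, ?_, by simp⟩
        have := hO.push (ord (pl c)[j])
        rwa [List.length_map] at this
    · rintro t' s₂ hF₂ ⟨ht', hE, hR, hO, hI₂⟩
      have hK₂ := hF₂.reg rK (by decide)
      simp only [Memory.reg_setReg, Nat.reduceEqDiff, if_false, hK₁] at hK₂
      refine ⟨by simp [hE, hK₂], ?_⟩
      simp only [Arith.eval, Arith.cost, Test.cost, Memory.reg_setReg, Memory.arr_setReg, if_true,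
        hI₂]
      have hfin : ((pl c).filter (· ≠ lastPos (P c))).toFinset = dropLast (P c) := by
        rw [dropLast, ← hp2]
        ext x; simp [and_comm]
      have hfk : f k = l ++ (pl c).filter (· ≠ lastPos (P c)) := by
        simp only [f]; rw [List.take_of_length_le (by omega)]
      obtain ⟨hdis, hcl⟩ := hl5 (dropLast (P c)) (hT.dropLast_isClique hc)
        (by rw [hφB]; exact EndsIn.refl _)
      have hnd : ((pl c).filter (· ≠ lastPos (P c))).Nodup := hp1.filter _
      have hlen : ((pl c).filter (· ≠ lastPos (P c))).length = k - 1 := by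
        rw [← List.toFinset_card_of_nodup hnd, hfin, hT.card_dropLast hc]
      refine ⟨by omega, f k, ?_, ?_, ?_, ?_, hO, rfl⟩ <;> rw [hfk]
      · refine List.nodup_append.mpr ⟨hl1, hnd, fun a ha b hb => ?_⟩
        rintro rfl
        rw [← List.mem_toFinset, hfin] at hb
        exact disjoint_left.mp hdis hb (List.mem_toFinset.mpr ha)
      · intro x hx
        rcases List.mem_append.mp hx with hx | hx
        · exact hl2 x hx
        · exact hpn x (List.mem_of_mem_filter hx)
      · rw [List.toFinset_append, hfin, union_comm]
        exact hcl
      · rw [List.length_append, hlen, hl3]; omega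

/-- The largest gain found by the dynamic program is an upper bound for all cliques. -/
theorem Inv.card_le (hT : CliqueTable H k n Cs P)
    (hInv : Inv H k n Cs P ord φ n (fun _ => n) s) {W : Finset ℕ} (hW : W ⊆ range n)
    (hcl : H.IsClique (W : Set ℕ)) : W.card ≤ k - 1 + s.reg rTop := by
  by_contra hlt
  obtain ⟨Z, hend, hZ⟩ := exists_endsIn W (k - 1) (by omega)
  have h1 := le_gain (k := k) hW hcl hend
  obtain ⟨X, hXn, hX, -, hle⟩ := exists_of_gain_ne_zero (n := n) hT.two_le (hend.1.trans hW)
    (hcl.subset (coe_subset.mpr hend.1)) hZ (by omega)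
  obtain ⟨c, hc, rfl⟩ := hT.complete X hXn hX
  obtain ⟨x, -, -, hx⟩ := hInv.scores.le_gain c hc (hT.lastPos_lt hc)
  have := hInv.scores.gain_le_top x
  omega

/-- Every `k`-clique gives a set of positive gain. -/
theorem Inv.top_ne_zero (hT : CliqueTable H k n Cs P)
    (hInv : Inv H k n Cs P ord φ n (fun _ => n) s) (hne : Cs.Nonempty) : s.reg rTop ≠ 0 := by
  obtain ⟨c, hc⟩ := hne
  obtain ⟨x, -, -, hx⟩ := hInv.scores.le_gain c hc (hT.lastPos_lt hc)
  have := hInv.scores.gain_le_top x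
  omega

end DynamicProgram

/-! ### The enumeration lists every clique once -/

/-- The out-lists of the orientation of `H` in which the values of `κ` increase along the arcs. -/
structure IsOrientation {β : Type*} [LinearOrder β] (H : SimpleGraph ℕ) (n : ℕ) (κ : ℕ → β)
    (out : ℕ → List ℕ) : Prop where
  injective : Function.Injective κ
  lt_of_adj : ∀ {x y}, H.Adj x y → x < n
  mem_out : ∀ {x y}, y ∈ out x ↔ H.Adj x y ∧ κ x < κ y
  nodup : ∀ x, (out x).Nodup

section Enumeration

variable {β : Type*} [LinearOrder β] {H : SimpleGraph ℕ} {n : ℕ} {κ : ℕ → β} {out : ℕ → List ℕ}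

/-- The marks count the members of `q` that have the out-neighbour `y`. -/
theorem count_flatMap_out (hnd : ∀ x, (out x).Nodup) (y : ℕ) (q : List ℕ) :
    (q.flatMap out).count y = q.countP fun x => y ∈ out x := by
  induction q with
  | nil => rfl
  | cons x q ih =>
    rw [List.flatMap_cons, List.count_append, ih, List.countP_cons]
    by_cases h : y ∈ out x
    · rw [List.count_eq_one_of_mem (hnd x) h]; simp [h, add_comm]
    · rw [List.count_eq_zero_of_not_mem h]; simp [h]

theorem mem_extensions (hnd : ∀ x, (out x).Nodup) {q : List ℕ} (hq : q ≠ []) {y : ℕ} :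
    y ∈ extensions out q ↔ ∀ x ∈ q, y ∈ out x := by
  rw [extensions, List.mem_filter, count_flatMap_out hnd]
  simp only [decide_eq_true_eq, List.countP_eq_length]
  obtain ⟨x, q, rfl⟩ := List.exists_cons_of_ne_nil hq
  simp only [List.headD_cons, List.mem_cons, forall_eq_or_imp]
  tauto

theorem mem_cliqueLevel_succ (hnd : ∀ x, (out x).Nodup) {i : ℕ} {q : List ℕ} :
    q ∈ cliqueLevel out n (i + 1) ↔
      ∃ q' ∈ cliqueLevel out n i, ∃ y, (∀ x ∈ q', y ∈ out x) ∧ q' ++ [y] = q := by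
  simp only [cliqueLevel, List.mem_flatMap, expand, List.mem_map]
  refine exists_congr fun q' => and_congr_right fun hq' => exists_congr fun y => ?_
  rw [mem_extensions hnd]
  rintro rfl
  simpa using length_of_mem_cliqueLevel hq'

/-- The members of the enumerated cliques are listed along the orientation. -/
theorem IsOrientation.pairwise (hO : IsOrientation H n κ out) :
    ∀ {i : ℕ} {q : List ℕ}, q ∈ cliqueLevel out n i →
      q.Pairwise (fun x y => y ∈ out x) ∧ ∀ x ∈ q, x < n
  | 0, q, h => by
    simp only [cliqueLevel, List.mem_map, List.mem_range] at h
    obtain ⟨v, hv, rfl⟩ := h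
    simpa using hv
  | i + 1, q, h => by
    obtain ⟨q', hq', y, hy, rfl⟩ := (mem_cliqueLevel_succ hO.nodup).mp h
    obtain ⟨h1, h2⟩ := hO.pairwise hq'
    refine ⟨?_, fun x hx => ?_⟩
    · rw [List.pairwise_append]
      refine ⟨h1, by simp, fun a ha b hb => ?_⟩
      rw [List.mem_singleton] at hb
      exact hb ▸ hy a ha
    · rcases List.mem_append.mp hx with hx | hx
      · exact h2 x hx
      · rw [List.mem_singleton] at hx
        subst hx
        have hne : q' ≠ [] := by
          rintro rfl
          simpa using length_of_mem_cliqueLevel hq'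
        obtain ⟨z, hz⟩ := List.exists_mem_of_ne_nil _ hne
        exact hO.lt_of_adj (hO.mem_out.mp (hy z hz)).1.symm

theorem IsOrientation.pairwise_lt (hO : IsOrientation H n κ out) {i : ℕ} {q : List ℕ}
    (hq : q ∈ cliqueLevel out n i) : q.Pairwise fun x y => κ x < κ y :=
  (hO.pairwise hq).1.imp fun h => (hO.mem_out.mp h).2

theorem IsOrientation.nodup_of_mem (hO : IsOrientation H n κ out) {i : ℕ} {q : List ℕ}
    (hq : q ∈ cliqueLevel out n i) : q.Nodup :=
  (hO.pairwise_lt hq).imp fun h he => by rw [he] at h; exact lt_irrefl _ h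

theorem IsOrientation.isNClique (hO : IsOrientation H n κ out) {i : ℕ} {q : List ℕ}
    (hq : q ∈ cliqueLevel out n i) : H.IsNClique (i + 1) q.toFinset := by
  refine ⟨?_, by rw [List.toFinset_card_of_nodup (hO.nodup_of_mem hq),
    length_of_mem_cliqueLevel hq]⟩
  have : q.Pairwise H.Adj := (hO.pairwise hq).1.imp fun h => (hO.mem_out.mp h).1
  intro x hx y hy hne
  have hsymm : Std.Symm H.Adj := ⟨fun _ _ h => h.symm⟩
  exact this.forall (List.mem_toFinset.mp hx) (List.mem_toFinset.mp hy) hne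

theorem IsOrientation.toFinset_injOn (hO : IsOrientation H n κ out) {i : ℕ} {q q' : List ℕ}
    (hq : q ∈ cliqueLevel out n i) (hq' : q' ∈ cliqueLevel out n i)
    (h : q.toFinset = q'.toFinset) : q = q' := by
  have hp := List.perm_of_nodup_nodup_toFinset_eq (hO.nodup_of_mem hq) (hO.nodup_of_mem hq') h
  exact hp.eq_of_pairwise (fun a b _ _ h1 h2 => absurd h1 h2.not_gt) (hO.pairwise_lt hq)
    (hO.pairwise_lt hq')

theorem IsOrientation.exists_of_isNClique (hO : IsOrientation H n κ out) :
    ∀ {i : ℕ} {X : Finset ℕ}, H.IsNClique (i + 1) X → X ⊆ range n →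
      ∃ q ∈ cliqueLevel out n i, q.toFinset = X
  | 0, X, hX, hn => by
    obtain ⟨v, rfl⟩ := card_eq_one.mp hX.card_eq
    exact ⟨[v], by simpa [cliqueLevel] using hn, by simp⟩
  | i + 1, X, hX, hn => by
    obtain ⟨y, hy, hmax⟩ := exists_max_image X κ (card_pos.mp (by rw [hX.card_eq]; omega))
    obtain ⟨q, hq, hqX⟩ := hO.exists_of_isNClique (i := i) (X := X.erase y)
      ⟨hX.isClique.subset (coe_subset.mpr (erase_subset _ _)),
        by rw [card_erase_of_mem hy, hX.card_eq]; rfl⟩ ((erase_subset _ _).trans hn)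
    refine ⟨q ++ [y], (mem_cliqueLevel_succ hO.nodup).mpr ⟨q, hq, y, fun x hx => ?_, rfl⟩, ?_⟩
    · rw [← List.mem_toFinset, hqX, mem_erase] at hx
      exact hO.mem_out.mpr ⟨hX.isClique (mem_coe.mpr hx.2) (mem_coe.mpr hy) hx.1,
        lt_of_le_of_ne (hmax x hx.2) fun h => hx.1 (hO.injective h)⟩
    · rw [List.toFinset_append, hqX]
      ext x
      simp only [mem_union, mem_erase, List.mem_toFinset, List.mem_singleton]
      by_cases h : x = y
      · simp [h, hy]
      · simp [h]

theorem IsOrientation.nodup_cliqueLevel (hO : IsOrientation H n κ out) :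
    ∀ i, (cliqueLevel out n i).Nodup
  | 0 => List.nodup_range.map fun a b h => by simpa using h
  | i + 1 => by
    rw [cliqueLevel, List.nodup_flatMap]
    refine ⟨fun q hq => ?_, ?_⟩
    · exact ((hO.nodup _).filter _).map fun a b h => by simpa using h
    · refine (hO.nodup_cliqueLevel i).imp fun {q q'} hne => ?_
      intro p hp hp'
      simp only [expand, List.mem_map] at hp hp'
      obtain ⟨y, -, rfl⟩ := hp
      obtain ⟨y', -, h⟩ := hp'
      exact hne (List.append_inj' h rfl).1.symm

/-! ### The number of cliques -/

/-- A clique consists of its first member and some out-neighbours of it. -/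
theorem IsOrientation.length_cliqueLevel_le (hO : IsOrientation H n κ out) (i : ℕ) :
    (cliqueLevel out n i).length ≤ ∑ v ∈ range n, (out v).length.choose i := by
  rw [← List.toFinset_card_of_nodup (hO.nodup_cliqueLevel i)]
  have hcard : ∑ v ∈ range n, (out v).length.choose i =
      ((range n).sigma fun v => powersetCard i (out v).toFinset).card := by
    rw [card_sigma]
    refine sum_congr rfl fun v _ => ?_
    rw [card_powersetCard, List.toFinset_card_of_nodup (hO.nodup v)]
  rw [hcard]
  -- a clique is determined by its first member and the set of its other members
  refine card_le_card_of_injOn (fun q => ⟨q.headD 0, q.tail.toFinset⟩) ?_ ?_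
  · intro q hq
    have hq : q ∈ cliqueLevel out n i := List.mem_toFinset.mp hq
    obtain ⟨h1, h2⟩ := hO.pairwise hq
    have hlen := length_of_mem_cliqueLevel hq
    have hnd := hO.nodup_of_mem hq
    obtain ⟨x, q, rfl⟩ := List.exists_cons_of_length_eq_add_one hlen
    rw [List.pairwise_cons] at h1
    rw [List.nodup_cons] at hnd
    simp only [coe_sigma, Set.mem_sigma_iff, mem_coe, mem_range, mem_powersetCard,
      List.headD_cons, List.tail_cons]
    refine ⟨h2 x (by simp), fun y hy => ?_, ?_⟩
    · exact List.mem_toFinset.mpr (h1.1 y (List.mem_toFinset.mp hy))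
    · rw [List.toFinset_card_of_nodup hnd.2]
      simpa using hlen
  · intro q hq q' hq' h
    have hq : q ∈ cliqueLevel out n i := List.mem_toFinset.mp hq
    have hq' : q' ∈ cliqueLevel out n i := List.mem_toFinset.mp hq'
    apply hO.toFinset_injOn hq hq'
    obtain ⟨x, q, rfl⟩ := List.exists_cons_of_length_eq_add_one (length_of_mem_cliqueLevel hq)
    obtain ⟨x', q', rfl⟩ := List.exists_cons_of_length_eq_add_one (length_of_mem_cliqueLevel hq')
    simp only [List.headD_cons, List.tail_cons, Sigma.mk.injEq, heq_eq_eq] at h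
    rw [List.toFinset_cons, List.toFinset_cons, h.1, h.2]

/-- If there are `m` arcs and all out-degrees are at most `D`, then the number of cliques of size
`i + 2` is at most `m D ^ i / (i + 1)!`. -/
theorem IsOrientation.factorial_mul_length_le (hO : IsOrientation H n κ out) {m D : ℕ}
    (hm : ∑ v ∈ range n, (out v).length = m) (hD : ∀ v, (out v).length ≤ D) (i : ℕ) :
    (i + 1).factorial * (cliqueLevel out n (i + 1)).length ≤ m * D ^ i := by
  calc (i + 1).factorial * (cliqueLevel out n (i + 1)).length
      ≤ (i + 1).factorial * ∑ v ∈ range n, (out v).length.choose (i + 1) :=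
        Nat.mul_le_mul_left _ (hO.length_cliqueLevel_le (i + 1))
    _ = ∑ v ∈ range n, (out v).length.descFactorial (i + 1) := by
        rw [mul_sum]
        exact sum_congr rfl fun v _ => (Nat.descFactorial_eq_factorial_mul_choose _ _).symm
    _ ≤ ∑ v ∈ range n, (out v).length * D ^ i := by
        refine sum_le_sum fun v _ => ?_
        refine (Nat.descFactorial_le_pow _ _).trans ?_
        rw [pow_succ']
        exact Nat.mul_le_mul_left _ (Nat.pow_le_pow_left (hD v) i)
    _ = m * D ^ i := by rw [← sum_mul, hm]

theorem two_pow_mul_sq_le (i : ℕ) : 2 ^ i * (i + 1) ^ 2 ≤ 22 * i.factorial := by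
  by_cases hi : i < 4
  · interval_cases i <;> decide
  · obtain ⟨j, rfl⟩ := Nat.exists_eq_add_of_le (Nat.le_of_not_lt hi)
    clear hi
    induction j with
    | zero => decide
    | succ j ih =>
      rw [← add_assoc, pow_succ, Nat.factorial_succ]
      have h : 2 * (4 + j + 1 + 1) ^ 2 ≤ (4 + j + 1) * (4 + j + 1) ^ 2 := by nlinarith
      calc 2 ^ (4 + j) * 2 * (4 + j + 1 + 1) ^ 2
          = 2 ^ (4 + j) * (2 * (4 + j + 1 + 1) ^ 2) := by ring
        _ ≤ 2 ^ (4 + j) * ((4 + j + 1) * (4 + j + 1) ^ 2) := Nat.mul_le_mul_left _ h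
        _ = (4 + j + 1) * (2 ^ (4 + j) * (4 + j + 1) ^ 2) := by ring
        _ ≤ (4 + j + 1) * (22 * (4 + j).factorial) := Nat.mul_le_mul_left _ ih
        _ = 22 * ((4 + j + 1) * (4 + j).factorial) := by ring

/-- The factorial in the bound for the number of cliques absorbs polynomial factors and the powers
of two that come from the bound `D ≤ 2 r` for the out-degrees. -/
theorem IsOrientation.length_mul_sq_le (hO : IsOrientation H n κ out) {m D : ℕ} {r : ℝ}
    (hm : ∑ v ∈ range n, (out v).length = m) (hD : ∀ v, (out v).length ≤ D) (hr : r ^ 2 = m)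
    (hr0 : 0 ≤ r) (hDr : (D : ℝ) ≤ 2 * r) (i : ℕ) :
    ((cliqueLevel out n (i + 1)).length : ℝ) * (i + 2) ^ 2 ≤ 11 * r ^ (i + 2) := by
  have h1 : (((i + 1).factorial : ℕ) : ℝ) * (cliqueLevel out n (i + 1)).length ≤ m * D ^ i := by
    exact_mod_cast hO.factorial_mul_length_le hm hD i
  have h2 : (2 : ℝ) ^ (i + 1) * (i + 1 + 1) ^ 2 ≤ 22 * ((i + 1).factorial : ℕ) := by
    exact_mod_cast two_pow_mul_sq_le (i + 1)
  have h3 : (D : ℝ) ^ i ≤ (2 * r) ^ i := by gcongr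
  have hf : (0 : ℝ) < ((i + 1).factorial : ℕ) := by exact_mod_cast Nat.factorial_pos _
  refine le_of_mul_le_mul_left ?_ hf
  calc (((i + 1).factorial : ℕ) : ℝ) * ((cliqueLevel out n (i + 1)).length * (i + 2) ^ 2)
      = (((i + 1).factorial : ℕ) : ℝ) * (cliqueLevel out n (i + 1)).length * (i + 2) ^ 2 := by ring
    _ ≤ ((m : ℝ) * (D : ℝ) ^ i) * (i + 2) ^ 2 := by gcongr
    _ ≤ (r ^ 2 * (2 * r) ^ i) * (i + 2) ^ 2 := by rw [hr]; gcongr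
    _ = r ^ (i + 2) * (2 ^ (i + 1) * (i + 1 + 1) ^ 2) / 2 := by rw [mul_pow]; ring
    _ ≤ r ^ (i + 2) * (22 * ((i + 1).factorial : ℕ)) / 2 := by gcongr
    _ = ((i + 1).factorial : ℕ) * (11 * r ^ (i + 2)) := by ring

theorem outWeight_le {D : ℕ} (hD : ∀ v, (out v).length ≤ D) (q : List ℕ) :
    outWeight out q ≤ q.length * D := by
  induction q with
  | nil => simp [outWeight]
  | cons x q ih =>
    simp only [outWeight, List.map_cons, List.sum_cons, List.length_cons] at ih ⊢
    have := hD x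
    rw [Nat.succ_mul]
    omega

theorem sum_expandTime_le {D : ℕ} (hD : ∀ v, (out v).length ≤ D) (i : ℕ) :
    ((cliqueLevel out n i).map (expandTime out)).sum ≤
      (cliqueLevel out n i).length * (260 * ((i + 1) ^ 2 * (D + 1))) := by
  have h := List.sum_le_card_nsmul ((cliqueLevel out n i).map (expandTime out))
    (260 * ((i + 1) ^ 2 * (D + 1))) ?_
  · simpa using h
  · intro x hx
    obtain ⟨q, hq, rfl⟩ := List.mem_map.mp hx
    have h1 := outWeight_le hD q
    rw [expandTime, length_of_mem_cliqueLevel hq]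
    rw [length_of_mem_cliqueLevel hq] at h1
    nlinarith [Nat.mul_le_mul_left (i + 1) h1]

theorem list_sum_map_range (f : ℕ → ℕ) (n : ℕ) :
    ((List.range n).map f).sum = ∑ v ∈ range n, f v := by
  induction n with
  | zero => rfl
  | succ n ih => rw [List.range_succ, List.map_append, List.sum_append, ih, sum_range_succ]; simp

/-- At level `0` the general bound `n (D + 1)` would be too large, but the out-degrees add up
to `m`. -/
theorem sum_expandTime_zero (out : ℕ → List ℕ) (n : ℕ) :
    ((cliqueLevel out n 0).map (expandTime out)).sum =
      260 * (∑ v ∈ range n, (out v).length + n) := by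
  rw [cliqueLevel, List.map_map]
  have : (List.range n).map (expandTime out ∘ fun v => [v]) =
      (List.range n).map fun v => 260 * ((out v).length + 1) := by
    simp [expandTime, outWeight, Function.comp_def]
  rw [this, list_sum_map_range, ← mul_sum, sum_add_distrib]
  simp

/-- Expanding the cliques of size `i + 1` takes time `O(m ^ ((i + 2) / 2))`. -/
theorem IsOrientation.levelTime_le (hO : IsOrientation H n κ out) {m D : ℕ} {r : ℝ}
    (hm : ∑ v ∈ range n, (out v).length = m) (hD : ∀ v, (out v).length ≤ D) (hr : r ^ 2 = m)
    (hr1 : 1 ≤ r) (hDr : (D : ℝ) ≤ 2 * r) (hn : n ≤ 2 * m) (i : ℕ) :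
    (levelTime out n i : ℝ) ≤ 10000 * r ^ (i + 2) := by
  have hr0 : 0 ≤ r := by linarith
  have h1 := hO.length_mul_sq_le hm hD hr hr0 hDr i
  have hpow : 1 ≤ r ^ (i + 2) := one_le_pow₀ hr1
  have h2 : ((cliqueLevel out n (i + 1)).length : ℝ) * (i + 1 + 1) ≤ 11 * r ^ (i + 2) := by
    refine le_trans ?_ h1
    have : (0 : ℝ) ≤ i := by positivity
    gcongr
    nlinarith
  have h3 : ((((cliqueLevel out n i).map (expandTime out)).sum : ℕ) : ℝ) ≤
      8580 * r ^ (i + 2) := by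
    rcases i with _ | i
    -- at level `0`, the number of arcs is used in place of the bound for the out-degrees
    · rw [sum_expandTime_zero, hm]
      have hn' : (n : ℝ) ≤ 2 * m := by exact_mod_cast hn
      push_cast
      have : r ^ (0 + 2) = m := hr
      rw [this]
      nlinarith
    · have h4 := hO.length_mul_sq_le hm hD hr hr0 hDr i
      have h5 : ((((cliqueLevel out n (i + 1)).map (expandTime out)).sum : ℕ) : ℝ) ≤
          (cliqueLevel out n (i + 1)).length * (260 * ((i + 1 + 1) ^ 2 * (D + 1))) := by
        exact_mod_cast sum_expandTime_le hD (i + 1)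
      refine h5.trans ?_
      calc ((cliqueLevel out n (i + 1)).length : ℝ) * (260 * ((i + 1 + 1) ^ 2 * (D + 1)))
          = (cliqueLevel out n (i + 1)).length * (i + 2) ^ 2 * (260 * (D + 1)) := by ring
        _ ≤ 11 * r ^ (i + 2) * (260 * (3 * r)) := by
            gcongr
            linarith
        _ = 8580 * r ^ (i + 1 + 2) := by ring
  rw [levelTime, Nat.cast_add, Nat.cast_add]
  push_cast at h3 ⊢
  linarith

end Enumeration

/-! ### The orientation computed from the list of edges -/

/-- The out-lists that `orient` computes. -/
def outList (fst snd deg : ℕ → ℕ) (m v : ℕ) : List ℕ :=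
  ((downTo 0 m).filter fun e => edgeSrc fst snd deg e = v).map (edgeTgt fst snd deg)

theorem hasOut_outList {s : Memory} {fst snd deg : ℕ → ℕ} {m : ℕ}
    (hB : Buckets (s.arr aNext) (s.arr aHead) (edgeSrc fst snd deg) (downTo 0 m))
    (hT : ∀ e < m, s.arr aTgt e = edgeTgt fst snd deg e) : HasOut s (outList fst snd deg m) := by
  intro v
  refine ⟨_, hB v, List.map_congr_left fun e he => hT e ?_⟩
  simpa using List.mem_of_mem_filter he

/-- The fibres of `f` over distinct values have total length at most that of the list. -/
theorem sum_length_filter_le {n : ℕ} (f g : ℕ → ℕ) (hg : ∀ x < n, ∀ y < n, g x = g y → x = y)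
    (l : List ℕ) : ∑ i ∈ range n, (l.filter fun e => f e = g i).length ≤ l.length := by
  induction l with
  | nil => simp
  | cons e l ih =>
    have h : ∀ i ∈ range n, ((e :: l).filter fun e => f e = g i).length =
        (if f e = g i then 1 else 0) + (l.filter fun e => f e = g i).length := by
      intro i _
      by_cases h : f e = g i <;> simp [h, add_comm]
    rw [sum_congr rfl h, sum_add_distrib, sum_boole, List.length_cons, add_comm]
    refine Nat.add_le_add ih (card_le_one.mpr ?_)
    simp only [mem_filter, mem_range, Nat.cast_id]
    rintro a ⟨ha, ha'⟩ b ⟨hb, hb'⟩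
    exact hg a ha b hb (ha'.symm.trans hb')

theorem sum_length_filter_eq {n : ℕ} (f : ℕ → ℕ) (l : List ℕ) (hf : ∀ e ∈ l, f e < n) :
    ∑ v ∈ range n, (l.filter fun e => f e = v).length = l.length := by
  induction l with
  | nil => simp
  | cons e l ih =>
    have h : ∀ v ∈ range n, ((e :: l).filter fun e => f e = v).length =
        (if f e = v then 1 else 0) + (l.filter fun e => f e = v).length := by
      intro v _
      by_cases h : f e = v <;> simp [h, add_comm]
    rw [sum_congr rfl h, sum_add_distrib, ih fun e he => hf e (List.mem_cons_of_mem _ he),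
      sum_ite_eq, if_pos (mem_range.mpr (hf e List.mem_cons_self)), List.length_cons, add_comm]

theorem length_downTo (p i : ℕ) : (downTo p i).length = i := by
  induction i with
  | zero => rfl
  | succ i ih => simp [downTo, ih]

/-- The numbers `fst e`, `snd e` with `e < m` are the ends of the edges of `H`, each edge listed
once. -/
structure EdgeTable (H : SimpleGraph ℕ) (n m : ℕ) (fst snd : ℕ → ℕ) : Prop where
  lt_of_adj : ∀ {x y}, H.Adj x y → x < n
  adj_iff : ∀ {x y}, H.Adj x y ↔ ∃ e < m, s(fst e, snd e) = s(x, y)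
  inj : ∀ e < m, ∀ e' < m, s(fst e, snd e) = s(fst e', snd e') → e = e'

section Orientation

variable {H : SimpleGraph ℕ} {n m : ℕ} {fst snd : ℕ → ℕ}

theorem EdgeTable.adj (hE : EdgeTable H n m fst snd) {e : ℕ} (he : e < m) :
    H.Adj (fst e) (snd e) := hE.adj_iff.mpr ⟨e, he, rfl⟩

theorem EdgeTable.sum_endCount (hE : EdgeTable H n m fst snd) :
    ∑ v ∈ range n, endCount fst snd m v = 2 * m := by
  simp only [endCount, sum_add_distrib]
  rw [← card_eq_sum_card_fiberwise (f := fst), ← card_eq_sum_card_fiberwise (f := snd)]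
  · simp; omega
  · intro e he
    exact mem_coe.mpr (mem_range.mpr (hE.lt_of_adj (hE.adj (mem_range.mp he)).symm))
  · intro e he
    exact mem_coe.mpr (mem_range.mpr (hE.lt_of_adj (hE.adj (mem_range.mp he))))

theorem EdgeTable.le_two_mul (hE : EdgeTable H n m fst snd) (hiso : ∀ v < n, ∃ w, H.Adj v w) :
    n ≤ 2 * m := by
  rw [← hE.sum_endCount]
  have : ∀ v ∈ range n, 1 ≤ endCount fst snd m v := by
    intro v hv
    obtain ⟨w, hw⟩ := hiso v (mem_range.mp hv)
    obtain ⟨e, he, hvw⟩ := hE.adj_iff.mp hw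
    rw [endCount]
    rcases Sym2.eq_iff.mp hvw with ⟨h1, -⟩ | ⟨-, h1⟩
    · have : 0 < ((range m).filter fun e => fst e = v).card :=
        card_pos.mpr ⟨e, by simp [he, h1]⟩
      omega
    · have : 0 < ((range m).filter fun e => snd e = v).card :=
        card_pos.mpr ⟨e, by simp [he, h1]⟩
      omega
  simpa using sum_le_sum this

/-- The degree of `v`, with ties broken by the name. -/
def rank (deg : ℕ → ℕ) (v : ℕ) : ℕ ×ₗ ℕ := toLex (deg v, v)

theorem forward_iff (fst snd deg : ℕ → ℕ) (e : ℕ) :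
    Forward fst snd deg e ↔ rank deg (fst e) < rank deg (snd e) := by
  simp [rank, Prod.Lex.lt_iff, Forward]

theorem rank_injective (deg : ℕ → ℕ) : Function.Injective (rank deg) := by
  intro x y h
  have := congrArg (fun z => (ofLex z).2) h
  simpa [rank] using this

theorem edge_eq (fst snd deg : ℕ → ℕ) (e : ℕ) :
    s(edgeSrc fst snd deg e, edgeTgt fst snd deg e) = s(fst e, snd e) := by
  unfold edgeSrc edgeTgt
  split_ifs
  · rfl
  · exact Sym2.eq_swap

theorem EdgeTable.rank_src_lt (hE : EdgeTable H n m fst snd) (deg : ℕ → ℕ) {e : ℕ} (he : e < m) :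
    rank deg (edgeSrc fst snd deg e) < rank deg (edgeTgt fst snd deg e) := by
  unfold edgeSrc edgeTgt
  split_ifs with h
  · exact (forward_iff _ _ _ _).mp h
  · rw [forward_iff] at h
    exact lt_of_le_of_ne (not_lt.mp h) fun heq =>
      (hE.adj he).ne (rank_injective deg heq.symm)

theorem EdgeTable.isOrientation (hE : EdgeTable H n m fst snd) (deg : ℕ → ℕ) :
    IsOrientation H n (rank deg) (outList fst snd deg m) where
  injective := rank_injective deg
  lt_of_adj := hE.lt_of_adj
  mem_out {x y} := by
    simp only [outList, List.mem_map, List.mem_filter, mem_downTo, decide_eq_true_eq]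
    constructor
    · rintro ⟨e, ⟨⟨-, he⟩, rfl⟩, rfl⟩
      rw [zero_add] at he
      exact ⟨hE.adj_iff.mpr ⟨e, he, (edge_eq _ _ deg e).symm⟩, hE.rank_src_lt deg he⟩
    · rintro ⟨hadj, hlt⟩
      obtain ⟨e, he, hxy⟩ := hE.adj_iff.mp hadj
      have h1 := hE.rank_src_lt deg he
      rw [← edge_eq fst snd deg] at hxy
      refine ⟨e, ?_⟩
      rcases Sym2.eq_iff.mp hxy with ⟨h2, h3⟩ | ⟨h2, h3⟩
      · exact ⟨⟨⟨by omega, by omega⟩, h2⟩, h3⟩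
      · rw [h2, h3] at h1
        exact absurd h1 hlt.not_gt
  nodup v := by
    refine ((nodup_downTo 0 m).filter _).map_on fun e he e' he' heq => ?_
    simp only [List.mem_filter, mem_downTo, decide_eq_true_eq] at he he'
    refine hE.inj e (by omega) e' (by omega) ?_
    rw [← edge_eq fst snd deg e, ← edge_eq fst snd deg e', he.2, he'.2, heq]

theorem EdgeTable.src_lt (hE : EdgeTable H n m fst snd) (deg : ℕ → ℕ) {e : ℕ} (he : e < m) :
    edgeSrc fst snd deg e < n :=
  hE.lt_of_adj (hE.adj_iff.mpr ⟨e, he, (edge_eq fst snd deg e).symm⟩)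

theorem EdgeTable.sum_length_outList (hE : EdgeTable H n m fst snd) (deg : ℕ → ℕ) :
    ∑ v ∈ range n, (outList fst snd deg m v).length = m := by
  simp only [outList, List.length_map]
  rw [sum_length_filter_eq, length_downTo]
  intro e he
  exact hE.src_lt deg (by simpa using he)

theorem EdgeTable.length_outList_le_endCount (deg : ℕ → ℕ) (v : ℕ) :
    (outList fst snd deg m v).length ≤ endCount fst snd m v := by
  rw [outList, List.length_map,
    ← List.toFinset_card_of_nodup ((nodup_downTo 0 m).filter _), endCount]
  refine (card_le_card fun e he => ?_).trans (card_union_le _ _)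
  simp only [List.mem_toFinset, List.mem_filter, mem_downTo, decide_eq_true_eq] at he
  simp only [mem_union, mem_filter, mem_range]
  obtain ⟨h1, h2⟩ := he
  unfold edgeSrc at h2
  split_ifs at h2
  · exact .inl ⟨by omega, h2⟩
  · exact .inr ⟨by omega, h2⟩

/-- The out-degrees are at most `√(2 m)`: all out-neighbours of `v` have at least the degree
of `v`, and the sum of all degrees is `2 m`. -/
theorem EdgeTable.length_outList_le_sqrt (hE : EdgeTable H n m fst snd) (v : ℕ) :
    (outList fst snd (endCount fst snd m) m v).length ≤ Nat.sqrt (2 * m) := by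
  have hO := hE.isOrientation (endCount fst snd m)
  rw [Nat.le_sqrt]
  generalize hout : outList fst snd (endCount fst snd m) m = out at *
  have hdeg : (out v).length ≤ endCount fst snd m v := by
    rw [← hout]; exact EdgeTable.length_outList_le_endCount _ v
  calc (out v).length * (out v).length
      = ∑ _w ∈ (out v).toFinset, (out v).length := by
        rw [sum_const, List.toFinset_card_of_nodup (hO.nodup v), smul_eq_mul]
    _ ≤ ∑ w ∈ (out v).toFinset, endCount fst snd m w := by
        refine sum_le_sum fun w hw => ?_
        obtain ⟨-, hlt⟩ := hO.mem_out.mp (List.mem_toFinset.mp hw)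
        rw [rank, rank, Prod.Lex.lt_iff] at hlt
        simp only [ofLex_toLex] at hlt
        omega
    _ ≤ ∑ w ∈ range n, endCount fst snd m w := by
        refine sum_le_sum_of_subset fun w hw => ?_
        obtain ⟨hadj, -⟩ := hO.mem_out.mp (List.mem_toFinset.mp hw)
        exact mem_range.mpr (hE.lt_of_adj hadj.symm)
    _ = 2 * m := hE.sum_endCount

end Orientation

/-! ### Output of a small clique -/

/-- Output the last clique in the queue, which has `rJ - 1` members. -/
def outputLast : Program :=
  .assign rI (.const 0) ;;
  .loop (.lt (.succ (.var rI)) (.var rJ))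
    (.assign rW (.pred (.var rW)) ;;
     .store aOut (.var rI) (.read aQueue (.var rW)) ;;
     incr rI) ;;
  .assign rK (.var rI)

theorem wp_outputLast {s : Memory} {a q : List ℕ} (hQ : Holds (s.arr aQueue) (a ++ q))
    (hW : s.reg rW = (a ++ q).length) (hJ : s.reg rJ = q.length + 1) :
    wp outputLast s fun t s' => t ≤ 30 * q.length + 20 ∧ Holds (s'.arr aOut) q.reverse ∧
      s'.reg rK = q.length := by
  simp only [outputLast, wp_seq, wp_assign]
  refine wp_loop q.length (fun i t s' => t ≤ 30 * i ∧ s'.reg rI = i ∧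
    s'.reg rW + i = (a ++ q).length ∧ Holds (s'.arr aOut) (q.reverse.take i)) ?_ ?_ ?_
  · exact ⟨Nat.zero_le _, by simp, by simp [hW], by simp [Holds]⟩
  · rintro i t s₁ hi hF ⟨ht, hI, hW₁, hO⟩
    have hJ₁ := hF.reg rJ (by decide)
    have hQ₁ := hF.arr aQueue (by decide)
    simp only [Memory.reg_setReg, Memory.arr_setReg, Nat.reduceEqDiff, if_false, hJ] at hJ₁ hQ₁
    rw [List.length_append] at hW₁
    refine ⟨by simp [hI, hJ₁, hi], ?_⟩
    simp only [wp_seq, wp_assign, wp_store, Arith.eval, Arith.cost, Test.cost, Memory.reg_setReg,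
      Memory.arr_setReg, Memory.reg_setArr, Memory.arr_setArr, Nat.reduceEqDiff, if_true,
      if_false, hI, hQ₁, true_and]
    refine ⟨by omega, by rw [List.length_append]; omega, ?_⟩
    have hi' : i < q.reverse.length := by simpa using hi
    have hget : s.arr aQueue (s₁.reg rW - 1) = q.reverse[i] := by
      have h1 : s₁.reg rW - 1 = a.length + (q.length - 1 - i) := by omega
      have h2 : Holds (s.arr aQueue) (a ++ q ++ []) := by simpa using hQ
      rw [h1, h2.segment _ (by omega), List.getElem_reverse]
    have htake : q.reverse.take (i + 1) = q.reverse.take i ++ [q.reverse[i]] :=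
      (List.take_append_getElem hi').symm
    have := hO.push (q.reverse[i])
    rw [List.length_take, min_eq_left hi'.le] at this
    rw [htake, hget]
    exact this
  · rintro t s₁ hF ⟨ht, hI, hW₁, hO⟩
    have hJ₁ := hF.reg rJ (by decide)
    simp only [Memory.reg_setReg, Nat.reduceEqDiff, if_false, hJ] at hJ₁
    rw [List.take_of_length_le (by simp)] at hO
    refine ⟨by simp [hI, hJ₁], ?_⟩
    simp only [Arith.eval, Arith.cost, Test.cost, Memory.reg_setReg, Memory.arr_setReg, if_true,
      hI]
    exact ⟨by omega, hO, trivial⟩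

/-! ### From `Fin n` to natural numbers -/

/-- The graph on `ℕ` with the edges of a graph on `Fin n`. -/
def natGraph {n : ℕ} (G : SimpleGraph (Fin n)) : SimpleGraph ℕ := G.map Fin.valEmbedding

section Transfer

variable {n k : ℕ} {G : SimpleGraph (Fin n)} {σ : Fin n ≃ Fin n}

theorem natGraph_adj {u v : Fin n} : (natGraph G).Adj u v ↔ G.Adj u v :=
  SimpleGraph.map_adj_apply (f := Fin.valEmbedding)

theorem natGraph_adj_iff {x y : ℕ} :
    (natGraph G).Adj x y ↔ ∃ (hx : x < n) (hy : y < n), G.Adj ⟨x, hx⟩ ⟨y, hy⟩ := by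
  constructor
  · intro h
    obtain ⟨u, v, huv, rfl, rfl⟩ := (SimpleGraph.map_adj _ _ _ _).mp h
    exact ⟨u.2, v.2, huv⟩
  · rintro ⟨hx, hy, h⟩
    exact natGraph_adj.mpr h

/-- The function on `ℕ` given by a permutation of `Fin n`. -/
def natPerm (σ : Fin n ≃ Fin n) (i : ℕ) : ℕ := if h : i < n then σ ⟨i, h⟩ else 0

theorem natPerm_val (σ : Fin n ≃ Fin n) (i : Fin n) : natPerm σ i = σ i := by
  simp [natPerm]

theorem natPerm_lt (σ : Fin n ≃ Fin n) {i : ℕ} (h : i < n) : natPerm σ i < n := by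
  lift i to Fin n using h
  rw [natPerm_val]; exact (σ i).2

theorem natPerm_symm (σ : Fin n ≃ Fin n) {i : ℕ} (h : i < n) :
    natPerm σ.symm (natPerm σ i) = i := by
  lift i to Fin n using h
  rw [natPerm_val, natPerm_val, Equiv.symm_apply_apply]

theorem natPerm_symm' (σ : Fin n ≃ Fin n) {i : ℕ} (h : i < n) :
    natPerm σ (natPerm σ.symm i) = i := natPerm_symm σ.symm h

theorem natPerm_inj (σ : Fin n ≃ Fin n) : ∀ x < n, ∀ y < n, natPerm σ x = natPerm σ y → x = y := by
  intro x hx y hy h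
  rw [← natPerm_symm σ hx, h, natPerm_symm σ hy]

theorem card_image_natPerm (σ : Fin n ≃ Fin n) {X : Finset ℕ} (hX : X ⊆ range n) :
    (X.image (natPerm σ)).card = X.card :=
  card_image_of_injOn fun x hx y hy =>
    natPerm_inj σ x (mem_range.mp (hX hx)) y (mem_range.mp (hX hy))

theorem image_natPerm_subset (σ : Fin n ≃ Fin n) {X : Finset ℕ} (hX : X ⊆ range n) :
    X.image (natPerm σ) ⊆ range n := by
  intro y hy
  obtain ⟨x, hx, rfl⟩ := mem_image.mp hy
  exact mem_range.mpr (natPerm_lt σ (mem_range.mp (hX hx)))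

theorem isClique_image_natPerm {X : Finset ℕ} (hX : X ⊆ range n)
    (h : (natGraph (G.comap σ)).IsClique (X : Set ℕ)) :
    (natGraph G).IsClique (X.image (natPerm σ) : Set ℕ) := by
  intro a ha b hb hab
  obtain ⟨x, hx, rfl⟩ := mem_image.mp (mem_coe.mp ha)
  obtain ⟨y, hy, rfl⟩ := mem_image.mp (mem_coe.mp hb)
  have hx' := mem_range.mp (hX hx)
  have hy' := mem_range.mp (hX hy)
  have := h (mem_coe.mpr hx) (mem_coe.mpr hy) fun e => hab (by rw [e])
  lift x to Fin n using hx'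
  lift y to Fin n using hy'
  rw [natPerm_val, natPerm_val, natGraph_adj]
  exact (natGraph_adj (G := G.comap σ)).mp this

theorem isClique_image_natPerm_symm {X : Finset ℕ} (hX : X ⊆ range n)
    (h : (natGraph G).IsClique (X : Set ℕ)) :
    (natGraph (G.comap σ)).IsClique (X.image (natPerm σ.symm) : Set ℕ) := by
  refine isClique_image_natPerm (G := G.comap σ) (σ := σ.symm) hX ?_
  have : (G.comap σ).comap σ.symm = G := by
    ext u v; simp
  rwa [this]

/-- A clique extendable ordering makes the graph on positions extendable in the natural order. -/
theorem extendable_natGraph (hk : 2 ≤ k) (h : CliqueOrdering.IsCliqueExtendable G σ k) :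
    Extendable (natGraph (G.comap σ)) k := by
  intro Z a b hZ ha hb hca hcb
  have hane : a ∉ Z := fun h => lt_irrefl _ (ha a h)
  have hbne : b ∉ Z := fun h => lt_irrefl _ (hb b h)
  obtain ⟨z₀, hz₀⟩ : Z.Nonempty := card_pos.mp (by omega)
  have haz : ∀ z ∈ Z, (natGraph (G.comap σ)).Adj a z := fun z hz =>
    hca (by simp) (by simp [hz]) fun e => hane (e ▸ hz)
  have hbz : ∀ z ∈ Z, (natGraph (G.comap σ)).Adj b z := fun z hz =>
    hcb (by simp) (by simp [hz]) fun e => hbne (e ▸ hz)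
  have hab : a < b := (ha z₀ hz₀).trans (hb z₀ hz₀)
  obtain ⟨han, -, -⟩ := natGraph_adj_iff.mp (haz z₀ hz₀)
  obtain ⟨hbn, -, -⟩ := natGraph_adj_iff.mp (hbz z₀ hz₀)
  have hZn : ∀ z ∈ Z, z < n := fun z hz => (natGraph_adj_iff.mp (haz z hz)).2.1
  lift a to Fin n using han
  lift b to Fin n using hbn
  have hlift : ∀ c : Fin n, (c : ℕ) ∉ Z →
      (natGraph (G.comap σ)).IsClique (insert (c : ℕ) Z : Finset ℕ) →
      G.IsNClique k ((insert c (Z.attachFin hZn)).map σ.toEmbedding) := by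
    intro c hc hcl
    refine ⟨?_, ?_⟩
    · intro x hx y hy hxy
      simp only [coe_map, Set.mem_image, mem_coe, mem_insert, mem_attachFin] at hx hy
      obtain ⟨x, hx, rfl⟩ := hx
      obtain ⟨y, hy, rfl⟩ := hy
      have hmem : ∀ x : Fin n, x = c ∨ (x : ℕ) ∈ Z → (x : ℕ) ∈ (insert (c : ℕ) Z : Finset ℕ) := by
        rintro x (rfl | hx) <;> simp [*]
      exact (natGraph_adj (G := G.comap σ)).mp (hcl (mem_coe.mpr (hmem x hx))
        (mem_coe.mpr (hmem y hy))
        fun e => hxy (by rw [Fin.ext e]))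
    · rw [card_map, card_insert_of_notMem (by simpa using hc), card_attachFin]
      omega
  have hXc := hlift a hane hca
  have hYc := hlift b hbne hcb
  set X := (insert a (Z.attachFin hZn)).map σ.toEmbedding with hX
  set Y := (insert b (Z.attachFin hZn)).map σ.toEmbedding with hY
  have memX : ∀ v, σ v ∈ X ↔ v = a ∨ (v : ℕ) ∈ Z := by intro v; simp [hX]
  have memY : ∀ v, σ v ∈ Y ↔ v = b ∨ (v : ℕ) ∈ Z := by intro v; simp [hY]
  have hne : a ≠ b := fun e => by rw [e] at hab; exact lt_irrefl _ hab
  have hXY : X \ Y = {σ a} := by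
    ext v
    obtain ⟨v, rfl⟩ := σ.surjective v
    simp only [mem_sdiff, memX, memY, mem_singleton, EmbeddingLike.apply_eq_iff_eq]
    constructor
    · tauto
    · rintro rfl; tauto
  have hYX : Y \ X = {σ b} := by
    ext v
    obtain ⟨v, rfl⟩ := σ.surjective v
    simp only [mem_sdiff, memX, memY, mem_singleton, EmbeddingLike.apply_eq_iff_eq]
    constructor
    · tauto
    · rintro rfl
      exact ⟨.inl rfl, fun h => h.elim (fun e => hne e.symm) hbne⟩
  have hinter : X ∩ Y = (Z.attachFin hZn).map σ.toEmbedding := by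
    ext v
    obtain ⟨v, rfl⟩ := σ.surjective v
    simp only [mem_inter, memX, memY]
    simp only [mem_map_equiv, mem_attachFin, Equiv.symm_apply_apply]
    constructor
    · rintro ⟨rfl | h1, h2 | h2⟩
      · exact absurd h2 hne
      all_goals assumption
    · tauto
  have hcardI : (X ∩ Y).card = k - 1 := by rw [hinter, card_map, card_attachFin, hZ]
  refine (natGraph_adj (G := G.comap σ)).mpr (h X Y (σ a) (σ b) hXc hYc ⟨?_, ?_, ?_⟩ hcardI hXY hYX
    ⟨?_, ?_⟩ ⟨?_, ?_⟩).1
  · exact card_pos.mp (by omega)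
  · rw [← sdiff_nonempty, hXY]; simp
  · rw [← sdiff_nonempty, hYX]; simp
  · exact sdiff_subset.trans subset_union_left
  · intro w hw u hu
    rw [hXY] at hw hu
    rw [mem_singleton] at hu
    subst hu
    obtain ⟨w, rfl⟩ := σ.surjective w
    simp only [mem_sdiff, mem_union, memX, memY, mem_singleton,
      EmbeddingLike.apply_eq_iff_eq] at hw
    have : a < w := by
      obtain ⟨(h1 | h1) | (rfl | h1), h2⟩ := hw
      · exact absurd h1 h2
      · exact ha _ h1
      · exact hab
      · exact ha _ h1
    simp [this.le]
  · exact sdiff_subset.trans subset_union_right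
  · intro w hw u hu
    rw [hYX] at hw hu
    rw [mem_singleton] at hu
    subst hu
    obtain ⟨w, rfl⟩ := σ.surjective w
    simp only [mem_sdiff, mem_union, memX, memY, mem_singleton,
      EmbeddingLike.apply_eq_iff_eq] at hw
    have : w < b := by
      obtain ⟨(rfl | h1) | (h1 | h1), h2⟩ := hw
      · exact hab
      · exact hb _ h1
      · exact absurd h1 h2
      · exact hb _ h1
    simp [this.le]

/-- An output list whose members form a clique, at least as large as every other clique, presents a
maximum clique of the graph. -/
theorem exists_isMaximumClique_outputs {l : List ℕ} {s : Memory} (hnd : l.Nodup)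
    (hlt : ∀ x ∈ l, x < n) (hcl : (natGraph G).IsClique (l.toFinset : Set ℕ))
    (hmax : ∀ W ⊆ range n, (natGraph G).IsClique (W : Set ℕ) → W.card ≤ l.length)
    (hO : Holds (s.arr aOut) l) (hK : s.reg rK = l.length) :
    ∃ Q : Finset (Fin n), G.IsMaximumClique Q ∧ Outputs s Q := by
  have hlt' : ∀ x ∈ l.toFinset, x < n := fun x hx => hlt x (List.mem_toFinset.mp hx)
  have hcard : (l.toFinset.attachFin hlt').card = l.length := by
    rw [card_attachFin, List.toFinset_card_of_nodup hnd]
  refine ⟨l.toFinset.attachFin hlt', ⟨?_, fun T hT => ?_⟩, ?_, fun x => ?_⟩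
  · intro u hu v hv huv
    rw [mem_coe, mem_attachFin] at hu hv
    exact natGraph_adj.mp (hcl hu hv fun e => huv (Fin.ext e))
  · rw [hcard, ← card_map Fin.valEmbedding]
    refine hmax _ (fun x hx => ?_) ?_
    · obtain ⟨v, -, rfl⟩ := mem_map.mp hx
      exact mem_range.mpr v.2
    · rw [coe_map]
      exact hT.map
  · rw [hcard, hK]
  · rw [hK]
    constructor
    · rintro ⟨i, hi, rfl⟩
      rw [hO i hi]
      have hmem : l[i] ∈ l := List.getElem_mem _
      exact ⟨⟨l[i], hlt _ hmem⟩, by simp, rfl⟩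
    · rintro ⟨v, hv, rfl⟩
      rw [mem_attachFin, List.mem_toFinset] at hv
      obtain ⟨i, hi, he⟩ := List.getElem_of_mem hv
      exact ⟨i, hi, by rw [hO i hi, he]⟩

/-! ### The table of `k`-cliques in the queue -/

/-- The clique that starts at position `c` of the queue, when the cliques in the list `L`, all of
size `k`, are stored from position `p` on. -/
def blockAt (L : List (List ℕ)) (p k c : ℕ) : List ℕ := L.getD ((c - p) / k) []

theorem blockAt_eq {L : List (List ℕ)} {p k b : ℕ} (hk : 0 < k) (hb : b < L.length) :
    blockAt L p k (p + b * k) = L[b] := by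
  rw [blockAt, Nat.add_sub_cancel_left, Nat.mul_div_cancel _ hk, List.getD_eq_getElem _ _ hb]

/-- The entries of the `b`-th clique of the queue. -/
theorem Holds.block {Q : ℕ → ℕ} {a : List ℕ} {L : List (List ℕ)} (hQ : Holds Q (a ++ L.flatten))
    (hL : ∀ q ∈ L, q.length = k) {b i : ℕ} (hb : b < L.length) (hi : i < L[b].length) :
    Q (a.length + b * k + i) = L[b][i] := by
  have hsplit : L.flatten = (L.take b).flatten ++ L[b] ++ (L.drop (b + 1)).flatten := by
    conv_lhs => rw [← List.take_append_drop b L, List.drop_eq_getElem_cons hb]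
    rw [List.flatten_append, List.flatten_cons, List.append_assoc]
  have hlen : ((L.take b).flatten).length = b * k := by
    rw [List.length_flatten, List.sum_eq_card_nsmul _ k]
    · simp [hb.le]
    · intro x hx
      obtain ⟨q, hq, rfl⟩ := List.mem_map.mp hx
      exact hL q (List.mem_of_mem_take hq)
  rw [hsplit] at hQ
  have h2 : Holds Q ((a ++ (L.take b).flatten) ++ L[b] ++ (L.drop (b + 1)).flatten) := by
    simpa using hQ
  have := h2.segment i hi
  rwa [List.length_append, hlen] at this

/-- The cliques in `L`, read as sets of positions and named by where they start in the queue. -/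
theorem cliqueTable_of_list {L : List (List ℕ)} {p : ℕ} (hk : 2 ≤ k)
    (hE : CliqueOrdering.IsCliqueExtendable G σ k)
    (hL : ∀ q ∈ L, (natGraph G).IsNClique k q.toFinset ∧ ∀ x ∈ q, x < n)
    (hcomplete : ∀ X, (natGraph G).IsNClique k X → X ⊆ range n → ∃ q ∈ L, q.toFinset = X) :
    CliqueTable (natGraph (G.comap σ)) k n ((range L.length).image fun b => p + b * k)
      fun c => (blockAt L p k c).toFinset.image (natPerm σ.symm) := by
  have hblock : ∀ c ∈ (range L.length).image fun b => p + b * k, blockAt L p k c ∈ L := by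
    intro c hc
    obtain ⟨b, hb, rfl⟩ := mem_image.mp hc
    rw [blockAt_eq (by omega) (mem_range.mp hb)]
    exact List.getElem_mem _
  have hsub : ∀ q ∈ L, q.toFinset ⊆ range n := fun q hq x hx =>
    mem_range.mpr ((hL q hq).2 x (List.mem_toFinset.mp hx))
  refine ⟨hk, extendable_natGraph hk hE, fun c hc => ?_, fun c hc => ?_, fun X hX hXc => ?_⟩
  · have hq := hblock c hc
    exact ⟨isClique_image_natPerm_symm (hsub _ hq) (hL _ hq).1.isClique,
      by rw [card_image_natPerm _ (hsub _ hq), (hL _ hq).1.card_eq]⟩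
  · exact image_natPerm_subset _ (hsub _ (hblock c hc))
  · obtain ⟨q, hq, hqX⟩ := hcomplete (X.image (natPerm σ))
      ⟨isClique_image_natPerm hX hXc.isClique, by rw [card_image_natPerm _ hX, hXc.card_eq]⟩
      (image_natPerm_subset σ hX)
    obtain ⟨b, hb, rfl⟩ := List.getElem_of_mem hq
    refine ⟨p + b * k, mem_image.mpr ⟨b, mem_range.mpr hb, rfl⟩, ?_⟩
    rw [blockAt_eq (by omega) hb, hqX, image_image]
    conv_rhs => rw [← image_id (s := X)]
    exact image_congr fun x hx => natPerm_symm σ (mem_range.mp (hX hx))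

/-- Build the incidence lists of the `k`-cliques, run the dynamic program and output the clique. -/
def searchLarge : Program := buildIncidence ;; process ;; traceBack

/-- The queue holds some list `a`, followed by the list `L` of all `k`-cliques. -/
theorem wp_searchLarge {s : Memory} {a : List ℕ} {L : List (List ℕ)} (hk : 2 ≤ k)
    (hE : CliqueOrdering.IsCliqueExtendable G σ k)
    (hL : ∀ q ∈ L, (natGraph G).IsNClique k q.toFinset ∧ (∀ x ∈ q, x < n) ∧ q.Nodup ∧
      q.length = k)
    (hcomplete : ∀ X, (natGraph G).IsNClique k X → X ⊆ range n → ∃ q ∈ L, q.toFinset = X)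
    (hne : L ≠ []) (hQ : Holds (s.arr aQueue) (a ++ L.flatten)) (hP : s.reg rP = a.length)
    (hW : s.reg rW = a.length + L.length * k) (hK : s.reg rK = k) (hn : s.reg rN = n)
    (hord : s.arr aOrd = natPerm σ) (hh : s.arr aIncHead = fun _ => 0)
    (h1 : s.arr aCount = fun _ => 0) (h2 : s.arr aNameA = fun _ => 0)
    (h3 : s.arr aNameB = fun _ => 0) (h4 : s.arr aStamp = fun _ => 0)
    (h5 : s.arr aGain = fun _ => 0) :
    wp searchLarge s fun t s' => t ≤ 400 * (L.length * k) + 100 * n + 100 * k + 100 ∧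
      ∃ Q : Finset (Fin n), G.IsMaximumClique Q ∧ Outputs s' Q := by
  have hk0 : 0 < k := by omega
  generalize hpdef : a.length = p at *
  have hT := cliqueTable_of_list (p := p) hk hE (fun q hq => ⟨(hL q hq).1, (hL q hq).2.1⟩)
    hcomplete
  have hblock : ∀ b (hb : b < L.length) i (hi : i < k),
      s.arr aQueue (p + b * k + i) = L[b][i]'(by
        rw [(hL _ (List.getElem_mem hb)).2.2.2]; exact hi) := by
    intro b hb i hi
    rw [← hpdef]
    exact hQ.block (fun q hq => (hL q hq).2.2.2) hb _
  have hentry : ∀ e, p ≤ e ∧ e < p + L.length * k → ∃ b < L.length, ∃ i < k, e = p + b * k + i := by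
    rintro e ⟨he1, he2⟩
    refine ⟨(e - p) / k, ?_, (e - p) % k, Nat.mod_lt _ hk0, ?_⟩
    · rw [Nat.div_lt_iff_lt_mul hk0]; omega
    · have := Nat.div_add_mod' (e - p) k
      omega
  rw [searchLarge, wp_seq]
  refine (wp_buildIncidence hK hk0 hP hW hh).frame.mono ?_
  rintro t₁ s₁ ⟨hF₁, ht₁, hB₁, hO₁⟩
  have hord₁ : s₁.arr aOrd = natPerm σ := (hF₁.arr _ (by decide)).trans hord
  let ls : ℕ → List ℕ := fun i =>
    (downTo p (L.length * k)).filter fun e => s.arr aQueue e = natPerm σ i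
  have hmemls : ∀ i e, e ∈ ls i ↔ ∃ b, ∃ hb : b < L.length, ∃ j, ∃ hj : j < k,
      e = p + b * k + j ∧ L[b][j]'(by
        rw [(hL _ (List.getElem_mem hb)).2.2.2]; exact hj) = natPerm σ i := by
    intro i e
    simp only [ls, List.mem_filter, mem_downTo, decide_eq_true_eq]
    constructor
    · rintro ⟨he, hq⟩
      obtain ⟨b, hb, j, hj, rfl⟩ := hentry e he
      rw [hblock b hb j hj] at hq
      exact ⟨b, hb, j, hj, rfl, hq⟩
    · rintro ⟨b, hb, j, hj, rfl, hq⟩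
      rw [hblock b hb j hj]
      have : b * k + k ≤ L.length * k := by
        rw [← Nat.succ_mul]; exact Nat.mul_le_mul_right k hb
      exact ⟨by omega, hq⟩
  rw [wp_seq]
  refine (wp_process (ls := ls) (ord := natPerm σ) (P := fun c =>
    (blockAt L p k c).toFinset.image (natPerm σ.symm)) hT
    ((hF₁.reg _ (by decide)).trans hn) ((hF₁.reg _ (by decide)).trans hK)
    (fun i _ => by rw [hord₁]) (fun i _ => hB₁ _) (fun i _ => ?_) (fun i hi c => ?_)
    ((hF₁.arr _ (by decide)).trans h1) ((hF₁.arr _ (by decide)).trans h2)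
    ((hF₁.arr _ (by decide)).trans h3) ((hF₁.arr _ (by decide)).trans h4)
    ((hF₁.arr _ (by decide)).trans h5)).frame.mono ?_
  · refine List.Nodup.map_on (fun e he e' he' heq => ?_) ((nodup_downTo _ _).filter _)
    obtain ⟨b, hb, j, hj, rfl, hq⟩ := (hmemls i e).mp he
    obtain ⟨b', hb', j', hj', rfl, hq'⟩ := (hmemls i e').mp he'
    rw [hO₁ b hb j hj, hO₁ b' hb' j' hj'] at heq
    have hbb : b = b' := Nat.eq_of_mul_eq_mul_right hk0 (by omega)
    subst hbb
    have := ((hL _ (List.getElem_mem hb)).2.2.1.getElem_inj_iff).mp (hq.trans hq'.symm)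
    rw [this]
  · simp only [List.mem_map, hmemls, mem_image, mem_range, List.mem_toFinset]
    constructor
    · rintro ⟨e, ⟨b, hb, j, hj, rfl, hq⟩, rfl⟩
      rw [hO₁ b hb j hj]
      refine ⟨⟨b, hb, rfl⟩, L[b][j]'(by rw [(hL _ (List.getElem_mem hb)).2.2.2]; exact hj), ?_, ?_⟩
      · rw [blockAt_eq hk0 hb]; exact List.getElem_mem _
      · rw [hq, natPerm_symm σ hi]
    · rintro ⟨⟨b, hb, rfl⟩, v, hv, rfl⟩
      rw [blockAt_eq hk0 hb] at hv
      have hLb := hL _ (List.getElem_mem hb)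
      obtain ⟨j, hj, rfl⟩ := List.getElem_of_mem hv
      rw [hLb.2.2.2] at hj
      refine ⟨p + b * k + j, ⟨b, hb, j, hj, rfl, ?_⟩, hO₁ b hb j hj⟩
      rw [natPerm_symm' σ (hLb.2.1 _ hv)]
  rintro t₂ s₂ ⟨hF₂, ht₂, φ, hInv⟩
  have hCs : ((range L.length).image fun b => p + b * k).Nonempty :=
    ⟨p + 0 * k, mem_image.mpr ⟨0, mem_range.mpr (List.length_pos_iff.mpr hne), rfl⟩⟩
  have hQ₂ : s₂.arr aQueue = s.arr aQueue :=
    (hF₂.arr _ (by decide)).trans (hF₁.arr _ (by decide))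
  refine (wp_traceBack (pl := fun c => (blockAt L p k c).map (natPerm σ.symm)) hT hInv
    ((hF₂.reg _ (by decide)).trans ((hF₁.reg _ (by decide)).trans hK)) (natPerm_inj σ)
    (hInv.top_ne_zero hT hCs) fun c hc => ?_).mono ?_
  · obtain ⟨b, hb, rfl⟩ := mem_image.mp hc
    have hb := mem_range.mp hb
    have hLb := hL _ (List.getElem_mem hb)
    simp only [blockAt_eq hk0 hb]
    refine ⟨?_, ?_, fun j hj => ?_⟩
    · exact List.Nodup.map_on (fun x hx y hy =>
        natPerm_inj σ.symm x (hLb.2.1 x hx) y (hLb.2.1 y hy)) hLb.2.2.1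
    · ext x; simp
    · rw [List.length_map, hLb.2.2.2] at hj
      rw [hQ₂, hblock b hb j hj, List.getElem_map, natPerm_symm' σ (hLb.2.1 _ (List.getElem_mem _))]
  · rintro t₃ s₃ ⟨ht₃, l, hl1, hl2, hl3, hl4, hl5, hl6⟩
    have hlsub : l.toFinset ⊆ range n := fun x hx => mem_range.mpr (hl2 x (List.mem_toFinset.mp hx))
    have hllen : l.length ≤ n := by
      rw [← List.toFinset_card_of_nodup hl1]
      simpa using card_le_card hlsub
    refine ⟨?_, ?_⟩
    · have hsum : ∑ i ∈ range n, (ls i).length ≤ L.length * k := by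
        have := sum_length_filter_le (s.arr aQueue) (natPerm σ) (natPerm_inj σ)
          (downTo p (L.length * k))
        rwa [length_downTo] at this
      rw [sum_add_distrib, ← mul_sum, sum_const, card_range, smul_eq_mul] at ht₂
      omega
    · refine exists_isMaximumClique_outputs (l := l.map (natPerm σ)) ?_ ?_ ?_ ?_ hl5
        (by simpa using hl6)
      · exact List.Nodup.map_on (fun x hx y hy =>
          natPerm_inj σ x (hl2 x hx) y (hl2 y hy)) hl1
      · intro x hx
        obtain ⟨y, hy, rfl⟩ := List.mem_map.mp hx
        exact natPerm_lt σ (hl2 y hy)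
      · have := isClique_image_natPerm hlsub hl3
        convert this using 2
        ext x; simp
      · intro W hW hcl
        have := hInv.card_le hT (image_natPerm_subset σ.symm hW)
          (isClique_image_natPerm_symm hW hcl)
        rw [card_image_natPerm _ hW] at this
        rw [List.length_map, hl4]
        exact this

end Transfer

/-! ### The whole program -/

/-- Orient the graph by degrees, enumerate the cliques of size at most `k`, and search for a larger
clique if there are cliques of size `k`. -/
def searchProgram : Program :=
  countDegrees ;; orient ;; enumerate ;; .cond (.lt (.var rP) (.var rW)) searchLarge outputLast

section Input

variable {n k : ℕ} {G : SimpleGraph (Fin n)} {σ : Fin n ≃ Fin n} {es : List (Fin n × Fin n)}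

theorem input_arr_aFst {e : ℕ} (he : e < es.length) : (input k σ es).arr aFst e = (es[e]).1 := by
  simp [input, he]

theorem input_arr_aSnd {e : ℕ} (he : e < es.length) : (input k σ es).arr aSnd e = (es[e]).2 := by
  simp [input, he]

theorem edgeTable_input (hes : ListsEdges G es) :
    EdgeTable (natGraph G) n es.length ((input k σ es).arr aFst) ((input k σ es).arr aSnd) where
  lt_of_adj h := (natGraph_adj_iff.mp h).1
  adj_iff {x y} := by
    constructor
    · intro h
      obtain ⟨hx, hy, h⟩ := natGraph_adj_iff.mp h
      obtain ⟨e, he, heq⟩ := List.mem_map.mp ((hes.2 _ _).mp h)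
      obtain ⟨i, hi, rfl⟩ := List.getElem_of_mem he
      refine ⟨i, hi, ?_⟩
      rw [input_arr_aFst hi, input_arr_aSnd hi]
      simpa using congrArg (Sym2.map Fin.val) heq
    · rintro ⟨e, he, heq⟩
      rw [input_arr_aFst he, input_arr_aSnd he] at heq
      have hadj : G.Adj es[e].1 es[e].2 :=
        (hes.2 _ _).mpr (List.mem_map.mpr ⟨es[e], List.getElem_mem he, rfl⟩)
      have := natGraph_adj.mpr hadj
      rwa [← SimpleGraph.mem_edgeSet, heq, SimpleGraph.mem_edgeSet] at this
  inj e he e' he' heq := by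
    rw [input_arr_aFst he, input_arr_aSnd he, input_arr_aFst he', input_arr_aSnd he'] at heq
    have h : s(es[e].1, es[e].2) = s(es[e'].1, es[e'].2) :=
      Sym2.map.injective Fin.val_injective (by simpa using heq)
    have := (hes.1.getElem_inj_iff (hi := by simpa using he) (hj := by simpa using he')).mp
      (by simpa using h)
    exact this

theorem ncard_edgeSet (hes : ListsEdges G es) : G.edgeSet.ncard = es.length := by
  have : G.edgeSet = ((es.map fun e => s(e.1, e.2)).toFinset : Set (Sym2 (Fin n))) := by
    ext e
    induction e with
    | _ u v =>
      rw [SimpleGraph.mem_edgeSet, hes.2, mem_coe, List.mem_toFinset]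
  rw [this, Set.ncard_coe_finset, List.toFinset_card_of_nodup hes.1, List.length_map]

/-- The enumeration stops with the first `N` for which there are no cliques of size `N + 1`
or `N + 1 = k`. -/
theorem exists_last_level (out : ℕ → List ℕ) (n : ℕ) (hk : 1 ≤ k) :
    ∃ N, N + 1 ≤ k ∧ (∀ i < N, cliqueLevel out n i ≠ []) ∧
      (N + 1 = k ∨ cliqueLevel out n N = []) := by
  have hex : ∃ j, j + 1 = k ∨ cliqueLevel out n j = [] := ⟨k - 1, .inl (by omega)⟩
  classical
  refine ⟨Nat.find hex, ?_, fun i hi h => Nat.find_min hex hi (.inr h), Nat.find_spec hex⟩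
  have := Nat.find_min' hex (m := k - 1) (.inl (by omega))
  omega

/-- If there are cliques of size `N` but none of size `N + 1`, then the last clique in the queue is
a maximum clique. -/
theorem wp_outputLast_maximum {β : Type*} [LinearOrder β] {κ : ℕ → β} {out : ℕ → List ℕ} {N : ℕ}
    {s : Memory} (hO : IsOrientation (natGraph G) n κ out) (hne : cliqueLevel out n N ≠ [])
    (hempty : cliqueLevel out n (N + 1) = [])
    (hQ : Holds (s.arr aQueue) (levelsBelow out n (N + 1 + 1)))
    (hW : s.reg rW = (levelsBelow out n (N + 1 + 1)).length) (hJ : s.reg rJ = N + 1 + 1) :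
    wp outputLast s fun t s' => t ≤ 30 * (N + 1) + 20 ∧
      ∃ Q : Finset (Fin n), G.IsMaximumClique Q ∧ Outputs s' Q := by
  obtain ⟨L, q, hLq⟩ : ∃ L q, cliqueLevel out n N = L ++ [q] :=
    ⟨_, _, (List.dropLast_append_getLast hne).symm⟩
  have hq : q ∈ cliqueLevel out n N := by simp [hLq]
  have hlen := length_of_mem_cliqueLevel hq
  have hlev : levelsBelow out n (N + 1 + 1) = (levelsBelow out n N ++ L.flatten) ++ q := by
    rw [levelsBelow, hempty, levelsBelow, hLq]
    simp
  rw [hlev] at hQ hW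
  refine (wp_outputLast hQ hW (by rw [hJ, hlen])).mono ?_
  rintro t s' ⟨ht, hO', hK⟩
  rw [hlen] at ht
  refine ⟨ht, exists_isMaximumClique_outputs (l := q.reverse)
    (List.nodup_reverse.mpr (hO.nodup_of_mem hq))
    (fun x hx => (hO.pairwise hq).2 x (by simpa using hx))
    ?_ (fun W hW hcl => ?_) hO' (by simpa using hK)⟩
  · rw [List.toFinset_reverse]
    exact (hO.isNClique hq).isClique
  · rw [List.length_reverse, hlen]
    by_contra hlt
    obtain ⟨X, hXW, hX⟩ := exists_subset_card_eq (s := W) (n := N + 1 + 1) (by omega)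
    obtain ⟨q', hq', -⟩ := hO.exists_of_isNClique ⟨hcl.subset (coe_subset.mpr hXW), hX⟩
      (hXW.trans hW)
    simp [hempty] at hq'

/-- The program finds a maximum clique in time `O(k r ^ k)`, where `r = √m`. -/
theorem wp_searchProgram {r : ℝ} (hk : 2 ≤ k) (hn : 0 < n) (hiso : ∀ v, ∃ w, G.Adj v w)
    (hE : CliqueOrdering.IsCliqueExtendable G σ k) (hes : ListsEdges G es)
    (hr0 : 0 ≤ r) (hr : r ^ 2 = es.length) :
    wp searchProgram (input k σ es) fun t s' => (t : ℝ) ≤ 20000 * (k * r ^ k) ∧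
      ∃ Q : Finset (Fin n), G.IsMaximumClique Q ∧ Outputs s' Q := by
  have hT : EdgeTable (natGraph G) n es.length ((input k σ es).arr aFst)
    ((input k σ es).arr aSnd) := edgeTable_input hes
  have hnm : n ≤ 2 * es.length := by
    refine hT.le_two_mul fun v hv => ?_
    obtain ⟨w, hw⟩ := hiso ⟨v, hv⟩
    exact ⟨w, natGraph_adj.mpr hw⟩
  have hlen := fun v => hT.length_outList_le_sqrt v
  generalize hdeg : endCount ((input k σ es).arr aFst) ((input k σ es).arr aSnd) es.length = deg
    at hlen
  have hO := hT.isOrientation deg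
  have hsum := hT.sum_length_outList deg
  generalize hout : outList ((input k σ es).arr aFst) ((input k σ es).arr aSnd) deg es.length = out
    at hlen hO hsum
  have hm1 : (1 : ℝ) ≤ es.length := by exact_mod_cast (by omega : 1 ≤ es.length)
  have hr1 : 1 ≤ r := by nlinarith
  have hDr : (Nat.sqrt (2 * es.length) : ℝ) ≤ 2 * r := by
    have h : ((Nat.sqrt (2 * es.length) * Nat.sqrt (2 * es.length) : ℕ) : ℝ) ≤
        (2 * es.length : ℕ) := Nat.cast_le.mpr (Nat.sqrt_le _)
    push_cast at h
    nlinarith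
  -- the enumeration stops at level `N`, and every level below is not empty
  obtain ⟨N, hNk, hlow, hlast⟩ := exists_last_level (k := k) out n (by omega)
  have hR1 : 1 ≤ r ^ k := one_le_pow₀ hr1
  have hmR : (es.length : ℝ) ≤ r ^ k := by rw [← hr]; exact pow_le_pow_right₀ hr1 hk
  have hnR : (n : ℝ) ≤ 2 * r ^ k := by
    have : (n : ℝ) ≤ 2 * es.length := by exact_mod_cast hnm
    linarith
  have hlevels : ((∑ i ∈ range N, levelTime out n i : ℕ) : ℝ) ≤ k * (10000 * r ^ k) := by
    push_cast
    calc ∑ i ∈ range N, (levelTime out n i : ℝ) ≤ ∑ _i ∈ range N, 10000 * r ^ k := by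
          refine sum_le_sum fun i hi => ?_
          refine (hO.levelTime_le hsum hlen hr hr1 hDr hnm i).trans ?_
          have := mem_range.mp hi
          gcongr
          omega
      _ = N * (10000 * r ^ k) := by rw [sum_const, card_range, nsmul_eq_mul]
      _ ≤ k * (10000 * r ^ k) := by
          have : (N : ℝ) ≤ k := by exact_mod_cast (by omega : N ≤ k)
          gcongr
  have hk2 : (2 : ℝ) ≤ k := by exact_mod_cast hk
  have hkR : 2 * r ^ k ≤ k * r ^ k := by gcongr
  have hkk : (k : ℝ) ≤ k * r ^ k := le_mul_of_one_le_right (by linarith) hR1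
  rw [searchProgram, wp_seq]
  refine (wp_countDegrees rfl).frame.mono ?_
  rintro t₁ s₁ ⟨hF₁, ht₁, hdeg₁⟩
  have hm₁ : s₁.reg rM = es.length := hF₁.reg _ (by decide)
  rw [wp_seq]
  refine (wp_orient (hF₁.arr aHead (by decide)) (hF₁.arr aFst (by decide))
    (hF₁.arr aSnd (by decide)) (hdeg₁.trans hdeg)).frame.mono ?_
  rintro t₂ s₂ ⟨hF₂, ht₂, hB, hTgt⟩
  rw [hm₁] at ht₂ hB hTgt
  have hHas : HasOut s₂ out := by rw [← hout]; exact hasOut_outList hB hTgt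
  rw [wp_seq]
  refine (wp_enumerate (k := k) (n := n) hHas
    ((hF₂.reg _ (by decide)).trans (hF₁.reg _ (by decide)))
    ((hF₂.reg _ (by decide)).trans (hF₁.reg _ (by decide)))
    ((hF₂.arr _ (by decide)).trans (hF₁.arr _ (by decide))) hNk hlow hlast).frame.mono ?_
  rintro t₃ s₃ ⟨hF₃, ht₃, hQ, hP, hW, hJ⟩
  have hreg : ∀ x, x ∉ (countDegrees ;; orient ;; enumerate).regs →
      s₃.reg x = (input k σ es).reg x := fun x hx => by
    simp only [Program.regs, List.mem_append, not_or] at hx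
    exact (hF₃.reg x hx.2.2).trans ((hF₂.reg x hx.2.1).trans (hF₁.reg x hx.1))
  have harr : ∀ a, a ∉ (countDegrees ;; orient ;; enumerate).arrs →
      s₃.arr a = (input k σ es).arr a := fun a ha => by
    simp only [Program.arrs, List.mem_append, not_or] at ha
    exact (hF₃.arr a ha.2.2).trans ((hF₂.arr a ha.2.1).trans (hF₁.arr a ha.1))
  have hlev : (levelsBelow out n (N + 1)).length =
      (levelsBelow out n N).length + (cliqueLevel out n N).length * (N + 1) := by
    rw [levelsBelow, List.length_append, length_flatten_cliqueLevel]
  have ht₁' : (t₁ : ℝ) ≤ 30 * es.length + 10 := by exact_mod_cast ht₁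
  have ht₂' : (t₂ : ℝ) ≤ 60 * es.length + 10 := by exact_mod_cast ht₂
  have ht₃' : (t₃ : ℝ) ≤ 20 * n + 40 + (∑ i ∈ range N, levelTime out n i : ℕ) := by
    exact_mod_cast ht₃
  rw [wp_cond]
  simp only [Test.Holds, Arith.eval, Test.cost, Arith.cost, hP, hW]
  refine ⟨fun hlt => ?_, fun hlt => ?_⟩
  · have hne : cliqueLevel out n N ≠ [] := by
      intro h
      rw [hlev, h] at hlt
      simp at hlt
    obtain rfl : N + 1 = k := hlast.resolve_right hne
    obtain ⟨i, rfl⟩ : ∃ i, N = i + 1 := ⟨N - 1, by omega⟩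
    refine (wp_searchLarge hk hE (fun q hq => ⟨hO.isNClique hq, (hO.pairwise hq).2,
      hO.nodup_of_mem hq, length_of_mem_cliqueLevel hq⟩)
      (fun X hX hXn => hO.exists_of_isNClique hX hXn) hne hQ hP (hW.trans hlev)
      (hreg _ (by decide)) (hreg _ (by decide)) (harr _ (by decide)) (harr _ (by decide))
      (harr _ (by decide)) (harr _ (by decide)) (harr _ (by decide)) (harr _ (by decide))
      (harr _ (by decide))).mono ?_
    rintro t₄ s₄ ⟨ht₄, hQ'⟩
    refine ⟨?_, hQ'⟩
    have h1 := hO.length_mul_sq_le hsum hlen hr hr0 hDr i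
    have ht₄' : (t₄ : ℝ) ≤ 400 * ((cliqueLevel out n (i + 1)).length * (i + 1 + 1)) + 100 * n +
      100 * (i + 1 + 1) + 100 := by exact_mod_cast ht₄
    have h2 : ((cliqueLevel out n (i + 1)).length : ℝ) * (i + 1 + 1) ≤ 11 * r ^ (i + 1 + 1) := by
      refine le_trans ?_ h1
      have : (i + 1 + 1 : ℝ) ≤ (i + 2) ^ 2 := by
        have : (0 : ℝ) ≤ i := Nat.cast_nonneg i
        nlinarith
      gcongr
    push_cast at *
    linarith
  · have hempty : cliqueLevel out n N = [] := by
      by_contra h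
      have : 0 < (cliqueLevel out n N).length * (N + 1) :=
        Nat.mul_pos (List.length_pos_iff.mpr h) (by omega)
      omega
    have hN0 : N ≠ 0 := by
      rintro rfl
      rw [cliqueLevel, List.map_eq_nil_iff, List.range_eq_nil] at hempty
      omega
    obtain ⟨i, rfl⟩ := Nat.exists_eq_succ_of_ne_zero hN0
    refine (wp_outputLast_maximum hO (hlow i (by omega)) hempty hQ hW hJ).mono ?_
    rintro t₄ s₄ ⟨ht₄, hQ'⟩
    refine ⟨?_, hQ'⟩
    have ht₄' : (t₄ : ℝ) ≤ 30 * (i + 1) + 20 := by exact_mod_cast ht₄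
    have hik : (i : ℝ) + 1 ≤ k := by exact_mod_cast (by omega : i + 1 ≤ k)
    push_cast at *
    linarith

end Input

end Ram

theorem mainTheorem6 :
    ∃ (P : Ram.Program) (C : ℝ),
      ∀ (n k : ℕ) (G : SimpleGraph (Fin n)) (σ : Fin n ≃ Fin n) (es : List (Fin n × Fin n)),
        2 ≤ k → 0 < n → (∀ v, ∃ w, G.Adj v w) →
        CliqueOrdering.IsCliqueExtendable G σ k →
        MaxCliqueProblem.ListsEdges G es →
        ∃ (t : ℕ) (s : Ram.Memory) (Q : Finset (Fin n)),
          Ram.Run P (MaxCliqueProblem.input k σ es) t s ∧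
          (t : ℝ) ≤ C * ((k : ℝ) * (G.edgeSet.ncard : ℝ) ^ ((k : ℝ) / 2)) ∧
          G.IsMaximumClique Q ∧ MaxCliqueProblem.Outputs s Q := by
  refine ⟨Ram.searchProgram, 20000, fun n k G σ es hk hn hiso hE hes => ?_⟩
  have hm : (0 : ℝ) ≤ es.length := Nat.cast_nonneg _
  obtain ⟨t, s, hrun, ht, Q, hQ, hout⟩ := Ram.wp_searchProgram hk hn hiso hE hes
    (Real.sqrt_nonneg es.length) (Real.sq_sqrt hm)
  refine ⟨t, s, Q, hrun, ?_, hQ, hout⟩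
  rwa [Ram.ncard_edgeSet hes, div_eq_inv_mul, Real.rpow_mul hm, Real.rpow_natCast, ← one_div,
    ← Real.sqrt_eq_rpow]
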